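/- Let $n\ge 3$ and $2\le k\le n-1$, and write points of $\mathbb{R}^n=\mathbb{R}^{n-k}\times\mathbb{R}^k$ as $(x'',x')$. Definitions. For a set $\Omega\subset\mathbb{R}^{n-k}$ (the base) and a function $f:\Omega\to[0,\infty)$ (the warping function), the spherical array $\Omega\times_f S^{k-1}$ is $\{(x'',x')\in\Omega\times\mathbb{R}^k:\|x'\|^2=f(x'')^2\}$. A set $H\subset\mathbb{R}^n$ satisfies the Archimedean projection property (APP) with constant $C\in(0,\infty)$ if, with $\pi(x'',x')=x''$, one has $\mathrm{Vol}_{n-1}(H\cap\pi^{-1}(U))=C\cdot\mathrm{Vol}_{n-k}(U)$ for every Lebesgue measurable $U\subset\pi(H)$. A $k$-Archimedean spherical array is a spherical array $H$ that satisfies the APP with some constant, is a closed (compact, without boundary) embedded $C^2$ hypersurface of $\mathbb{R}^n$, and is the boundary of a strictly convex body. Let $$M_k=\int_0^1\frac{t^{k-1}}{\sqrt{1-t^{2k-2}}}\,dt,$$ and let $f_k:[0,M_k]\to[0,1]$ be the inverse of $y\mapsto\int_0^y\frac{t^{k-1}}{\sqrt{1-t^{2k-2}}}\,dt$. Let $B$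 be the closed ball of radius $M_k$ centred at the origin of $\mathbb{R}^{n-k}$, let $\omega(x'')=\mathrm{dist}(x'',\partial B)$, and put $\mathscr{A}_k^{n-1}=B\times_{f_k\circ\omega}S^{k-1}$. Theorem. (i) $\mathscr{A}_k^{n-1}$ is a $k$-Archimedean spherical array: it is closed, of class $C^2$, bounds a strictly convex region, and satisfies the APP, with constant $\mathrm{Vol}(S^{k-1}(1))$. (ii) Up to scaling (and translation in the base space) it is the only one: a set $H\subset\mathbb{R}^n$ is a $k$-Archimedean spherical array if and only if $H=(c,0)+R\,\mathscr{A}_k^{n-1}$ for some $R>0$ and some $c\in\mathbb{R}^{n-k}$. (iii) A spherical array $\Omega\times_f S^{k-1}$ is a $k$-Archimedean spherical array with constant $\mathrm{Vol}(S^{k-1}(1))$ if and only if $\Omega$ is a closed ball of radius $M_k$ in $\mathbb{R}^{n-k}$ and $f=f_k\circ\omega_\Omega$ on $\Omega$, where $\omega_\Omega(x'')=\mathrm{dist}(x'',\partial\Omega)$. -/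

import Mathlib

open Set MeasureTheory
open scoped ENNReal

noncomputable section

/-- Euclidean space `ℝ^d`. -/
abbrev Euc (d : ℕ) : Type := EuclideanSpace ℝ (Fin d)

/-- The orthogonal decomposition `ℝ^(m+k) = ℝ^m × ℝ^k`, with the Euclidean norm. A point `p` has
components `p.fst` (written `x''`) in `ℝ^m` and `p.snd` (written `x'`) in `ℝ^k`. -/
abbrev Amb (m k : ℕ) : Type := WithLp 2 (Euc m × Euc k)

/-- The orthogonal projection `ℝ^m × ℝ^k → ℝ^m` of codimension `k`. -/
def baseProj (m k : ℕ) (p : Amb m k) : Euc m := p.fst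

/-- The spherical array over the base `Ω ⊆ ℝ^m` with warping function `f`: over each `x'' ∈ Ω` lies
the sphere of radius `f x''` around the origin of `ℝ^k`. -/
def sphericalArray (m k : ℕ) (Ω : Set (Euc m)) (f : Euc m → ℝ) : Set (Amb m k) :=
  {p | p.fst ∈ Ω ∧ ‖p.snd‖ ^ 2 = f p.fst ^ 2}

/-- `H` is a spherical array: some base and some nonnegative warping function produce it. -/
def IsSphericalArray (m k : ℕ) (H : Set (Amb m k)) : Prop :=
  ∃ (Ω : Set (Euc m)) (f : Euc m → ℝ), (∀ x ∈ Ω, 0 ≤ f x) ∧ H = sphericalArray m k Ω f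

/-- The `(k-1)`-dimensional volume of the unit sphere of `ℝ^k`. -/
def unitSphereVol (k : ℕ) : ℝ≥0∞ := μHE[k - 1] (Metric.sphere (0 : Euc k) 1)

/-- The Archimedean projection property of `H` for the orthogonal projection onto `ℝ^m`, with
proportionality constant `C` (positive and finite). The volume of a part of the hypersurface `H` is
its `(m+k-1)`-dimensional Hausdorff measure (normalized as Lebesgue measure); "measurable" is
Lebesgue measurable. -/
def HasAPP (m k : ℕ) (C : ℝ≥0∞) (H : Set (Amb m k)) : Prop :=
  C ≠ 0 ∧ C ≠ ⊤ ∧ ∀ U : Set (Euc m), U ⊆ baseProj m k '' H → NullMeasurableSet U volume →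
    μHE[m + k - 1] (H ∩ baseProj m k ⁻¹' U) = C * volume U

/-- `H` is an embedded hypersurface (without boundary) of class `C²`: near each of its points it is
the zero set of a `C²` function whose differential does not vanish there. -/
def IsC2Hypersurface (m k : ℕ) (H : Set (Amb m k)) : Prop :=
  ∀ p ∈ H, ∃ (V : Set (Amb m k)) (φ : Amb m k → ℝ), IsOpen V ∧ p ∈ V ∧ ContDiffOn ℝ 2 φ V ∧
    fderiv ℝ φ p ≠ 0 ∧ H ∩ V = {x | x ∈ V ∧ φ x = 0}

/-- `H` is the boundary of a strictly convex body. -/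
def BoundsStrictlyConvex (m k : ℕ) (H : Set (Amb m k)) : Prop :=
  ∃ K : Set (Amb m k), IsCompact K ∧ (interior K).Nonempty ∧ StrictConvex ℝ K ∧ frontier K = H

/-- `H ⊆ ℝ^m × ℝ^k` is a `k`-Archimedean spherical array with proportionality constant `C`. A closed
hypersurface is one that is compact and without boundary. -/
structure IsArchimedeanWith (m k : ℕ) (C : ℝ≥0∞) (H : Set (Amb m k)) : Prop where
  array : IsSphericalArray m k H
  app : HasAPP m k C H
  compact : IsCompact H
  strictConvex : BoundsStrictlyConvex m k H
  smooth : IsC2Hypersurface m k H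

/-- `H ⊆ ℝ^m × ℝ^k` is a `k`-Archimedean spherical array, for some proportionality constant. -/
def IsArchimedean (m k : ℕ) (H : Set (Amb m k)) : Prop :=
  ∃ C : ℝ≥0∞, IsArchimedeanWith m k C H

/-- The function `y ↦ ∫₀^y t^(k-1) / √(1 - t^(2k-2)) dt` on `[0, 1]`. -/
def scalingInv (k : ℕ) (y : ℝ) : ℝ :=
  ∫ t in (0 : ℝ)..y, t ^ (k - 1) / √(1 - t ^ (2 * k - 2))

/-- `M_k = ∫₀¹ t^(k-1) / √(1 - t^(2k-2)) dt`. -/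
def scalingMax (k : ℕ) : ℝ := scalingInv k 1

/-- The codimension `k` Archimedean scaling function `f_k : [0, M_k] → [0, 1]`, the inverse of
`scalingInv k : [0, 1] → [0, M_k]`; its values outside `[0, M_k]` are irrelevant. -/
def scalingFn (k : ℕ) : ℝ → ℝ := Function.invFunOn (scalingInv k) (Icc 0 1)

/-- Distance to the boundary of `Ω`. -/
def boundaryDist {m : ℕ} (Ω : Set (Euc m)) (x : Euc m) : ℝ := Metric.infDist x (frontier Ω)

/-- The model array: base the closed ball of radius `M_k` around the origin, warping function `f_k`
composed with the distance to the boundary. -/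
def modelArray (m k : ℕ) : Set (Amb m k) :=
  sphericalArray m k (Metric.closedBall 0 (scalingMax k))
    (fun x => scalingFn k (boundaryDist (Metric.closedBall 0 (scalingMax k)) x))

/-- The copy of `A` scaled by `R` and translated by `(c, 0)`. -/
def scaledCopy (m k : ℕ) (R : ℝ) (c : Euc m) (A : Set (Amb m k)) : Set (Amb m k) :=
  (fun p => WithLp.toLp 2 (c, (0 : Euc k)) + R • p) '' A

end

noncomputable section

open Filter
open scoped NNReal Topology

set_option linter.unusedSectionVars false

/-! ### Euclidean Hausdorff measure and near isometries -/

section NearIsometry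

variable {X Y : Type*} [MetricSpace X] [MeasurableSpace X] [BorelSpace X]
  [MetricSpace Y] [MeasurableSpace Y] [BorelSpace Y]

/-! Write `m = n - k` and `k = j + 1`. Where the warping function `f` is positive and
differentiable, the part of the array over `U` has volume `Vol(S^j) * ∫_U √(1 + |∇f|²) f^j`. With
the constant `Vol(S^j)` the projection property therefore becomes the differential equation `√(1 +
|∇f|²) f^j = 1`. Since `scalingInv` has derivative `t^j / √(1 - t^(2j))`, this says exactly that `g
= scalingInv k ∘ f` satisfies the eikonal equation `|∇g| = 1` wherever `0 < f < 1`.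

Uniqueness (`IsArrayBody.eq_model`): strict convexity makes `f` concave, positive exactly on the
interior of the base, and gives it a single maximum point `p`. There the gradient vanishes, so `f p
= 1` and `g p = M_k`. An eikonal function with one peak is the peak value minus the distance to the
peak (`le_sub_norm_of_unit_gradient`, `sub_norm_le_of_unit_gradient`); as `g` vanishes on the
boundary, the base is the ball of radius `M_k` about `p`. A general constant is reduced to this one
by a similarity, which multiplies it by `R^j`.

Existence: the model is the level set `‖x''‖ + scalingInv k ‖x'‖ = M_k`. Strict monotonicity and
strict convexity of `scalingInv` make the body strictly convex. Regularity is delicate at the rim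
`x' = 0`, where `scalingInv` is `r^k` times a smooth function of `r^(2j)`, and at `x'' = 0`, where
`M_k - scalingInv k y` is `√w` times a smooth function of `w = 1 - y^(2j)`, so that the squared
equation is smooth.

The volume density is obtained from Lipschitz comparisons (`sphereBundle_measure_near`): near a
point the bundle of spheres is mapped, with distortion at most `K`, onto the product of a linear
image of the base with a fixed sphere, and then `K` tends to `1`. -/

lemma LipschitzOnWith.euclideanHausdorffMeasure_image_le {K : ℝ≥0} {h : X → Y} {s : Set X}
    (hh : LipschitzOnWith K h s) (d : ℕ) : μHE[d] (h '' s) ≤ (K : ℝ≥0∞) ^ d * μHE[d] s := by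
  have := hh.hausdorffMeasure_image_le (d := d) (by positivity)
  rw [ENNReal.rpow_natCast] at this
  simp only [Measure.euclideanHausdorffMeasure_def, Measure.smul_apply, ENNReal.smul_def,
    smul_eq_mul]
  calc _ ≤ _ * ((K : ℝ≥0∞) ^ d * μH[d] s) := by gcongr
    _ = _ := by ring

/-- The hypothesis makes `h` injective on `s` with a `K`-Lipschitz inverse on the image. No
measurability of `s` is involved. -/
lemma euclideanHausdorffMeasure_le_image {K : ℝ≥0} {h : X → Y} {s : Set X}
    (hh : ∀ x ∈ s, ∀ y ∈ s, dist x y ≤ K * dist (h x) (h y)) (d : ℕ) :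
    μHE[d] s ≤ (K : ℝ≥0∞) ^ d * μHE[d] (h '' s) := by
  rcases s.eq_empty_or_nonempty with rfl | ⟨x₀, hx₀⟩
  · simp
  have : Nonempty X := ⟨x₀⟩
  have hinj : InjOn h s := by
    intro x hx y hy hxy
    have := hh x hx y hy
    rw [hxy, dist_self, mul_zero] at this
    exact dist_le_zero.1 this
  have hL : LipschitzOnWith K (Function.invFunOn h s) (h '' s) := by
    apply LipschitzOnWith.of_dist_le_mul
    rintro _ ⟨x, hx, rfl⟩ _ ⟨y, hy, rfl⟩
    rw [hinj.leftInvOn_invFunOn hx, hinj.leftInvOn_invFunOn hy]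
    exact hh x hx y hy
  have := hL.euclideanHausdorffMeasure_image_le d
  rwa [hinj.leftInvOn_invFunOn.image_image] at this

end NearIsometry

/-- The limit `K → 1` that turns comparisons with distortion `K` into exact inequalities between
volumes. -/
lemma ENNReal.le_of_forall_one_lt_pow_mul {a b : ℝ≥0∞} (d : ℕ)
    (h : ∀ K : ℝ≥0, 1 < K → a ≤ (K : ℝ≥0∞) ^ d * b) : a ≤ b := by
  have h1 : Tendsto (fun K : ℝ≥0 => ((K : ℝ≥0∞) ^ d) * b) (𝓝[>] 1) (𝓝 (((1 : ℝ≥0) : ℝ≥0∞) ^ d * b)) := by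
    apply ENNReal.Tendsto.mul_const _ (Or.inl (by simp))
    refine Tendsto.mono_left ?_ nhdsWithin_le_nhds
    exact ((ENNReal.continuous_pow d).comp ENNReal.continuous_coe).tendsto 1
  simp only [ENNReal.coe_one, one_pow, one_mul] at h1
  exact ge_of_tendsto h1 (by filter_upwards [self_mem_nhdsWithin] with K hK using h K hK)

/-- An inequality between measures that holds locally holds globally. -/
lemma measure_le_of_locally {X : Type*} [TopologicalSpace X] [SecondCountableTopology X]
    [MeasurableSpace X] [OpensMeasurableSpace X] (a b : Measure X) {s : Set X}
    (hs : MeasurableSet s)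
    (h : ∀ x ∈ s, ∃ N, IsOpen N ∧ x ∈ N ∧ ∀ t ⊆ N ∩ s, MeasurableSet t → a t ≤ b t) :
    a s ≤ b s := by
  classical
  choose! N hNo hxN hN using h
  -- Lindelöf gives countably many of the neighbourhoods; making them disjoint lets the local
  -- inequalities be summed.
  obtain ⟨t, hts, htc, hst⟩ := TopologicalSpace.countable_cover_nhdsWithin (f := N) (s := s)
    (fun x hx => mem_nhdsWithin_of_mem_nhds ((hNo x hx).mem_nhds (hxN x hx)))
  rcases t.eq_empty_or_nonempty with rfl | hne
  · have : s = ∅ := by simpa using hst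
    simp [this]
  obtain ⟨u, rfl⟩ := htc.exists_eq_range hne
  simp only [biUnion_range] at hst
  have hu : ∀ i, u i ∈ s := fun i => hts (mem_range_self i)
  have hm : ∀ i, MeasurableSet (s ∩ disjointed (fun i => N (u i)) i) := fun i =>
    hs.inter (MeasurableSet.disjointed (fun j => (hNo _ (hu j)).measurableSet) i)
  have hd : Pairwise (Function.onFun Disjoint fun i => s ∩ disjointed (fun i => N (u i)) i) :=
    fun i j hij => ((disjoint_disjointed (fun i => N (u i))) hij).mono inter_subset_right
      inter_subset_right
  have hU : s = ⋃ i, s ∩ disjointed (fun i => N (u i)) i := by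
    rw [← inter_iUnion, iUnion_disjointed]
    exact (inter_eq_left.2 hst).symm
  rw [hU, measure_iUnion hd hm, measure_iUnion hd hm]
  refine ENNReal.tsum_le_tsum fun i => hN (u i) (hu i) _ ?_ (hm i)
  intro x hx
  exact ⟨disjointed_subset _ i hx.2, hx.1⟩

/-! ### Products of Euclidean sets with spheres -/

section SphereProduct

open scoped RealInnerProductSpace

variable {E V : Type*} [NormedAddCommGroup E] [InnerProductSpace ℝ E] [FiniteDimensional ℝ E]
  [MeasurableSpace E] [BorelSpace E]
  [NormedAddCommGroup V] [InnerProductSpace ℝ V] [FiniteDimensional ℝ V]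
  [MeasurableSpace V] [BorelSpace V]

/-- A chord `y - z` of the sphere is orthogonal to `y + z`, hence nearly orthogonal to `p` when `y`
and `z` are near `p`. Projection to the tangent hyperplane thus loses little of its length. -/
lemma dist_le_mul_dist_orthogonalProjectionOnto_of_mem_sphere {r : ℝ} (hr : 0 < r) {K : ℝ≥0}
    (hK : 1 < K) {p : V} (hp : ‖p‖ = r) :
    ∃ δ > 0, ∀ y ∈ Metric.ball p δ, ∀ z ∈ Metric.ball p δ, ‖y‖ = r → ‖z‖ = r →
      dist y z ≤ K * dist ((ℝ ∙ p)ᗮ.orthogonalProjectionOnto y)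
        ((ℝ ∙ p)ᗮ.orthogonalProjectionOnto z) := by
  have hK' : (1 : ℝ) < K := by exact_mod_cast hK
  have hK2 : 0 < 1 - 1 / (K : ℝ) ^ 2 := by
    rw [sub_pos, div_lt_one (by positivity)]
    nlinarith
  -- This radius allows the component along `p` at most the share `1 - 1 / K²` of `‖y - z‖²`,
  -- leaving `1 / K²` for the projection.
  refine ⟨r * √(1 - 1 / (K : ℝ) ^ 2), by positivity, ?_⟩
  set δ := r * √(1 - 1 / (K : ℝ) ^ 2) with hδ
  intro y hy z hz hyr hzr
  have hδ2 : δ ^ 2 = r ^ 2 * (1 - 1 / (K : ℝ) ^ 2) := by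
    rw [hδ, mul_pow, Real.sq_sqrt hK2.le]
  have key := Submodule.norm_sq_eq_add_norm_sq_projection (𝕜 := ℝ) (y - z) (ℝ ∙ p)
  have h1 : ‖(ℝ ∙ p).orthogonalProjectionOnto (y - z)‖ = |⟪p, y - z⟫| / r := by
    rw [← Submodule.norm_coe, Submodule.coe_orthogonalProjectionOnto_apply,
      Submodule.starProjection_singleton, norm_smul, hp]
    simp only [Real.norm_eq_abs, abs_div, RCLike.ofReal_real_eq_id, id]
    rw [abs_of_pos (by positivity : 0 < r ^ 2)]
    field_simp
  have h2 : |⟪p, y - z⟫| ≤ δ * ‖y - z‖ := by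
    have e1 : ⟪y + z, y - z⟫ = 0 := by
      rw [real_inner_add_sub_eq_zero_iff, hyr, hzr]
    have e2 : ⟪p, y - z⟫ = ⟪p - (1 / 2 : ℝ) • (y + z), y - z⟫ := by
      rw [inner_sub_left, real_inner_smul_left, e1]; ring
    rw [e2]
    refine (abs_real_inner_le_norm _ _).trans ?_
    gcongr
    have e3 : p - (1 / 2 : ℝ) • (y + z) = (1 / 2 : ℝ) • ((p - y) + (p - z)) := by
      module
    rw [e3, norm_smul]
    have a1 : ‖p - y‖ < δ := by rw [← dist_eq_norm, dist_comm]; exact hy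
    have a2 : ‖p - z‖ < δ := by rw [← dist_eq_norm, dist_comm]; exact hz
    have := norm_add_le (p - y) (p - z)
    rw [Real.norm_of_nonneg (by norm_num)]
    linarith
  rw [dist_eq_norm, dist_eq_norm, ← map_sub]
  rw [h1] at key
  set a := ‖y - z‖
  set b := ‖(ℝ ∙ p)ᗮ.orthogonalProjectionOnto (y - z)‖
  have h3 : (|⟪p, y - z⟫| / r) ^ 2 ≤ (1 - 1 / (K : ℝ) ^ 2) * a ^ 2 := by
    rw [div_pow, div_le_iff₀ (by positivity)]
    calc _ ≤ (δ * a) ^ 2 := by gcongr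
      _ = _ := by rw [mul_pow, hδ2]; ring
  have h4 : a ^ 2 / (K : ℝ) ^ 2 ≤ b ^ 2 := by
    have : (1 - 1 / (K : ℝ) ^ 2) * a ^ 2 = a ^ 2 - a ^ 2 / (K : ℝ) ^ 2 := by ring
    linarith
  rw [div_le_iff₀ (by positivity)] at h4
  refine (pow_le_pow_iff_left₀ (norm_nonneg _) (by positivity) two_ne_zero).1 ?_
  rw [mul_pow]
  linarith

/-- The product of subsets of Euclidean spaces, as a subset of their Euclidean product. -/
def euclideanProd (A : Set E) (B : Set V) : Set (WithLp 2 (E × V)) :=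
  {p | p.fst ∈ A ∧ p.snd ∈ B}

lemma euclideanHausdorffMeasure_euclideanProd {d j : ℕ} (hd : Module.finrank ℝ E = d)
    (hj : Module.finrank ℝ V = j) (A : Set E) (B : Set V) :
    μHE[d + j] (euclideanProd A B) = volume A * volume B := by
  have hfin : Module.finrank ℝ (WithLp 2 (E × V)) = d + j := by
    rw [(WithLp.linearEquiv 2 ℝ (E × V)).finrank_eq, Module.finrank_prod, hd, hj]
  rw [← hfin, InnerProductSpace.euclideanHausdorffMeasure_eq_volume]
  have : euclideanProd A B = (MeasurableEquiv.toLp 2 (E × V)).symm ⁻¹' (A ×ˢ B) := rfl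
  rw [this, (WithLp.volume_preserving_symm_measurableEquiv_toLp_prod E V).measure_preimage_equiv]
  exact Measure.prod_prod A B

variable {j : ℕ}

lemma finrank_orthogonal_span_singleton_of_norm_pos (hj : Module.finrank ℝ V = j + 1) {p : V}
    (hp : p ≠ 0) : Module.finrank ℝ (ℝ ∙ p)ᗮ = j := by
  have : Fact (Module.finrank ℝ V = j + 1) := ⟨hj⟩
  exact Submodule.finrank_orthogonal_span_singleton hp

lemma volume_orthogonalProjectionOnto_image_le (hj : Module.finrank ℝ V = j + 1) {p : V}
    (hp : p ≠ 0) (t : Set V) :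
    volume ((ℝ ∙ p)ᗮ.orthogonalProjectionOnto '' t) ≤ μHE[j] t := by
  have hf := finrank_orthogonal_span_singleton_of_norm_pos hj hp
  have h := InnerProductSpace.euclideanHausdorffMeasure_eq_volume (V := (ℝ ∙ p)ᗮ)
  rw [hf] at h
  rw [← h]
  have hL : LipschitzOnWith 1 (ℝ ∙ p)ᗮ.orthogonalProjectionOnto t := by
    apply LipschitzOnWith.of_dist_le_mul
    intro x _ y _
    rw [dist_eq_norm, dist_eq_norm, ← map_sub]
    simpa using Submodule.norm_orthogonalProjectionOnto_apply_le (ℝ ∙ p)ᗮ (x - y)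
  simpa using hL.euclideanHausdorffMeasure_image_le j

lemma le_volume_orthogonalProjectionOnto_image (hj : Module.finrank ℝ V = j + 1) {p : V}
    (hp : p ≠ 0) {t : Set V} {K : ℝ≥0}
    (ht : ∀ y ∈ t, ∀ z ∈ t, dist y z ≤ K * dist ((ℝ ∙ p)ᗮ.orthogonalProjectionOnto y)
        ((ℝ ∙ p)ᗮ.orthogonalProjectionOnto z)) :
    μHE[j] t ≤ (K : ℝ≥0∞) ^ j * volume ((ℝ ∙ p)ᗮ.orthogonalProjectionOnto '' t) := by
  have hf := finrank_orthogonal_span_singleton_of_norm_pos hj hp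
  have h := InnerProductSpace.euclideanHausdorffMeasure_eq_volume (V := (ℝ ∙ p)ᗮ)
  rw [hf] at h
  rw [← h]
  exact euclideanHausdorffMeasure_le_image ht j

lemma euclideanHausdorffMeasure_sphere_lt_top (hj : Module.finrank ℝ V = j + 1) {r : ℝ}
    (hr : 0 < r) : μHE[j] (Metric.sphere (0 : V) r) < ⊤ := by
  apply (isCompact_sphere (0 : V) r).measure_lt_top_of_nhdsWithin
  intro p hp
  have hpr : ‖p‖ = r := by simpa using hp
  have hp0 : p ≠ 0 := norm_pos_iff.1 (hpr ▸ hr)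
  obtain ⟨δ, hδ, H⟩ := dist_le_mul_dist_orthogonalProjectionOnto_of_mem_sphere hr
    (K := 2) one_lt_two hpr
  refine ⟨Metric.sphere 0 r ∩ Metric.ball p δ,
    inter_mem_nhdsWithin _ (Metric.ball_mem_nhds p hδ), ?_⟩
  refine (le_volume_orthogonalProjectionOnto_image hj hp0 (K := 2) ?_).trans_lt ?_
  · intro y hy z hz
    exact H y hy.2 z hz.2 (by simpa using hy.1) (by simpa using hz.1)
  · refine ENNReal.mul_lt_top (by simp) (Bornology.IsBounded.measure_lt_top ?_)
    exact ((ℝ ∙ p)ᗮ.orthogonalProjectionOnto.lipschitz.isBounded_image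
      (Metric.isBounded_ball.subset inter_subset_right))

/-- Projection to a hyperplane does not increase measure, and the image of the sphere covers a ball
of that hyperplane. -/
lemma euclideanHausdorffMeasure_sphere_ne_zero (hj : Module.finrank ℝ V = j + 1) {r : ℝ}
    (hr : 0 < r) : μHE[j] (Metric.sphere (0 : V) r) ≠ 0 := by
  have : Nontrivial V := Module.nontrivial_of_finrank_pos (R := ℝ) (by omega)
  obtain ⟨p, hp⟩ := exists_ne (0 : V)
  have h := volume_orthogonalProjectionOnto_image_le hj hp (Metric.sphere (0 : V) r)
  refine (lt_of_lt_of_le ?_ h).ne'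
  refine (Metric.measure_ball_pos volume (0 : (ℝ ∙ p)ᗮ) hr).trans_le (measure_mono ?_)
  intro q hq
  have hq' : ‖(q : V)‖ < r := by simpa using hq
  -- The height along `p` that lifts `q` to the sphere, by Pythagoras.
  set c : ℝ := √(r ^ 2 - ‖(q : V)‖ ^ 2) / ‖p‖ with hc
  have hpq : ⟪(q : V), p⟫ = 0 := by
    have := q.2
    rw [Submodule.mem_orthogonal_singleton_iff_inner_left] at this
    exact this
  refine ⟨q + c • p, ?_, ?_⟩
  · rw [mem_sphere_zero_iff_norm, ← pow_left_inj₀ (norm_nonneg _) hr.le two_ne_zero,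
      norm_add_sq_real, inner_smul_right, hpq, norm_smul, hc]
    have : 0 ≤ r ^ 2 - ‖(q : V)‖ ^ 2 := by nlinarith [norm_nonneg (q : V)]
    rw [norm_div, norm_norm, div_mul_cancel₀ _ (norm_ne_zero_iff.2 hp), Real.norm_eq_abs, sq_abs,
      Real.sq_sqrt this]
    ring
  · rw [map_add, map_smul, Submodule.orthogonalProjectionOnto_orthogonalComplement_singleton_eq_zero]
    simp

/-- Near each of its points the sphere is almost isometric to its tangent hyperplane, so `A` times a
small cap is almost isometric to a product of Euclidean sets, where the measure is the product
Lebesgue measure. Local comparison and `K → 1` do the rest. -/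
theorem euclideanHausdorffMeasure_euclideanProd_sphere {d : ℕ} (hd : Module.finrank ℝ E = d)
    (hj : Module.finrank ℝ V = j + 1) (A : Set E) {r : ℝ} (hr : 0 < r) :
    μHE[d + j] (euclideanProd A (Metric.sphere (0 : V) r)) =
      volume A * μHE[j] (Metric.sphere (0 : V) r) := by
  -- Both sides are viewed as measures in the sphere variable. The set `A` may be non-measurable:
  -- the restriction is only evaluated on preimages of measurable sets.
  let a : Measure V := ((μHE[d + j] : Measure (WithLp 2 (E × V))).restrict
    (euclideanProd A univ)).map (fun p => p.snd)
  have hsnd : Measurable (fun p : WithLp 2 (E × V) => p.snd) := by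
    fun_prop
  have ha : ∀ t, MeasurableSet t → a t = μHE[d + j] (euclideanProd A t) := by
    intro t ht
    rw [Measure.map_apply hsnd ht, Measure.restrict_apply (hsnd ht)]
    congr 1
    ext p
    simp [euclideanProd, and_comm]
  have hsph : MeasurableSet (Metric.sphere (0 : V) r) := Metric.isClosed_sphere.measurableSet
  let b : Measure V := volume A • μHE[j]
  have hb : ∀ t, b t = volume A * μHE[j] t := fun t => rfl
  let Φ (p : V) : WithLp 2 (E × V) → WithLp 2 (E × (ℝ ∙ p)ᗮ) :=
    fun x => WithLp.toLp 2 (x.fst, (ℝ ∙ p)ᗮ.orthogonalProjectionOnto x.snd)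
  have hΦ : ∀ p t, Φ p '' euclideanProd A t =
      euclideanProd A ((ℝ ∙ p)ᗮ.orthogonalProjectionOnto '' t) := by
    intro p t
    ext x
    constructor
    · rintro ⟨y, ⟨h1, h2⟩, rfl⟩
      exact ⟨h1, mem_image_of_mem _ h2⟩
    · rintro ⟨h1, y, h2, h3⟩
      refine ⟨WithLp.toLp 2 (x.fst, y), ⟨h1, h2⟩, ?_⟩
      exact WithLp.ofLp_injective 2 (Prod.ext rfl h3)
  have hvol : ∀ p : V, p ≠ 0 → ∀ t, μHE[d + j] (Φ p '' euclideanProd A t) =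
      volume A * volume ((ℝ ∙ p)ᗮ.orthogonalProjectionOnto '' t) := by
    intro p hp t
    rw [hΦ]
    exact euclideanHausdorffMeasure_euclideanProd hd
      (finrank_orthogonal_span_singleton_of_norm_pos hj hp) _ _
  rw [← ha _ hsph, ← hb]
  apply le_antisymm
  · apply ENNReal.le_of_forall_one_lt_pow_mul (d + j)
    intro K hK
    refine measure_le_of_locally a ((K : ℝ≥0∞) ^ (d + j) • b) hsph ?_
    intro p hp
    have hpr : ‖p‖ = r := by simpa using hp
    have hp0 : p ≠ 0 := norm_pos_iff.1 (hpr ▸ hr)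
    obtain ⟨δ, hδ, H⟩ := dist_le_mul_dist_orthogonalProjectionOnto_of_mem_sphere hr hK hpr
    refine ⟨Metric.ball p δ, Metric.isOpen_ball, Metric.mem_ball_self hδ, fun t ht htm => ?_⟩
    rw [ha _ htm, Measure.smul_apply, hb, smul_eq_mul]
    have : μHE[d + j] (euclideanProd A t) ≤
        (K : ℝ≥0∞) ^ (d + j) * μHE[d + j] (Φ p '' euclideanProd A t) := by
      apply euclideanHausdorffMeasure_le_image
      intro x hx y hy
      have h1 := H x.snd (ht hx.2).1 y.snd (ht hy.2).1 (by simpa using (ht hx.2).2)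
        (by simpa using (ht hy.2).2)
      rw [WithLp.prod_dist_eq_of_L2, WithLp.prod_dist_eq_of_L2]
      apply Real.sqrt_le_iff.2 ⟨by positivity, ?_⟩
      rw [mul_pow, Real.sq_sqrt (by positivity)]
      have hK1 : (1 : ℝ) ≤ (K : ℝ) ^ 2 := one_le_pow₀ (by exact_mod_cast hK.le)
      calc dist x.fst y.fst ^ 2 + dist x.snd y.snd ^ 2
          ≤ (K : ℝ) ^ 2 * dist x.fst y.fst ^ 2 + (K * dist ((ℝ ∙ p)ᗮ.orthogonalProjectionOnto x.snd)
            ((ℝ ∙ p)ᗮ.orthogonalProjectionOnto y.snd)) ^ 2 := by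
            gcongr
            nlinarith [sq_nonneg (dist x.fst y.fst)]
        _ = _ := by rw [mul_pow, ← mul_add]; rfl
    refine this.trans ?_
    rw [hvol p hp0]
    gcongr
    exact volume_orthogonalProjectionOnto_image_le hj hp0 t
  · apply ENNReal.le_of_forall_one_lt_pow_mul j
    intro K hK
    refine measure_le_of_locally b ((K : ℝ≥0∞) ^ j • a) hsph ?_
    intro p hp
    have hpr : ‖p‖ = r := by simpa using hp
    have hp0 : p ≠ 0 := norm_pos_iff.1 (hpr ▸ hr)
    obtain ⟨δ, hδ, H⟩ := dist_le_mul_dist_orthogonalProjectionOnto_of_mem_sphere hr hK hpr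
    refine ⟨Metric.ball p δ, Metric.isOpen_ball, Metric.mem_ball_self hδ, fun t ht htm => ?_⟩
    rw [hb, Measure.smul_apply, smul_eq_mul, ha _ htm]
    have h1 : μHE[j] t ≤ (K : ℝ≥0∞) ^ j * volume ((ℝ ∙ p)ᗮ.orthogonalProjectionOnto '' t) :=
      le_volume_orthogonalProjectionOnto_image hj hp0 fun y hy z hz =>
        H y (ht hy).1 z (ht hz).1 (by simpa using (ht hy).2) (by simpa using (ht hz).2)
    have h2 : μHE[d + j] (Φ p '' euclideanProd A t) ≤ μHE[d + j] (euclideanProd A t) := by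
      have hL : LipschitzOnWith 1 (Φ p) (euclideanProd A t) := by
        apply LipschitzOnWith.of_dist_le_mul
        intro x _ y _
        rw [NNReal.coe_one, one_mul, WithLp.prod_dist_eq_of_L2, WithLp.prod_dist_eq_of_L2]
        apply Real.sqrt_le_sqrt
        gcongr
        · exact le_rfl
        change dist ((ℝ ∙ p)ᗮ.orthogonalProjectionOnto x.snd)
          ((ℝ ∙ p)ᗮ.orthogonalProjectionOnto y.snd) ≤ _
        rw [dist_eq_norm, dist_eq_norm, ← map_sub]
        exact Submodule.norm_orthogonalProjectionOnto_apply_le _ _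
      simpa using hL.euclideanHausdorffMeasure_image_le (d + j)
    rw [hvol p hp0] at h2
    calc volume A * μHE[j] t
        ≤ volume A * ((K : ℝ≥0∞) ^ j * volume ((ℝ ∙ p)ᗮ.orthogonalProjectionOnto '' t)) := by
          gcongr
      _ = (K : ℝ≥0∞) ^ j * (volume A * volume ((ℝ ∙ p)ᗮ.orthogonalProjectionOnto '' t)) := by ring
      _ ≤ _ := by gcongr

end SphereProduct

/-! ### Volume density of a warped sphere bundle -/

section Density

open scoped RealInnerProductSpace Pointwise

variable {E V : Type*} [NormedAddCommGroup E] [InnerProductSpace ℝ E] [FiniteDimensional ℝ E]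
  [MeasurableSpace E] [BorelSpace E]
  [NormedAddCommGroup V] [InnerProductSpace ℝ V] [FiniteDimensional ℝ V]
  [MeasurableSpace V] [BorelSpace V]

lemma euclideanHausdorffMeasure_sphere (j : ℕ) {r : ℝ} (hr : 0 < r) :
    μHE[j] (Metric.sphere (0 : V) r) = ENNReal.ofReal (r ^ j) * μHE[j] (Metric.sphere (0 : V) 1) := by
  have h : Metric.sphere (0 : V) r = r • Metric.sphere (0 : V) 1 := by
    rw [smul_sphere' hr.ne']
    simp [abs_of_pos hr]
  rw [h, Measure.euclideanHausdorffMeasure_smul₀ j hr.ne', ENNReal.smul_def, smul_eq_mul]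
  congr 1
  rw [ENNReal.ofReal_pow hr.le, ← Real.enorm_eq_ofReal hr.le]
  simp [enorm_eq_nnnorm]

/-- A linear map pulling the Euclidean metric back to the metric of the graph of a linear form. -/
lemma exists_linearMap_norm_sq_eq (ℓ : E →L[ℝ] ℝ) : ∃ A : E →ₗ[ℝ] E,
    (∀ w, ‖A w‖ ^ 2 = ‖w‖ ^ 2 + (ℓ w) ^ 2) ∧ LinearMap.det A = √(1 + ‖ℓ‖ ^ 2) := by
  set u : E := (InnerProductSpace.toDual ℝ E).symm ℓ with hu
  have hℓ : ∀ w, ℓ w = ⟪u, w⟫ := fun w => by simp [hu]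
  have hn : ‖ℓ‖ = ‖u‖ := by simp [hu]
  set s := √(1 + ‖ℓ‖ ^ 2) with hs
  have hs2 : s ^ 2 = 1 + ‖u‖ ^ 2 := by rw [hs, Real.sq_sqrt (by positivity), hn]
  have hs0 : 0 ≤ s := Real.sqrt_nonneg _
  have h1s : (1 + s) ≠ 0 := by positivity
  -- With `s = √(1 + ‖u‖²)`, the map `w ↦ w + ℓ w • u / (1 + s)` fixes the orthogonal complement of
  -- `u` and multiplies `u` by `s`, because `‖u‖² = (s - 1)(s + 1)`.
  refine ⟨LinearMap.transvection (ℓ : E →ₗ[ℝ] ℝ) ((1 / (1 + s)) • u), fun w => ?_, ?_⟩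
  · rw [LinearMap.transvection.apply]
    simp only [ContinuousLinearMap.coe_coe]
    rw [norm_add_sq_real, smul_smul, inner_smul_right, norm_smul, mul_pow, Real.norm_eq_abs, sq_abs,
      real_inner_comm, ← hℓ]
    have : ‖u‖ ^ 2 = (s - 1) * (s + 1) := by linarith
    rw [this]
    field_simp
    ring
  · rw [LinearMap.transvection.det]
    simp only [ContinuousLinearMap.coe_coe, map_smul, smul_eq_mul]
    rw [hℓ, real_inner_self_eq_norm_sq]
    have : ‖u‖ ^ 2 = (s - 1) * (s + 1) := by linarith
    rw [this]
    field_simp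
    ring

/-- The part over `U` of the bundle of spheres of radius `f`. -/
def sphereBundle (V : Type*) [NormedAddCommGroup V] (f : E → ℝ) (U : Set E) :
    Set (WithLp 2 (E × V)) :=
  {p | p.fst ∈ U ∧ ‖p.snd‖ = f p.fst}

/-- Turns the additive error of a first-order approximation into a factor close to `1`. It is used
with `W = ‖w‖` and with an increment of `f` and its linearization in the roles of `D` and `v`, in
either order. -/
lemma sq_add_sq_le_of_abs_sub_le {W D v ε : ℝ} (hε : 0 ≤ ε) (h : |D - v| ≤ ε * W) :
    W ^ 2 + D ^ 2 ≤ (1 + ε + ε ^ 2) * (W ^ 2 + v ^ 2) := by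
  have h1 := sq_le_sq' (abs_le.1 h).1 (abs_le.1 h).2
  have h2 : 2 * v * (D - v) ≤ ε * v ^ 2 + ε * W ^ 2 := by
    have : 2 * v * (D - v) ≤ 2 * |v| * (ε * W) := by
      calc 2 * v * (D - v) ≤ |2 * v * (D - v)| := le_abs_self _
        _ = 2 * |v| * |D - v| := by rw [abs_mul, abs_mul]; simp
        _ ≤ _ := by gcongr
    nlinarith [mul_nonneg hε (sq_nonneg (|v| - W)), sq_abs v]
  nlinarith [mul_nonneg (sq_nonneg ε) (sq_nonneg v)]

/-- The law of cosines, split into the difference of the radii and a multiple of `1 - cos θ`. The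
next identity has the same angular quantity after both vectors are rescaled to radius `r`. -/
lemma norm_sub_sq_eq_of_norm_eq {y z : V} {a b : ℝ} (hy : ‖y‖ = a) (hz : ‖z‖ = b) (ha : 0 < a)
    (hb : 0 < b) : ‖y - z‖ ^ 2 = (a - b) ^ 2 + 2 * (a * b) * (1 - ⟪y, z⟫ / (a * b)) := by
  rw [norm_sub_sq_real, hy, hz]
  field_simp
  ring

lemma norm_smul_sub_smul_sq_eq_of_norm_eq {y z : V} {a b r : ℝ} (hy : ‖y‖ = a) (hz : ‖z‖ = b)
    (ha : 0 < a) (hb : 0 < b) :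
    ‖(r / a) • y - (r / b) • z‖ ^ 2 = 2 * r ^ 2 * (1 - ⟪y, z⟫ / (a * b)) := by
  rw [norm_sub_sq_real, norm_smul, norm_smul, hy, hz, real_inner_smul_left, real_inner_smul_right,
    mul_pow, mul_pow, Real.norm_eq_abs, Real.norm_eq_abs, sq_abs, sq_abs]
  field_simp
  ring

lemma inner_div_le_one_of_norm_eq {y z : V} {a b : ℝ} (hy : ‖y‖ = a) (hz : ‖z‖ = b)
    (ha : 0 < a) (hb : 0 < b) : 0 ≤ 1 - ⟪y, z⟫ / (a * b) := by
  rw [sub_nonneg, div_le_one (by positivity), ← hy, ← hz]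
  exact real_inner_le_norm y z

/-- With `A` the linear map modelled on the graph of `f'` and `r = f x₀`, the map `(x, y) ↦ (A x, r
y / ‖y‖)` distorts distances in the bundle by at most `K` near `x₀`. Its image is the product of `A
'' U` with a sphere of radius `r`, whose volume has the factors `det A = √(1 + ‖f'‖²)` and `r^j`. -/
theorem sphereBundle_measure_near {d j : ℕ} (hd : Module.finrank ℝ E = d)
    (hj : Module.finrank ℝ V = j + 1) {f : E → ℝ} {f' : E →L[ℝ] ℝ} {x₀ : E}
    (hf : HasStrictFDerivAt f f' x₀) (hpos : 0 < f x₀) {K : ℝ≥0} (hK : 1 < K) :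
    ∃ N, IsOpen N ∧ x₀ ∈ N ∧ ∀ U ⊆ N,
      μHE[d + j] (sphereBundle V f U) ≤ (K : ℝ≥0∞) ^ (d + j) *
        (ENNReal.ofReal (√(1 + ‖f'‖ ^ 2) * f x₀ ^ j) * μHE[j] (Metric.sphere (0 : V) 1) * volume U) ∧
      ENNReal.ofReal (√(1 + ‖f'‖ ^ 2) * f x₀ ^ j) * μHE[j] (Metric.sphere (0 : V) 1) * volume U ≤
        (K : ℝ≥0∞) ^ (d + j) * μHE[d + j] (sphereBundle V f U) := by
  have hK1 : (1 : ℝ) < K := by exact_mod_cast hK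
  have hK0 : (0 : ℝ) < K := by positivity
  -- The linearization error contributes `1 + ε + ε²` to squared distances; for `ε ≤ 1` this is at
  -- most `1 + 2ε ≤ K²`.
  obtain ⟨ε, hε0, hεK⟩ : ∃ ε : ℝ, 0 < ε ∧ 1 + ε + ε ^ 2 ≤ (K : ℝ) ^ 2 := by
    refine ⟨min 1 (((K : ℝ) ^ 2 - 1) / 2), lt_min one_pos (by nlinarith), ?_⟩
    have h1 := min_le_left 1 (((K : ℝ) ^ 2 - 1) / 2)
    have h2 := min_le_right 1 (((K : ℝ) ^ 2 - 1) / 2)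
    have h3 : 0 < min 1 (((K : ℝ) ^ 2 - 1) / 2) := lt_min one_pos (by nlinarith)
    nlinarith
  obtain ⟨δ₁, hδ₁, H₁⟩ := Metric.eventually_nhds_iff_ball.1 (hf.isLittleO.def hε0)
  have hcont := hf.hasFDerivAt.continuousAt
  have ev1 : ∀ᶠ x in 𝓝 x₀, f x < K * f x₀ :=
    hcont.eventually_lt continuousAt_const (by nlinarith)
  have ev2 : ∀ᶠ x in 𝓝 x₀, f x₀ / K < f x :=
    continuousAt_const.eventually_lt hcont (div_lt_self hpos hK1)
  obtain ⟨δ₂, hδ₂, H₂⟩ := Metric.eventually_nhds_iff_ball.1 (ev1.and ev2)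
  obtain ⟨A, hA, hdet⟩ := exists_linearMap_norm_sq_eq f'
  set r := f x₀ with hr
  refine ⟨Metric.ball x₀ (min δ₁ δ₂), Metric.isOpen_ball, Metric.mem_ball_self (lt_min hδ₁ hδ₂),
    fun U hU => ?_⟩
  let h : WithLp 2 (E × V) → WithLp 2 (E × V) :=
    fun p => WithLp.toLp 2 (A p.fst, (r / ‖p.snd‖) • p.snd)
  have hmemU : ∀ x ∈ U, r / K < f x ∧ f x < K * r ∧ 0 < f x := by
    intro x hx
    have := H₂ x (Metric.ball_subset_ball (min_le_right _ _) (hU hx))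
    exact ⟨this.2, this.1, (div_pos hpos hK0).trans this.2⟩
  have himg : h '' sphereBundle V f U = euclideanProd (A '' U) (Metric.sphere (0 : V) r) := by
    ext q
    constructor
    · rintro ⟨p, ⟨hp1, hp2⟩, rfl⟩
      refine ⟨mem_image_of_mem _ hp1, ?_⟩
      have : ‖p.snd‖ ≠ 0 := by rw [hp2]; exact (hmemU _ hp1).2.2.ne'
      rw [mem_sphere_zero_iff_norm]
      change ‖(r / ‖p.snd‖) • p.snd‖ = r
      rw [norm_smul, norm_div, norm_norm, div_mul_cancel₀ _ this, Real.norm_of_nonneg hpos.le]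
    · rintro ⟨⟨x, hx, hx2⟩, hq⟩
      rw [mem_sphere_zero_iff_norm] at hq
      have hfx := (hmemU x hx).2.2
      have hn : ‖(f x / r) • q.snd‖ = f x := by
        rw [norm_smul, hq, norm_div, Real.norm_of_nonneg hpos.le, div_mul_cancel₀ _ hpos.ne',
          Real.norm_of_nonneg hfx.le]
      refine ⟨WithLp.toLp 2 (x, (f x / r) • q.snd), ⟨hx, hn⟩, ?_⟩
      apply WithLp.ofLp_injective 2
      refine Prod.ext hx2 ?_
      change (r / ‖(f x / r) • q.snd‖) • ((f x / r) • q.snd) = q.snd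
      rw [hn, smul_smul]
      have : r / f x * (f x / r) = 1 := by field_simp
      rw [this, one_smul]
  have hvol : μHE[d + j] (h '' sphereBundle V f U) =
      ENNReal.ofReal (√(1 + ‖f'‖ ^ 2) * r ^ j) * μHE[j] (Metric.sphere (0 : V) 1) * volume U := by
    rw [himg, euclideanHausdorffMeasure_euclideanProd_sphere hd hj _ hpos,
      euclideanHausdorffMeasure_sphere j hpos, Measure.addHaar_image_linearMap, hdet,
      abs_of_nonneg (Real.sqrt_nonneg _), ENNReal.ofReal_mul (Real.sqrt_nonneg _)]
    ring
  have hdist : ∀ p ∈ sphereBundle V f U, ∀ q ∈ sphereBundle V f U,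
      dist p q ≤ K * dist (h p) (h q) ∧ dist (h p) (h q) ≤ K * dist p q := by
    rintro p ⟨hpU, hp⟩ q ⟨hqU, hq⟩
    obtain ⟨a1, a2, a3⟩ := hmemU _ hpU
    obtain ⟨b1, b2, b3⟩ := hmemU _ hqU
    set a := f p.fst
    set b := f q.fst
    have hab : |a - b - f' (p.fst - q.fst)| ≤ ε * ‖p.fst - q.fst‖ := by
      have := H₁ (p.fst, q.fst) (by
        rw [← ball_prod_same]
        exact ⟨Metric.ball_subset_ball (min_le_left _ _) (hU hpU),
          Metric.ball_subset_ball (min_le_left _ _) (hU hqU)⟩)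
      simpa using this
    set w := p.fst - q.fst with hw
    set c := 1 - ⟪p.snd, q.snd⟫ / (a * b)
    have hc : 0 ≤ c := inner_div_le_one_of_norm_eq hp hq a3 b3
    -- The two squared distances agree term by term up to the factor `K²`: equal base parts, an
    -- increment of `f` against its linearization, and the weights `a * b` and `r²` of the common
    -- angular term `c`.
    have d1 : dist p q ^ 2 = ‖w‖ ^ 2 + (a - b) ^ 2 + 2 * (a * b) * c := by
      rw [dist_eq_norm, WithLp.prod_norm_sq_eq_of_L2, WithLp.sub_fst, WithLp.sub_snd, ← hw,
        norm_sub_sq_eq_of_norm_eq hp hq a3 b3]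
      ring
    have d2 : dist (h p) (h q) ^ 2 = ‖w‖ ^ 2 + (f' w) ^ 2 + 2 * r ^ 2 * c := by
      rw [dist_eq_norm, WithLp.prod_norm_sq_eq_of_L2, WithLp.sub_fst, WithLp.sub_snd]
      change ‖A p.fst - A q.fst‖ ^ 2 + ‖(r / ‖p.snd‖) • p.snd - (r / ‖q.snd‖) • q.snd‖ ^ 2 = _
      rw [← map_sub, hA, hp, hq, norm_smul_sub_smul_sq_eq_of_norm_eq hp hq a3 b3]
    have e1 := sq_add_sq_le_of_abs_sub_le hε0.le hab
    have e2 : ‖w‖ ^ 2 + (f' w) ^ 2 ≤ (1 + ε + ε ^ 2) * (‖w‖ ^ 2 + (a - b) ^ 2) :=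
      sq_add_sq_le_of_abs_sub_le hε0.le (by rwa [abs_sub_comm])
    have ab1 : a * b ≤ (K : ℝ) ^ 2 * r ^ 2 := by
      calc a * b ≤ (K * r) * (K * r) := by gcongr
        _ = _ := by ring
    have ab2 : r ^ 2 ≤ (K : ℝ) ^ 2 * (a * b) := by
      calc r ^ 2 = (K : ℝ) ^ 2 * ((r / K) * (r / K)) := by field_simp
        _ ≤ _ := by gcongr
    constructor
    · refine (pow_le_pow_iff_left₀ dist_nonneg (by positivity) two_ne_zero).1 ?_
      rw [mul_pow, d1, d2]
      calc _ ≤ (K : ℝ) ^ 2 * (‖w‖ ^ 2 + (f' w) ^ 2) + 2 * ((K : ℝ) ^ 2 * r ^ 2) * c := by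
            gcongr
            exact e1.trans (by gcongr)
        _ = _ := by ring
    · refine (pow_le_pow_iff_left₀ dist_nonneg (by positivity) two_ne_zero).1 ?_
      rw [mul_pow, d1, d2]
      calc _ ≤ (K : ℝ) ^ 2 * (‖w‖ ^ 2 + (a - b) ^ 2) + 2 * ((K : ℝ) ^ 2 * (a * b)) * c := by
            gcongr
            exact e2.trans (by gcongr)
        _ = _ := by ring
  rw [← hvol]
  refine ⟨euclideanHausdorffMeasure_le_image (fun p hp q hq => (hdist p hp q hq).1) _, ?_⟩
  apply LipschitzOnWith.euclideanHausdorffMeasure_image_le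
  apply LipschitzOnWith.of_dist_le_mul
  exact fun p hp q hq => (hdist p hp q hq).2

end Density

/-! ### Exact volumes, densities and negligible parts of sphere bundles -/

section Density

variable {E V : Type*} [NormedAddCommGroup E] [InnerProductSpace ℝ E] [FiniteDimensional ℝ E]
  [MeasurableSpace E] [BorelSpace E]
  [NormedAddCommGroup V] [InnerProductSpace ℝ V] [FiniteDimensional ℝ V]
  [MeasurableSpace V] [BorelSpace V]

theorem sphereBundle_measure_eq {d j : ℕ} (hd : Module.finrank ℝ E = d)
    (hj : Module.finrank ℝ V = j + 1) {f : E → ℝ} {f' : E → E →L[ℝ] ℝ} {U : Set E}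
    (hU : MeasurableSet U) (hf : ∀ x ∈ U, HasStrictFDerivAt f (f' x) x) (hpos : ∀ x ∈ U, 0 < f x)
    (hdens : ∀ x ∈ U, √(1 + ‖f' x‖ ^ 2) * f x ^ j = 1) :
    μHE[d + j] (sphereBundle V f U) = μHE[j] (Metric.sphere (0 : V) 1) * volume U := by
  let a : Measure E := ((μHE[d + j] : Measure (WithLp 2 (E × V))).restrict
    (sphereBundle V f univ)).map (fun p => p.fst)
  have hfst : Measurable (fun p : WithLp 2 (E × V) => p.fst) := by fun_prop
  have ha : ∀ t, MeasurableSet t → a t = μHE[d + j] (sphereBundle V f t) := by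
    intro t ht
    rw [Measure.map_apply hfst ht, Measure.restrict_apply (hfst ht)]
    congr 1
    ext p
    simp [sphereBundle]
  let b : Measure E := μHE[j] (Metric.sphere (0 : V) 1) • volume
  have hb : ∀ t, b t = μHE[j] (Metric.sphere (0 : V) 1) * volume t := fun t => rfl
  rw [← ha _ hU, ← hb]
  apply le_antisymm
  · apply ENNReal.le_of_forall_one_lt_pow_mul (d + j)
    intro K hK
    refine measure_le_of_locally a ((K : ℝ≥0∞) ^ (d + j) • b) hU fun x hx => ?_
    obtain ⟨N, hN, hxN, H⟩ := sphereBundle_measure_near hd hj (hf x hx) (hpos x hx) hK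
    refine ⟨N, hN, hxN, fun t ht htm => ?_⟩
    have := (H t (ht.trans inter_subset_left)).1
    rw [hdens x hx, ENNReal.ofReal_one, one_mul] at this
    rw [ha _ htm, Measure.smul_apply, hb, smul_eq_mul]
    exact this
  · apply ENNReal.le_of_forall_one_lt_pow_mul (d + j)
    intro K hK
    refine measure_le_of_locally b ((K : ℝ≥0∞) ^ (d + j) • a) hU fun x hx => ?_
    obtain ⟨N, hN, hxN, H⟩ := sphereBundle_measure_near hd hj (hf x hx) (hpos x hx) hK
    refine ⟨N, hN, hxN, fun t ht htm => ?_⟩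
    have := (H t (ht.trans inter_subset_left)).2
    rw [hdens x hx, ENNReal.ofReal_one, one_mul] at this
    rw [hb, Measure.smul_apply, ha _ htm, smul_eq_mul]
    exact this

/-- On a small ball the two bounds of `sphereBundle_measure_near` can be divided by the volume,
which is positive and finite. -/
theorem density_eq_of_sphereBundle_measure_eq {d j : ℕ} (hd : Module.finrank ℝ E = d)
    (hj : Module.finrank ℝ V = j + 1) {f : E → ℝ} {f' : E →L[ℝ] ℝ} {x₀ : E} {W : Set E}
    (hW : W ∈ 𝓝 x₀) {C : ℝ≥0∞}
    (hC : ∀ U ⊆ W, MeasurableSet U → μHE[d + j] (sphereBundle V f U) = C * volume U)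
    (hf : HasStrictFDerivAt f f' x₀) (hpos : 0 < f x₀) :
    ENNReal.ofReal (√(1 + ‖f'‖ ^ 2) * f x₀ ^ j) * μHE[j] (Metric.sphere (0 : V) 1) = C := by
  have main : ∀ K : ℝ≥0, 1 < K →
      C ≤ (K : ℝ≥0∞) ^ (d + j) *
        (ENNReal.ofReal (√(1 + ‖f'‖ ^ 2) * f x₀ ^ j) * μHE[j] (Metric.sphere (0 : V) 1)) ∧
      ENNReal.ofReal (√(1 + ‖f'‖ ^ 2) * f x₀ ^ j) * μHE[j] (Metric.sphere (0 : V) 1) ≤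
        (K : ℝ≥0∞) ^ (d + j) * C := by
    intro K hK
    obtain ⟨N, hN, hxN, H⟩ := sphereBundle_measure_near hd hj hf hpos hK
    obtain ⟨δ, hδ, hball⟩ := Metric.mem_nhds_iff.1 (inter_mem (hN.mem_nhds hxN) hW)
    obtain ⟨h1, h2⟩ := H (Metric.ball x₀ δ) (hball.trans inter_subset_left)
    rw [hC _ (hball.trans inter_subset_right) measurableSet_ball] at h1 h2
    have v0 : volume (Metric.ball x₀ δ) ≠ 0 := (Metric.measure_ball_pos _ _ hδ).ne'
    have vt : volume (Metric.ball x₀ δ) ≠ ⊤ := measure_ball_lt_top.ne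
    rw [← mul_assoc] at h1 h2
    exact ⟨(ENNReal.mul_le_mul_iff_left v0 vt).1 h1, (ENNReal.mul_le_mul_iff_left v0 vt).1 h2⟩
  exact le_antisymm (ENNReal.le_of_forall_one_lt_pow_mul _ fun K hK => (main K hK).2)
    (ENNReal.le_of_forall_one_lt_pow_mul _ fun K hK => (main K hK).1)

/-- A sphere bundle over a point is a lower-dimensional sphere. -/
lemma sphereBundle_singleton_measure {d j : ℕ} (hd : 1 ≤ d) (hj : Module.finrank ℝ V = j + 1)
    {f : E → ℝ} {x : E} (hx : 0 < f x) : μHE[d + j] (sphereBundle V f {x}) = 0 := by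
  have hiso : Isometry (fun y : V => (WithLp.toLp 2 (x, y) : WithLp 2 (E × V))) := by
    apply Isometry.of_dist_eq
    intro y z
    rw [WithLp.prod_dist_eq_of_L2]
    simp
  have himg : sphereBundle V f {x} = (fun y : V => (WithLp.toLp 2 (x, y) : WithLp 2 (E × V))) ''
      Metric.sphere 0 (f x) := by
    ext p
    constructor
    · rintro ⟨h1, h2⟩
      have h1 : p.fst = x := h1
      refine ⟨p.snd, by simp [h2, h1], ?_⟩
      exact WithLp.ofLp_injective 2 (Prod.ext h1.symm rfl)
    · rintro ⟨y, hy, rfl⟩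
      exact ⟨rfl, by simpa using hy⟩
  rw [himg, hiso.euclideanHausdorffMeasure_image]
  -- Finite `j`-dimensional measure forces the measure in the higher dimension `d + j` to vanish.
  rcases Measure.euclideanHausdorffMeasure_zero_or_top (d₁ := j) (d₂ := d + j) (by omega)
    (Metric.sphere (0 : V) (f x)) with h | h
  · exact h
  · exact absurd h (euclideanHausdorffMeasure_sphere_lt_top hj hx).ne

/-- The part of a sphere bundle where all radii vanish is negligible. -/
lemma sphereBundle_measure_of_zero {d j : ℕ} (hd : Module.finrank ℝ E = d) (hj : 1 ≤ j)
    {f : E → ℝ} {U : Set E} (hU : Bornology.IsBounded U) (hf : ∀ x ∈ U, f x = 0) :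
    μHE[d + j] (sphereBundle V f U) = 0 := by
  have hiso : Isometry (fun x : E => (WithLp.toLp 2 (x, 0) : WithLp 2 (E × V))) := by
    apply Isometry.of_dist_eq
    intro y z
    rw [WithLp.prod_dist_eq_of_L2]
    simp
  have himg : sphereBundle V f U ⊆ (fun x : E => (WithLp.toLp 2 (x, 0) : WithLp 2 (E × V))) '' U := by
    rintro p ⟨h1, h2⟩
    rw [hf _ h1, norm_eq_zero] at h2
    exact ⟨p.fst, h1, WithLp.ofLp_injective 2 (Prod.ext rfl h2.symm)⟩
  refine measure_mono_null himg ?_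
  rw [hiso.euclideanHausdorffMeasure_image]
  rcases Measure.euclideanHausdorffMeasure_zero_or_top (d₁ := d) (d₂ := d + j) (by omega) U with h | h
  · exact h
  · rw [← hd, InnerProductSpace.euclideanHausdorffMeasure_eq_volume] at h
    exact absurd h hU.measure_lt_top.ne

end Density

/-! ### The scaling function -/

section Scaling

/-- The integrand of `scalingInv (j + 1)`. -/
def scalingDensity (j : ℕ) (t : ℝ) : ℝ := t ^ j / √(1 - t ^ (2 * j))

lemma scalingInv_succ (j : ℕ) (y : ℝ) :
    scalingInv (j + 1) y = ∫ t in (0 : ℝ)..y, scalingDensity j t := by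
  simp only [scalingInv, scalingDensity, Nat.add_sub_cancel, Nat.mul_add, mul_one]

variable {j : ℕ} (hj : 1 ≤ j)
include hj

lemma one_sub_pow_pos {t : ℝ} (h0 : 0 ≤ t) (h1 : t < 1) : 0 < 1 - t ^ (2 * j) :=
  sub_pos.2 (pow_lt_one₀ h0 h1 (by omega))

lemma scalingDensity_pos {t : ℝ} (h0 : 0 < t) (h1 : t < 1) : 0 < scalingDensity j t :=
  div_pos (pow_pos h0 j) (Real.sqrt_pos.2 (one_sub_pow_pos hj h0.le h1))

lemma continuousAt_scalingDensity {t : ℝ} (h0 : 0 ≤ t) (h1 : t < 1) :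
    ContinuousAt (scalingDensity j) t := by
  have h : √(1 - t ^ (2 * j)) ≠ 0 := (Real.sqrt_pos.2 (one_sub_pow_pos hj h0 h1)).ne'
  unfold scalingDensity
  fun_prop (disch := assumption)

lemma strictMonoOn_scalingDensity : StrictMonoOn (scalingDensity j) (Ioo 0 1) := by
  intro s hs t ht hst
  have h1 := one_sub_pow_pos hj ht.1.le ht.2
  have h2 : s ^ j < t ^ j := pow_lt_pow_left₀ hst hs.1.le (by omega)
  have h3 : √(1 - t ^ (2 * j)) ≤ √(1 - s ^ (2 * j)) :=
    Real.sqrt_le_sqrt (by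
      have := pow_le_pow_left₀ hs.1.le hst.le (2 * j)
      linarith)
  exact div_lt_div₀ h2 h3 (pow_pos ht.1 j).le (Real.sqrt_pos.2 h1)

/-- The only singularity is at `1`. Since `j ≥ 1`, the integrand is at most `t / √(1 - t²)`, the
derivative of `-√(1 - t²)`. -/
lemma integrableOn_scalingDensity : IntegrableOn (scalingDensity j) (Ioc 0 1) := by
  have h : IntegrableOn (fun t : ℝ => t / √(1 - t ^ 2)) (Ioc 0 1) := by
    apply intervalIntegral.integrableOn_deriv_of_nonneg (g := fun t => -√(1 - t ^ 2))
    · fun_prop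
    · intro x hx
      have hx1 : 1 - x ^ 2 ≠ 0 := by nlinarith [hx.1, hx.2]
      have := (((hasDerivAt_pow 2 x).const_sub 1).sqrt hx1).neg
      have e : x / √(1 - x ^ 2) = -(-(((2 : ℕ) : ℝ) * x ^ (2 - 1)) / (2 * √(1 - x ^ 2))) := by
        rw [neg_div, neg_neg, Nat.cast_ofNat, pow_one, mul_div_mul_left _ _ two_ne_zero]
      rw [e]
      exact this
    · intro x hx
      exact div_nonneg hx.1.le (Real.sqrt_nonneg _)
  rw [integrableOn_Ioc_iff_integrableOn_Ioo] at h ⊢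
  refine Integrable.mono' h ?_ ?_
  · refine ContinuousOn.aestronglyMeasurable (fun t ht => ?_) measurableSet_Ioo
    exact (continuousAt_scalingDensity hj ht.1.le ht.2).continuousWithinAt
  · refine (ae_restrict_iff' measurableSet_Ioo).2 (Eventually.of_forall fun t ht => ?_)
    rw [Real.norm_of_nonneg (scalingDensity_pos hj ht.1 ht.2).le]
    have h1 : t ^ j ≤ t := by simpa using pow_le_pow_of_le_one ht.1.le ht.2.le hj
    have h2 : t ^ (2 * j) ≤ t ^ 2 := pow_le_pow_of_le_one ht.1.le ht.2.le (by omega)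
    have h3 : 0 < 1 - t ^ 2 := by nlinarith [ht.1, ht.2]
    exact div_le_div₀ ht.1.le h1 (Real.sqrt_pos.2 h3) (Real.sqrt_le_sqrt (by linarith))

lemma intervalIntegrable_scalingDensity {a b : ℝ} (ha : a ∈ Icc (0 : ℝ) 1) (hb : b ∈ Icc (0 : ℝ) 1) :
    IntervalIntegrable (scalingDensity j) volume a b := by
  have : IntervalIntegrable (scalingDensity j) volume 0 1 :=
    (intervalIntegrable_iff_integrableOn_Ioc_of_le zero_le_one).2 (integrableOn_scalingDensity hj)
  apply this.mono_set
  rw [uIcc_of_le (zero_le_one' ℝ)]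
  exact uIcc_subset_Icc ha hb

lemma hasDerivAt_scalingInv {y : ℝ} (h0 : 0 < y) (h1 : y < 1) :
    HasDerivAt (scalingInv (j + 1)) (scalingDensity j y) y := by
  have : scalingInv (j + 1) = fun y => ∫ t in (0 : ℝ)..y, scalingDensity j t := by
    ext y; exact scalingInv_succ j y
  rw [this]
  apply intervalIntegral.integral_hasDerivAt_right
    (intervalIntegrable_scalingDensity hj ⟨le_rfl, zero_le_one⟩ ⟨h0.le, h1.le⟩)
  · refine ContinuousOn.stronglyMeasurableAtFilter (s := Ioo 0 1) isOpen_Ioo (fun t ht => ?_) y ⟨h0, h1⟩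
    exact (continuousAt_scalingDensity hj ht.1.le ht.2).continuousWithinAt
  · exact continuousAt_scalingDensity hj h0.le h1

lemma continuousOn_scalingInv : ContinuousOn (scalingInv (j + 1)) (Icc 0 1) := by
  have : scalingInv (j + 1) = fun y => ∫ t in (0 : ℝ)..y, scalingDensity j t := by
    ext y; exact scalingInv_succ j y
  rw [this, ← uIcc_of_le (zero_le_one' ℝ)]
  apply intervalIntegral.continuousOn_primitive_interval
  rw [uIcc_of_le zero_le_one, integrableOn_Icc_iff_integrableOn_Ioc]
  exact integrableOn_scalingDensity hj

lemma strictMonoOn_scalingInv : StrictMonoOn (scalingInv (j + 1)) (Icc 0 1) := by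
  apply strictMonoOn_of_deriv_pos (convex_Icc 0 1) (continuousOn_scalingInv hj)
  intro x hx
  rw [interior_Icc] at hx
  rw [(hasDerivAt_scalingInv hj hx.1 hx.2).deriv]
  exact scalingDensity_pos hj hx.1 hx.2

/-- The integrand is strictly increasing. This is one source of the strict convexity of the model
body. -/
lemma strictConvexOn_scalingInv : StrictConvexOn ℝ (Icc 0 1) (scalingInv (j + 1)) := by
  apply StrictMonoOn.strictConvexOn_of_deriv (convex_Icc 0 1) (continuousOn_scalingInv hj)
  rw [interior_Icc]
  intro s hs t ht hst
  rw [(hasDerivAt_scalingInv hj hs.1 hs.2).deriv, (hasDerivAt_scalingInv hj ht.1 ht.2).deriv]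
  exact strictMonoOn_scalingDensity hj hs ht hst

omit hj in
lemma scalingInv_zero (k : ℕ) : scalingInv k 0 = 0 := by simp [scalingInv]

lemma scalingMax_pos : 0 < scalingMax (j + 1) := by
  have := strictMonoOn_scalingInv hj ⟨le_rfl, zero_le_one⟩ ⟨zero_le_one, le_rfl⟩ zero_lt_one
  rwa [scalingInv_zero] at this

lemma scalingInv_mem {y : ℝ} (hy : y ∈ Icc (0 : ℝ) 1) :
    scalingInv (j + 1) y ∈ Icc 0 (scalingMax (j + 1)) := by
  have h := (strictMonoOn_scalingInv hj).monotoneOn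
  refine ⟨?_, h hy ⟨zero_le_one, le_rfl⟩ hy.2⟩
  rw [← scalingInv_zero (j + 1)]
  exact h ⟨le_rfl, zero_le_one⟩ hy hy.1

lemma scalingFn_spec {s : ℝ} (hs : s ∈ Icc 0 (scalingMax (j + 1))) :
    scalingFn (j + 1) s ∈ Icc (0 : ℝ) 1 ∧ scalingInv (j + 1) (scalingFn (j + 1) s) = s := by
  have h : s ∈ scalingInv (j + 1) '' Icc 0 1 := by
    apply intermediate_value_Icc zero_le_one (continuousOn_scalingInv hj)
    rwa [scalingInv_zero]
  exact ⟨Function.invFunOn_mem h, Function.invFunOn_eq h⟩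

lemma scalingFn_scalingInv {y : ℝ} (hy : y ∈ Icc (0 : ℝ) 1) :
    scalingFn (j + 1) (scalingInv (j + 1) y) = y :=
  (strictMonoOn_scalingInv hj).injOn.leftInvOn_invFunOn hy

lemma strictMonoOn_scalingFn : StrictMonoOn (scalingFn (j + 1)) (Icc 0 (scalingMax (j + 1))) := by
  intro s hs t ht hst
  have h1 := scalingFn_spec hj hs
  have h2 := scalingFn_spec hj ht
  rw [← (strictMonoOn_scalingInv hj).lt_iff_lt h1.1 h2.1, h1.2, h2.2]
  exact hst

lemma scalingFn_mem_Ioo {s : ℝ} (hs : s ∈ Ioo 0 (scalingMax (j + 1))) :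
    scalingFn (j + 1) s ∈ Ioo (0 : ℝ) 1 := by
  obtain ⟨h1, h2⟩ := scalingFn_spec hj ⟨hs.1.le, hs.2.le⟩
  constructor
  · refine h1.1.lt_of_ne fun h => ?_
    rw [← h, scalingInv_zero] at h2
    exact hs.1.ne h2
  · refine h1.2.lt_of_ne fun h => ?_
    rw [h] at h2
    exact hs.2.ne' h2

lemma continuousAt_scalingFn {s : ℝ} (hs : s ∈ Ioo 0 (scalingMax (j + 1))) :
    ContinuousAt (scalingFn (j + 1)) s := by
  apply (strictMonoOn_scalingFn hj).continuousAt_of_image_mem_nhds (Icc_mem_nhds hs.1 hs.2)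
  have h := scalingFn_mem_Ioo hj hs
  refine mem_of_superset (Icc_mem_nhds h.1 h.2) fun y hy => ?_
  exact ⟨_, scalingInv_mem hj hy, scalingFn_scalingInv hj hy⟩

lemma hasDerivAt_scalingFn {s : ℝ} (hs : s ∈ Ioo 0 (scalingMax (j + 1))) :
    HasDerivAt (scalingFn (j + 1)) (scalingDensity j (scalingFn (j + 1) s))⁻¹ s := by
  have h := scalingFn_mem_Ioo hj hs
  apply (hasDerivAt_scalingInv hj h.1 h.2).of_local_left_inverse (continuousAt_scalingFn hj hs)
    (scalingDensity_pos hj h.1 h.2).ne'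
  filter_upwards [Icc_mem_nhds hs.1 hs.2] with t ht using (scalingFn_spec hj ht).2

lemma hasStrictDerivAt_scalingFn {s : ℝ} (hs : s ∈ Ioo 0 (scalingMax (j + 1))) :
    HasStrictDerivAt (scalingFn (j + 1)) (scalingDensity j (scalingFn (j + 1) s))⁻¹ s := by
  have h := scalingFn_mem_Ioo hj hs
  apply hasStrictDerivAt_of_hasDerivAt_of_continuousAt
    (f' := fun s => (scalingDensity j (scalingFn (j + 1) s))⁻¹)
  · filter_upwards [Ioo_mem_nhds hs.1 hs.2] with t ht using hasDerivAt_scalingFn hj ht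
  · refine ContinuousAt.fun_inv₀ ?_ (scalingDensity_pos hj h.1 h.2).ne'
    exact (continuousAt_scalingDensity hj h.1.le h.2).comp_of_eq (continuousAt_scalingFn hj hs) rfl

omit hj in
/-- The differential equation satisfied by the scaling function, in terms of the volume density. -/
lemma sqrt_one_add_inv_scalingDensity_sq_mul (hj : 1 ≤ j) {y : ℝ} (h0 : 0 < y) (h1 : y < 1) :
    √(1 + (scalingDensity j y)⁻¹ ^ 2) * y ^ j = 1 := by
  have h := one_sub_pow_pos hj h0.le h1
  have hy : 0 < y ^ j := pow_pos h0 j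
  -- The squared inverse density is `(1 - y^(2j)) / y^(2j)`, and adding `1` leaves `y^(-2j)`.
  have : 1 + (scalingDensity j y)⁻¹ ^ 2 = ((y ^ j)⁻¹) ^ 2 := by
    rw [scalingDensity, inv_div, div_pow, Real.sq_sqrt h.le]
    rw [mul_comm 2 j, pow_mul]
    field_simp
    ring
  rw [this, Real.sqrt_sq (by positivity), inv_mul_cancel₀ hy.ne']

end Scaling

/-! ### Smoothness of some integrals depending on a parameter -/

/-- An integral of a real power of an affine function of the parameter `w`. -/
def rpowIntegral (c b : ℝ → ℝ) (p w : ℝ) : ℝ := ∫ τ in (0 : ℝ)..1, c τ * (1 - w * b τ) ^ p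

section RpowIntegral

variable {c b : ℝ → ℝ} {p w : ℝ}

lemma one_sub_mul_pos {β : ℝ} (hβ : β ∈ Icc (0 : ℝ) 1) (hw : w < 1) : 0 < 1 - w * β := by
  rcases le_or_gt w 0 with h | h
  · nlinarith [mul_nonneg (neg_nonneg.2 h) hβ.1]
  · nlinarith [mul_le_mul_of_nonneg_left hβ.2 h.le]

lemma continuousOn_rpowIntegrand (hc : Continuous c) (hb : Continuous b)
    (hb01 : ∀ τ ∈ Icc (0 : ℝ) 1, b τ ∈ Icc (0 : ℝ) 1) :
    ContinuousOn (fun x : ℝ × ℝ => c x.2 * (1 - x.1 * b x.2) ^ p) (Iio 1 ×ˢ Icc 0 1) := by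
  intro x hx
  have h := one_sub_mul_pos (hb01 x.2 hx.2) hx.1
  have h1 : ContinuousAt (fun x : ℝ × ℝ => 1 - x.1 * b x.2) x := by fun_prop
  have h2 : ContinuousAt (fun x : ℝ × ℝ => c x.2) x := by fun_prop
  exact (h2.mul (h1.rpow_const (Or.inl h.ne'))).continuousWithinAt

lemma hasDerivAt_rpowIntegral (hc : Continuous c) (hb : Continuous b)
    (hb01 : ∀ τ ∈ Icc (0 : ℝ) 1, b τ ∈ Icc (0 : ℝ) 1) (hw : w < 1) :
    HasDerivAt (rpowIntegral c b p)
      (rpowIntegral (fun τ => -(p * c τ * b τ)) b (p - 1) w) w := by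
  have hci : ∀ (c : ℝ → ℝ) (p : ℝ), Continuous c → ∀ x < 1,
      ContinuousOn (fun τ => c τ * (1 - x * b τ) ^ p) (Icc 0 1) := by
    intro c p hc x hx
    exact (continuousOn_rpowIntegrand hc hb hb01).comp
      (f := fun τ => ((x, τ) : ℝ × ℝ)) (by fun_prop) (fun τ hτ => ⟨hx, hτ⟩)
  obtain ⟨δ, hδ, hδw⟩ : ∃ δ > 0, w + δ < 1 := ⟨(1 - w) / 2, by linarith, by linarith⟩
  have hcb : Continuous fun τ => -(p * c τ * b τ) := by fun_prop
  obtain ⟨B, hB⟩ := ((isCompact_closedBall w δ).prod (isCompact_Icc (a := (0:ℝ)) (b := 1))).exists_bound_of_continuousOn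
    ((continuousOn_rpowIntegrand (p := p - 1) hcb hb hb01).mono (prod_mono (fun x hx => by
      rw [Real.closedBall_eq_Icc] at hx
      exact lt_of_le_of_lt hx.2 hδw) subset_rfl))
  have hm : ∀ (c : ℝ → ℝ) (p : ℝ), Continuous c → ∀ x < 1,
      AEStronglyMeasurable (fun τ => c τ * (1 - x * b τ) ^ p) (volume.restrict (uIoc 0 1)) := by
    intro c p hc x hx
    rw [uIoc_of_le zero_le_one]
    exact ((hci c p hc x hx).mono Ioc_subset_Icc_self).aestronglyMeasurable measurableSet_Ioc
  have hlt : ∀ x ∈ Metric.ball w δ, x < 1 := by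
    intro x hx
    rw [Real.ball_eq_Ioo] at hx
    exact hx.2.trans hδw
  refine (intervalIntegral.hasDerivAt_integral_of_dominated_loc_of_deriv_le
    (F := fun x τ => c τ * (1 - x * b τ) ^ p)
    (F' := fun x τ => -(p * c τ * b τ) * (1 - x * b τ) ^ (p - 1))
    (bound := fun _ => B) (Metric.ball_mem_nhds w hδ) ?_ ?_ ?_ ?_ ?_ ?_).2
  · filter_upwards [Iio_mem_nhds hw] with x hx using hm c p hc x hx
  · apply ContinuousOn.intervalIntegrable
    rw [uIcc_of_le zero_le_one]
    exact hci c p hc w hw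
  · exact hm _ _ hcb w hw
  · refine Eventually.of_forall fun τ hτ x hx => ?_
    rw [uIoc_of_le zero_le_one] at hτ
    exact hB (x, τ) ⟨Metric.ball_subset_closedBall hx, Ioc_subset_Icc_self hτ⟩
  · exact intervalIntegrable_const
  · refine Eventually.of_forall fun τ hτ x hx => ?_
    rw [uIoc_of_le zero_le_one] at hτ
    have h := one_sub_mul_pos (hb01 τ (Ioc_subset_Icc_self hτ)) (hlt x hx)
    have h1 : HasDerivAt (fun x : ℝ => 1 - x * b τ) (-(1 * b τ)) x :=
      ((hasDerivAt_id x).mul_const (b τ)).const_sub 1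
    have h2 := (h1.rpow_const (p := p) (Or.inl h.ne')).const_mul (c τ)
    have e : -(p * c τ * b τ) * (1 - x * b τ) ^ (p - 1) =
      c τ * (-(1 * b τ) * p * (1 - x * b τ) ^ (p - 1)) := by ring
    rw [e]
    exact h2

/-- Differentiation under the integral stays in the same family, with a new coefficient `c` and
exponent `p - 1`, so the induction runs over all `c` and `p`. The domain `w < 1` contains a
neighbourhood of `0`, which is where the factors of the scaling integral are needed. -/
lemma contDiffOn_rpowIntegral (n : ℕ) (hc : Continuous c) (hb : Continuous b)
    (hb01 : ∀ τ ∈ Icc (0 : ℝ) 1, b τ ∈ Icc (0 : ℝ) 1) :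
    ContDiffOn ℝ n (rpowIntegral c b p) (Iio 1) := by
  induction n generalizing c p with
  | zero =>
    refine contDiffOn_zero.2 fun w hw => ?_
    exact (hasDerivAt_rpowIntegral hc hb hb01 hw).continuousAt.continuousWithinAt
  | succ n ih =>
    have : ((n + 1 : ℕ) : WithTop ℕ∞) = (n : WithTop ℕ∞) + 1 := by norm_cast
    rw [this, contDiffOn_succ_iff_deriv_of_isOpen isOpen_Iio]
    refine ⟨fun w hw => (hasDerivAt_rpowIntegral hc hb hb01
      hw).differentiableAt.differentiableWithinAt, by simp, ?_⟩
    refine (ih (p := p - 1) (c := fun τ => -(p * c τ * b τ)) (by fun_prop)).congr fun w hw => ?_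
    exact (hasDerivAt_rpowIntegral hc hb hb01 hw).deriv

lemma rpowIntegral_pos (hc : Continuous c) (hb : Continuous b)
    (hb01 : ∀ τ ∈ Icc (0 : ℝ) 1, b τ ∈ Icc (0 : ℝ) 1) (hc0 : ∀ τ ∈ Ioo (0 : ℝ) 1, 0 < c τ)
    (hw : w < 1) : 0 < rpowIntegral c b p w := by
  apply intervalIntegral.intervalIntegral_pos_of_pos_on _ _ zero_lt_one
  · apply ContinuousOn.intervalIntegrable
    rw [uIcc_of_le zero_le_one]
    exact (continuousOn_rpowIntegrand hc hb hb01).comp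
      (f := fun τ => ((w, τ) : ℝ × ℝ)) (by fun_prop) (fun τ hτ => ⟨hw, hτ⟩)
  · intro τ hτ
    exact mul_pos (hc0 τ hτ)
      (Real.rpow_pos_of_pos (one_sub_mul_pos (hb01 τ (Ioo_subset_Icc_self hτ)) hw) p)

end RpowIntegral

/-! ### Powers of the norm -/

section NormPow

variable {V : Type*} [NormedAddCommGroup V] [InnerProductSpace ℝ V]

open scoped RealInnerProductSpace

/-- Up to the factor `3` this is the gradient of `‖x‖³`. Its derivative away from `0` is bounded by
`2‖x‖`, hence extends continuously by `0`. -/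
lemma contDiff_norm_smul : ContDiff ℝ 1 (fun x : V => ‖x‖ • x) := by
  rw [contDiff_one_iff_hasFDerivAt]
  refine ⟨fun x => ‖x‖ • ContinuousLinearMap.id ℝ V + (‖x‖⁻¹ • innerSL ℝ x).smulRight x, ?_, ?_⟩
  · rw [continuous_iff_continuousAt]
    intro x
    rcases eq_or_ne x 0 with rfl | hx
    · unfold ContinuousAt
      have h0 : ‖(0 : V)‖ • ContinuousLinearMap.id ℝ V +
          (‖(0 : V)‖⁻¹ • innerSL ℝ (0 : V)).smulRight (0 : V) = 0 := by simp
      beta_reduce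
      rw [h0]
      have hlim : Tendsto (fun x : V => 2 * ‖x‖) (𝓝 0) (𝓝 0) := by
        have : Continuous fun x : V => 2 * ‖x‖ := by fun_prop
        simpa using this.tendsto 0
      refine squeeze_zero_norm (fun x => ?_) hlim
      have a1 : ‖‖x‖ • ContinuousLinearMap.id ℝ V‖ ≤ ‖x‖ := by
        rw [norm_smul, norm_norm]
        exact mul_le_of_le_one_right (norm_nonneg _) ContinuousLinearMap.norm_id_le
      have a2 : ‖(‖x‖⁻¹ • innerSL ℝ x).smulRight x‖ ≤ ‖x‖ := by
        rw [ContinuousLinearMap.norm_smulRight_apply, norm_smul, innerSL_apply_norm, norm_inv,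
          norm_norm]
        exact mul_le_of_le_one_left (norm_nonneg _) (inv_mul_le_one)
      linarith [norm_add_le (‖x‖ • ContinuousLinearMap.id ℝ V) ((‖x‖⁻¹ • innerSL ℝ x).smulRight x)]
    · have hn : ‖x‖ ≠ 0 := norm_ne_zero_iff.2 hx
      have h1 : ContinuousAt (fun x : V => ‖x‖⁻¹ • innerSL ℝ x) x := by
        refine ContinuousAt.fun_smul ?_ (innerSL ℝ).continuous.continuousAt
        exact continuous_norm.continuousAt.inv₀ hn
      have h2 : ContinuousAt (fun x : V => (‖x‖⁻¹ • innerSL ℝ x).smulRight x) x :=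
        (ContinuousLinearMap.smulRightL ℝ V V).continuous₂.continuousAt.comp₂ h1 continuousAt_id
      exact (by fun_prop : ContinuousAt (fun x : V => ‖x‖ • ContinuousLinearMap.id ℝ V) x).add h2
  · intro x
    rcases eq_or_ne x 0 with rfl | hx
    · simp only [norm_zero, zero_smul, ContinuousLinearMap.smulRight_zero, add_zero]
      rw [hasFDerivAt_iff_isLittleO_nhds_zero]
      simp only [zero_add, norm_zero, zero_smul, sub_zero, zero_apply]
      rw [Asymptotics.isLittleO_iff]
      intro ε hε
      filter_upwards [Metric.ball_mem_nhds (0 : V) hε] with x hx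
      rw [norm_smul, norm_norm]
      have : ‖x‖ < ε := by simpa using hx
      gcongr
    · have h1 : HasFDerivAt (fun x : V => ‖x‖) (‖x‖⁻¹ • innerSL ℝ x) x := by
        have h := ((hasStrictFDerivAt_norm_sq x).hasFDerivAt.sqrt (by positivity))
        simp only [Real.sqrt_sq (norm_nonneg _)] at h
        convert h using 1
        ext y
        simp
        field_simp
      have h2 := h1.smul (hasFDerivAt_id x)
      exact h2

lemma contDiff_norm_pow_three : ContDiff ℝ 2 (fun x : V => ‖x‖ ^ 3) := by
  have e : (2 : WithTop ℕ∞) = ((1 : ℕ) : WithTop ℕ∞) + 1 := by norm_num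
  rw [e, contDiff_succ_iff_hasFDerivAt]
  refine ⟨fun x => (3 : ℝ) • innerSL ℝ (‖x‖ • x), ?_, fun x => ?_⟩
  · exact ((innerSL ℝ).contDiff.comp (by simpa using contDiff_norm_smul (V := V))).const_smul _
  · have h := hasFDerivAt_norm_rpow x (p := 3) (by norm_num)
    have h3 : (fun x : V => ‖x‖ ^ (3 : ℝ)) = fun x => ‖x‖ ^ 3 := by
      ext x; exact_mod_cast Real.rpow_natCast ‖x‖ 3
    rw [h3] at h
    have h4 : (3 : ℝ) - 2 = 1 := by norm_num
    rw [h4, Real.rpow_one] at h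
    beta_reduce
    rwa [map_smul, smul_smul]

/-- Even powers are powers of the smooth function `‖x‖²`; odd ones are `‖x‖³` times such a power.
This gives the `C²` regularity at the rim, where `‖x'‖^k` occurs. -/
lemma contDiff_norm_pow {k : ℕ} (hk : 2 ≤ k) : ContDiff ℝ 2 (fun x : V => ‖x‖ ^ k) := by
  rcases Nat.even_or_odd' k with ⟨i, rfl | rfl⟩
  · simp only [pow_mul]
    exact (contDiff_norm_sq ℝ).pow i
  · obtain ⟨l, rfl⟩ : ∃ l, i = l + 1 := ⟨i - 1, by omega⟩
    have : (fun x : V => ‖x‖ ^ (2 * (l + 1) + 1)) = fun x => ‖x‖ ^ 3 * (‖x‖ ^ 2) ^ l := by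
      ext x; ring
    rw [this]
    exact contDiff_norm_pow_three.mul ((contDiff_norm_sq ℝ).pow l)

end NormPow

/-! ### Smooth forms of the scaling integral -/

section ScalingSmooth

variable {j : ℕ}

lemma pow_mem_Icc_of_mem_Icc (n : ℕ) {τ : ℝ} (hτ : τ ∈ Icc (0 : ℝ) 1) : τ ^ n ∈ Icc (0 : ℝ) 1 :=
  ⟨pow_nonneg hτ.1 n, pow_le_one₀ hτ.1 hτ.2⟩

/-- The smooth factor of the scaling integral at `0`. -/
def originFactor (j : ℕ) : ℝ → ℝ := rpowIntegral (fun τ => τ ^ j) (fun τ => τ ^ (2 * j)) (-(1 / 2))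

lemma contDiffOn_originFactor (j : ℕ) : ContDiffOn ℝ 2 (originFactor j) (Iio 1) :=
  contDiffOn_rpowIntegral 2 (by fun_prop) (by fun_prop) fun _ hτ => pow_mem_Icc_of_mem_Icc _ hτ

/-- Substitution `t = r τ`: one factor `r` comes from `dt` and `r^j` from the numerator. -/
lemma scalingInv_eq_originFactor (hj : 1 ≤ j) {r : ℝ} (h0 : 0 ≤ r) (h1 : r < 1) :
    scalingInv (j + 1) r = r ^ (j + 1) * originFactor j (r ^ (2 * j)) := by
  have h := intervalIntegral.mul_integral_comp_mul_left (a := 0) (b := 1) (f := scalingDensity j) r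
  rw [mul_zero, mul_one] at h
  rw [scalingInv_succ, ← h, originFactor, rpowIntegral, pow_succ', mul_assoc]
  congr 1
  rw [← intervalIntegral.integral_const_mul]
  apply intervalIntegral.integral_congr
  intro τ hτ
  rw [uIcc_of_le zero_le_one] at hτ
  have hpos : 0 < 1 - r ^ (2 * j) * τ ^ (2 * j) := one_sub_mul_pos (pow_mem_Icc_of_mem_Icc _ hτ)
    (pow_lt_one₀ h0 h1 (by omega))
  simp only [scalingDensity]
  rw [mul_pow, mul_pow, Real.rpow_neg hpos.le, ← Real.sqrt_eq_rpow]
  ring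

/-- The smooth factor of the complementary scaling integral at `1`. -/
def poleFactor (j : ℕ) : ℝ → ℝ :=
  rpowIntegral (fun _ => 1 / (j : ℝ)) (fun τ => τ ^ 2) (-(((j : ℝ) - 1) / (2 * j)))

lemma contDiffOn_poleFactor (j : ℕ) : ContDiffOn ℝ 2 (poleFactor j) (Iio 1) :=
  contDiffOn_rpowIntegral 2 (by fun_prop) (by fun_prop) fun _ hτ => pow_mem_Icc_of_mem_Icc _ hτ

lemma poleFactor_pos (hj : 1 ≤ j) {w : ℝ} (hw : w < 1) : 0 < poleFactor j w := by
  have : (0 : ℝ) < j := by exact_mod_cast hj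
  exact rpowIntegral_pos (by fun_prop) (by fun_prop) (fun _ hτ => pow_mem_Icc_of_mem_Icc _ hτ)
    (fun _ _ => by positivity) hw

lemma mul_poleFactor_sq (j : ℕ) (u : ℝ) : u * poleFactor j (u ^ 2) =
    ∫ v in (0 : ℝ)..u, 1 / (j : ℝ) * (1 - v ^ 2) ^ (-(((j : ℝ) - 1) / (2 * j))) := by
  have h := intervalIntegral.mul_integral_comp_mul_left (a := 0) (b := 1)
    (f := fun v => 1 / (j : ℝ) * (1 - v ^ 2) ^ (-(((j : ℝ) - 1) / (2 * j)))) u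
  rw [mul_zero, mul_one] at h
  rw [← h, poleFactor, rpowIntegral]
  simp only [mul_pow]

lemma hasDerivAt_mul_poleFactor_sq {u : ℝ} (hu : u ∈ Ioo (-1 : ℝ) 1) :
    HasDerivAt (fun u => u * poleFactor j (u ^ 2))
      (1 / (j : ℝ) * (1 - u ^ 2) ^ (-(((j : ℝ) - 1) / (2 * j)))) u := by
  have hc : ∀ v ∈ Ioo (-1 : ℝ) 1, ContinuousAt
      (fun v : ℝ => 1 / (j : ℝ) * (1 - v ^ 2) ^ (-(((j : ℝ) - 1) / (2 * j)))) v := by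
    intro v hv
    have h : 1 - v ^ 2 ≠ 0 := by nlinarith [hv.1, hv.2]
    have h1 : ContinuousAt (fun v : ℝ => 1 - v ^ 2) v := by fun_prop
    exact continuousAt_const.mul (h1.rpow_const (Or.inl h))
  have e : (fun u => u * poleFactor j (u ^ 2)) = fun u => ∫ v in (0 : ℝ)..u,
      1 / (j : ℝ) * (1 - v ^ 2) ^ (-(((j : ℝ) - 1) / (2 * j))) := funext (mul_poleFactor_sq j)
  rw [e]
  have hsub : uIcc 0 u ⊆ Ioo (-1 : ℝ) 1 :=
    Set.OrdConnected.uIcc_subset ordConnected_Ioo ⟨by norm_num, by norm_num⟩ hu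
  apply intervalIntegral.integral_hasDerivAt_right
  · exact ContinuousOn.intervalIntegrable fun v hv => (hc v (hsub hv)).continuousWithinAt
  · exact ContinuousOn.stronglyMeasurableAtFilter (s := Ioo (-1) 1) isOpen_Ioo
      (fun v hv => (hc v hv).continuousWithinAt) u hu
  · exact hc u hu

/-- The substitution `v = √(1 - t^(2j))` removes the singularity at `1`: it turns `t^j dt / v` into
`-(1/j) (1 - v²)^(-(j-1)/(2j)) dv`, regular at `v = 0`. It is carried out by checking that `H` has
zero derivative on the open interval, continuity taking care of the endpoint `1`. -/
lemma scalingMax_sub_scalingInv (hj : 1 ≤ j) {y : ℝ} (h0 : 0 < y) (h1 : y ≤ 1) :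
    scalingMax (j + 1) - scalingInv (j + 1) y =
      √(1 - y ^ (2 * j)) * poleFactor j (1 - y ^ (2 * j)) := by
  have hj0 : (0 : ℝ) < j := by exact_mod_cast hj
  rcases h1.eq_or_lt with rfl | h1
  · simp [scalingMax]
  let u : ℝ → ℝ := fun y => √(1 - y ^ (2 * j))
  have hle : ∀ x ∈ Icc y 1, 0 ≤ 1 - x ^ (2 * j) := fun x hx =>
    sub_nonneg.2 (pow_le_one₀ (h0.le.trans hx.1) hx.2)
  have hu1 : ∀ x ∈ Icc y 1, u x ∈ Ioo (-1 : ℝ) 1 := by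
    intro x hx
    refine ⟨lt_of_lt_of_le (by norm_num) (Real.sqrt_nonneg _), ?_⟩
    rw [Real.sqrt_lt' one_pos, one_pow]
    have : 0 < x ^ (2 * j) := pow_pos (h0.trans_le hx.1) _
    linarith
  let H : ℝ → ℝ := fun x => scalingInv (j + 1) x + u x * poleFactor j (u x ^ 2)
  have hcont : ContinuousOn H (Icc y 1) := by
    refine ContinuousOn.add ((continuousOn_scalingInv hj).mono
      (Icc_subset_Icc_left h0.le)) fun x hx => ?_
    have huc : ContinuousAt u x := by fun_prop
    exact ((hasDerivAt_mul_poleFactor_sq (j := j) (hu1 x hx)).continuousAt.comp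
      huc).continuousWithinAt
  obtain ⟨x, hx, hxe⟩ := exists_hasDerivAt_eq_slope H (fun _ => 0) h1 hcont (by
    intro x hx
    have hx0 : 0 < x := h0.trans hx.1
    have hp := one_sub_pow_pos hj hx0.le hx.2
    have d1 := hasDerivAt_scalingInv hj hx0 hx.2
    have d2 : HasDerivAt u (-(((2 * j : ℕ) : ℝ) * x ^ (2 * j - 1)) / (2 * √(1 - x ^ (2 * j)))) x :=
      ((hasDerivAt_pow (2 * j) x).const_sub 1).sqrt hp.ne'
    have d3 := (hasDerivAt_mul_poleFactor_sq (j := j) (hu1 x (Ioo_subset_Icc_self hx))).comp x d2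
    have hu2 : 1 - u x ^ 2 = x ^ (2 * j) := by
      simp only [u]
      rw [Real.sq_sqrt hp.le]; ring
    -- The exponents add up as `-(j - 1) + (2j - 1) = j`.
    have hpow : (x ^ (2 * j)) ^ (-(((j : ℝ) - 1) / (2 * j))) * x ^ (2 * j - 1) = x ^ j := by
      rw [← Real.rpow_natCast, ← Real.rpow_mul hx0.le, ← Real.rpow_natCast, ← Real.rpow_natCast,
        ← Real.rpow_add hx0]
      congr 1
      have : ((2 * j - 1 : ℕ) : ℝ) = 2 * j - 1 := by
        rw [Nat.cast_sub (by omega)]; push_cast; ring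
      rw [this]
      push_cast
      field_simp
      ring
    have d4 := d1.add d3
    refine d4.congr_deriv ?_
    rw [hu2, scalingDensity, ← hpow]
    push_cast
    field_simp
    ring)
  have hH : H y = H 1 := by
    have : (0 : ℝ) = (H 1 - H y) / (1 - y) := hxe
    rw [eq_div_iff (by linarith)] at this
    linarith
  have hH1 : H 1 = scalingMax (j + 1) := by simp [H, u, scalingMax]
  have hHy : H y = scalingInv (j + 1) y + √(1 - y ^ (2 * j)) * poleFactor j (1 - y ^ (2 * j)) := by
    simp only [H, u]
    rw [Real.sq_sqrt (hle y ⟨le_rfl, h1.le⟩)]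
  rw [← hH1, ← hH, hHy]
  ring

end ScalingSmooth

/-! ### The model array -/

section Model

variable {m j : ℕ}

lemma euc_nontrivial (hm : 1 ≤ m) : Nontrivial (Euc m) :=
  Module.nontrivial_of_finrank_pos (R := ℝ) (by simp; omega)

lemma boundaryDist_closedBall (hm : 1 ≤ m) {c x : Euc m} {r : ℝ} (hr : 0 < r)
    (hx : x ∈ Metric.closedBall c r) : boundaryDist (Metric.closedBall c r) x = r - dist x c := by
  have := euc_nontrivial hm
  rw [boundaryDist, frontier_closedBall c hr.ne']
  rw [Metric.mem_closedBall] at hx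
  obtain ⟨v, hv1, hv2⟩ : ∃ v : Euc m, ‖v‖ = 1 ∧ x = c + dist x c • v := by
    rcases eq_or_ne x c with rfl | hne
    · obtain ⟨v, hv⟩ := exists_norm_eq (Euc m) zero_le_one
      exact ⟨v, hv, by simp⟩
    · have h0 : dist x c ≠ 0 := dist_ne_zero.2 hne
      refine ⟨(dist x c)⁻¹ • (x - c), ?_, ?_⟩
      · rw [norm_smul, ← dist_eq_norm, norm_inv, Real.norm_of_nonneg dist_nonneg,
          inv_mul_cancel₀ h0]
      · rw [smul_inv_smul₀ h0]
        abel
  have hmem : c + r • v ∈ Metric.sphere c r := by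
    rw [mem_sphere_iff_norm, add_sub_cancel_left, norm_smul, hv1, Real.norm_of_nonneg hr.le, mul_one]
  apply le_antisymm
  · refine (Metric.infDist_le_dist_of_mem hmem).trans ?_
    nth_rewrite 1 [hv2]
    rw [dist_eq_norm, add_sub_add_left_eq_sub, ← sub_smul, norm_smul, hv1, mul_one, Real.norm_eq_abs,
      abs_sub_comm, abs_of_nonneg (by linarith)]
  · refine (Metric.le_infDist ⟨_, hmem⟩).2 fun y hy => ?_
    have h1 : dist y c = r := hy
    have := dist_triangle_left y c x
    linarith

lemma sq_eq_sq_iff_of_nonneg {a b : ℝ} (ha : 0 ≤ a) (hb : 0 ≤ b) : a ^ 2 = b ^ 2 ↔ a = b :=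
  pow_left_inj₀ ha hb two_ne_zero

/-- Inverting `scalingFn` gives the array as a level set in which the base and fibre norms enter
separately; convexity and regularity are read off from it. -/
lemma mem_modelArray_iff (hm : 1 ≤ m) (hj : 1 ≤ j) {p : Amb m (j + 1)} :
    p ∈ modelArray m (j + 1) ↔
      ‖p.snd‖ ≤ 1 ∧ ‖p.fst‖ + scalingInv (j + 1) ‖p.snd‖ = scalingMax (j + 1) := by
  have hM := scalingMax_pos hj
  constructor
  · rintro ⟨h1, h2⟩
    beta_reduce at h2
    rw [boundaryDist_closedBall hm hM h1, dist_zero_right] at h2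
    rw [mem_closedBall_zero_iff] at h1
    have hs : scalingMax (j + 1) - ‖p.fst‖ ∈ Icc 0 (scalingMax (j + 1)) :=
      ⟨by linarith, by linarith [norm_nonneg p.fst]⟩
    obtain ⟨a1, a2⟩ := scalingFn_spec hj hs
    rw [sq_eq_sq_iff_of_nonneg (norm_nonneg _) a1.1] at h2
    rw [h2, a2]
    exact ⟨a1.2, by ring⟩
  · rintro ⟨h1, h2⟩
    have hy : ‖p.snd‖ ∈ Icc (0 : ℝ) 1 := ⟨norm_nonneg _, h1⟩
    have hG := scalingInv_mem hj hy
    have hx : p.fst ∈ Metric.closedBall (0 : Euc m) (scalingMax (j + 1)) := by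
      rw [mem_closedBall_zero_iff]; linarith [hG.1]
    refine ⟨hx, ?_⟩
    beta_reduce
    rw [boundaryDist_closedBall hm hM hx, dist_zero_right]
    have : scalingMax (j + 1) - ‖p.fst‖ = scalingInv (j + 1) ‖p.snd‖ := by linarith
    rw [this, scalingFn_scalingInv hj hy]

/-- The convex body bounded by the model array. -/
def modelBody (m j : ℕ) : Set (Amb m (j + 1)) :=
  {p | ‖p.snd‖ ≤ 1 ∧ ‖p.fst‖ + scalingInv (j + 1) ‖p.snd‖ ≤ scalingMax (j + 1)}

lemma continuousOn_modelDefining (hj : 1 ≤ j) :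
    ContinuousOn (fun p : Amb m (j + 1) => ‖p.fst‖ + scalingInv (j + 1) ‖p.snd‖)
      {p | ‖p.snd‖ ≤ 1} := by
  refine ContinuousOn.add (by fun_prop) ?_
  exact (continuousOn_scalingInv hj).comp (by fun_prop) fun p hp => ⟨norm_nonneg _, hp⟩

lemma isClosed_norm_snd_le_one : IsClosed {p : Amb m (j + 1) | ‖p.snd‖ ≤ 1} :=
  isClosed_le (by fun_prop) (by fun_prop)

lemma isBounded_modelBody (hj : 1 ≤ j) : Bornology.IsBounded (modelBody m j) := by
  refine (isBounded_iff_forall_norm_le).2 ⟨√(scalingMax (j + 1) ^ 2 + 1 ^ 2), fun p hp => ?_⟩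
  rw [WithLp.prod_norm_eq_of_L2]
  have := (scalingInv_mem hj ⟨norm_nonneg p.snd, hp.1⟩).1
  have := hp.2
  apply Real.sqrt_le_sqrt
  gcongr
  · linarith
  · exact hp.1

lemma isClosed_modelBody (hj : 1 ≤ j) : IsClosed (modelBody m j) :=
  (continuousOn_modelDefining hj).preimage_isClosed_of_isClosed isClosed_norm_snd_le_one isClosed_Iic

lemma isCompact_modelBody (hj : 1 ≤ j) : IsCompact (modelBody m j) :=
  Metric.isCompact_of_isClosed_isBounded (isClosed_modelBody hj) (isBounded_modelBody hj)

lemma mem_interior_modelBody (hj : 1 ≤ j) {p : Amb m (j + 1)} (h1 : ‖p.snd‖ ≤ 1)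
    (h2 : ‖p.fst‖ + scalingInv (j + 1) ‖p.snd‖ < scalingMax (j + 1)) :
    p ∈ interior (modelBody m j) := by
  -- At `‖p.snd‖ = 1` the function `scalingInv` already attains `M_k`, so a strict inequality keeps
  -- `p` away from the edge of its domain of continuity.
  have h3 : ‖p.snd‖ < 1 := by
    refine h1.lt_of_ne fun h => ?_
    rw [h] at h2
    have : scalingInv (j + 1) 1 = scalingMax (j + 1) := rfl
    linarith [norm_nonneg p.fst]
  have hn : {p : Amb m (j + 1) | ‖p.snd‖ ≤ 1} ∈ 𝓝 p := by
    have hc : ContinuousAt (fun p : Amb m (j + 1) => ‖p.snd‖) p := by fun_prop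
    exact (hc.eventually_lt continuousAt_const h3).mono fun q hq => le_of_lt hq
  rw [mem_interior_iff_mem_nhds]
  have hc := (continuousOn_modelDefining hj p h1).continuousAt hn
  filter_upwards [hn, hc.eventually_lt continuousAt_const h2] with q hq1 hq2 using ⟨hq1, hq2.le⟩

/-- If the fibre norms differ, strict convexity of `scalingInv` gives a strict inequality. If the
fibre components differ but have equal norms, strict convexity of the ball in the fibre shortens
their mean and `scalingInv` strictly decreases. If the fibre components coincide, the ball in the
base is used. -/
lemma strictConvex_modelBody (hj : 1 ≤ j) : StrictConvex ℝ (modelBody m j) := by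
  have hG := strictMonoOn_scalingInv hj
  have hGc := strictConvexOn_scalingInv hj
  rintro p ⟨p1, p2⟩ q ⟨q1, q2⟩ hpq s t hs ht hst
  set M := scalingMax (j + 1)
  set G := scalingInv (j + 1)
  have fstle : ‖s • p.fst + t • q.fst‖ ≤ s * ‖p.fst‖ + t * ‖q.fst‖ := by
    refine (norm_add_le _ _).trans_eq ?_
    rw [norm_smul, norm_smul, Real.norm_of_nonneg hs.le, Real.norm_of_nonneg ht.le]
  have sndle : ‖s • p.snd + t • q.snd‖ ≤ s * ‖p.snd‖ + t * ‖q.snd‖ := by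
    refine (norm_add_le _ _).trans_eq ?_
    rw [norm_smul, norm_smul, Real.norm_of_nonneg hs.le, Real.norm_of_nonneg ht.le]
  have pI : ‖p.snd‖ ∈ Icc (0 : ℝ) 1 := ⟨norm_nonneg _, p1⟩
  have qI : ‖q.snd‖ ∈ Icc (0 : ℝ) 1 := ⟨norm_nonneg _, q1⟩
  have avI : s * ‖p.snd‖ + t * ‖q.snd‖ ∈ Icc (0 : ℝ) 1 :=
    (convex_Icc (0 : ℝ) 1) pI qI hs.le ht.le hst
  have sI : ‖s • p.snd + t • q.snd‖ ∈ Icc (0 : ℝ) 1 := ⟨norm_nonneg _, sndle.trans avI.2⟩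
  have Gle : G ‖s • p.snd + t • q.snd‖ ≤ G (s * ‖p.snd‖ + t * ‖q.snd‖) :=
    hG.monotoneOn sI avI sndle
  have Gcv : G (s * ‖p.snd‖ + t * ‖q.snd‖) ≤ s * G ‖p.snd‖ + t * G ‖q.snd‖ :=
    hGc.convexOn.2 pI qI hs.le ht.le hst
  have hM : s * (‖p.fst‖ + G ‖p.snd‖) + t * (‖q.fst‖ + G ‖q.snd‖) ≤ M := by
    calc _ ≤ s * M + t * M := by gcongr
      _ = M := by rw [← add_mul, hst, one_mul]
  apply mem_interior_modelBody hj
  · exact sI.2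
  change ‖s • p.fst + t • q.fst‖ + G ‖s • p.snd + t • q.snd‖ < M
  by_cases hn : ‖p.snd‖ = ‖q.snd‖
  · by_cases hsnd : p.snd = q.snd
    · have hfst : p.fst ≠ q.fst := fun h => hpq (WithLp.ofLp_injective 2 (Prod.ext h hsnd))
      have e : G ‖s • p.snd + t • q.snd‖ = G ‖p.snd‖ := by
        rw [← hsnd, ← add_smul, hst, one_smul]
      rw [e]
      rw [← hn] at q2
      have hp' : ‖p.fst‖ ≤ M - G ‖p.snd‖ := by linarith
      have hq' : ‖q.fst‖ ≤ M - G ‖p.snd‖ := by linarith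
      have hr : M - G ‖p.snd‖ ≠ 0 := by
        intro h0
        rw [h0] at hp' hq'
        exact hfst ((norm_le_zero_iff.1 hp').trans (norm_le_zero_iff.1 hq').symm)
      have := strictConvex_closedBall ℝ (0 : Euc m) (M - G ‖p.snd‖)
        (mem_closedBall_zero_iff.2 hp') (mem_closedBall_zero_iff.2 hq') hfst hs ht hst
      rw [interior_closedBall _ hr, mem_ball_zero_iff] at this
      linarith
    · have hr : ‖p.snd‖ ≠ 0 := by
        intro h0
        have h0' := hn ▸ h0
        exact hsnd ((norm_eq_zero.1 h0).trans (norm_eq_zero.1 h0').symm)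
      have := strictConvex_closedBall ℝ (0 : Euc (j + 1)) ‖p.snd‖
        (mem_closedBall_zero_iff.2 le_rfl) (mem_closedBall_zero_iff.2 hn.symm.le) hsnd hs ht hst
      rw [interior_closedBall _ hr, mem_ball_zero_iff] at this
      have e : s * ‖p.snd‖ + t * ‖q.snd‖ = ‖p.snd‖ := by rw [← hn, ← add_mul, hst, one_mul]
      have := hG sI avI (by rw [e]; exact this)
      nlinarith
  · have := hGc.2 pI qI hn hs ht hst
    have h' : G (s * ‖p.snd‖ + t * ‖q.snd‖) < s * G ‖p.snd‖ + t * G ‖q.snd‖ := this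
    nlinarith

lemma frontier_modelBody (hm : 1 ≤ m) (hj : 1 ≤ j) :
    frontier (modelBody m j) = modelArray m (j + 1) := by
  have hG := strictMonoOn_scalingInv hj
  ext p
  rw [(isClosed_modelBody hj).frontier_eq, mem_modelArray_iff hm hj]
  constructor
  · rintro ⟨⟨h1, h2⟩, h3⟩
    refine ⟨h1, h2.eq_of_not_lt fun h => h3 (mem_interior_modelBody hj h1 h)⟩
  · rintro ⟨h1, h2⟩
    refine ⟨⟨h1, h2.le⟩, fun h3 => ?_⟩
    -- Moving radially outward strictly increases the defining function, so a point of the level set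
    -- cannot be interior.
    have hc : ContinuousAt (fun t : ℝ => (1 + t) • p) 0 := by fun_prop
    have h0 : (1 + (0 : ℝ)) • p = p := by simp
    have hev : ∀ᶠ t in 𝓝 (0 : ℝ), (1 + t) • p ∈ modelBody m j := by
      apply hc.eventually_mem
      rw [h0]
      exact mem_interior_iff_mem_nhds.1 h3
    obtain ⟨t, ht, ht0⟩ := ((hev.filter_mono nhdsWithin_le_nhds).and
      (self_mem_nhdsWithin (a := (0 : ℝ)) (s := Ioi 0))).exists
    have ht0 : 0 < t := ht0
    obtain ⟨k1, k2⟩ := ht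
    have e1 : ‖((1 + t) • p).fst‖ = (1 + t) * ‖p.fst‖ := by
      change ‖(1 + t) • p.fst‖ = _
      rw [norm_smul, Real.norm_of_nonneg (by linarith)]
    have e2 : ‖((1 + t) • p).snd‖ = (1 + t) * ‖p.snd‖ := by
      change ‖(1 + t) • p.snd‖ = _
      rw [norm_smul, Real.norm_of_nonneg (by linarith)]
    rw [e1, e2] at k2
    rw [e2] at k1
    have hI : ‖p.snd‖ ∈ Icc (0 : ℝ) 1 := ⟨norm_nonneg _, h1⟩
    have hI' : (1 + t) * ‖p.snd‖ ∈ Icc (0 : ℝ) 1 := ⟨by positivity, k1⟩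
    have l1 : scalingInv (j + 1) ‖p.snd‖ ≤ scalingInv (j + 1) ((1 + t) * ‖p.snd‖) :=
      hG.monotoneOn hI hI' (by nlinarith [norm_nonneg p.snd])
    rcases eq_or_ne ‖p.snd‖ 0 with hz | hz
    · simp only [hz, mul_zero, scalingInv_zero, add_zero] at h2 k2
      have := scalingMax_pos hj
      nlinarith
    · have hz' : 0 < ‖p.snd‖ := hz.symm.lt_of_le (norm_nonneg _)
      have l2 : scalingInv (j + 1) ‖p.snd‖ < scalingInv (j + 1) ((1 + t) * ‖p.snd‖) :=
        hG hI hI' (by nlinarith)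
      nlinarith [norm_nonneg p.fst]

lemma boundsStrictlyConvex_modelArray (hm : 1 ≤ m) (hj : 1 ≤ j) :
    BoundsStrictlyConvex m (j + 1) (modelArray m (j + 1)) := by
  refine ⟨modelBody m j, isCompact_modelBody hj, ⟨0, mem_interior_modelBody hj ?_ ?_⟩,
    strictConvex_modelBody hj, frontier_modelBody hm hj⟩
  · simp
  · simpa [scalingInv_zero] using scalingMax_pos hj

end Model

/-! ### `C²` regularity of the model array -/

section Model

variable {m j : ℕ}

lemma isSphericalArray_modelArray (hm : 1 ≤ m) (hj : 1 ≤ j) :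
    IsSphericalArray m (j + 1) (modelArray m (j + 1)) := by
  refine ⟨_, _, fun x hx => ?_, rfl⟩
  rw [boundaryDist_closedBall hm (scalingMax_pos hj) hx]
  rw [Metric.mem_closedBall] at hx
  exact (scalingFn_spec hj ⟨by linarith, by linarith [dist_nonneg (x := x) (y := 0)]⟩).1.1

lemma fderiv_ne_zero_of_hasDerivAt_line {F : Type*} [NormedAddCommGroup F] [NormedSpace ℝ F]
    {φ : F → ℝ} {p v : F} {c : ℝ} (hφ : DifferentiableAt ℝ φ p) (hc : c ≠ 0)
    (h : HasDerivAt (fun t : ℝ => φ (p + t • v)) c 0) : fderiv ℝ φ p ≠ 0 := by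
  intro h0
  have h1 := hφ.hasFDerivAt
  rw [h0] at h1
  have h2 : HasDerivAt (fun t : ℝ => p + t • v) ((1 : ℝ) • v) 0 :=
    ((hasDerivAt_id (0 : ℝ)).smul_const v).const_add p
  have e : p = p + (0 : ℝ) • v := by simp
  rw [e] at h1
  have h3 := h1.comp_hasDerivAt (0 : ℝ) h2
  exact hc (h.unique h3)

/-- A defining function of the model array away from the axis `x'' = 0`. -/
def rimDefining (m j : ℕ) (p : Amb m (j + 1)) : ℝ :=
  ‖p.fst‖ - scalingMax (j + 1) + ‖p.snd‖ ^ (j + 1) * originFactor j ((‖p.snd‖ ^ 2) ^ j)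

/-- A defining function of the model array away from the base. -/
def poleDefining (m j : ℕ) (p : Amb m (j + 1)) : ℝ :=
  ‖p.fst‖ ^ 2 - (1 - (‖p.snd‖ ^ 2) ^ j) * poleFactor j (1 - (‖p.snd‖ ^ 2) ^ j) ^ 2

lemma contDiff_fst_amb {k : ℕ} : ContDiff ℝ 2 (fun p : Amb m k => p.fst) :=
  (WithLp.fstL 2 ℝ (Euc m) (Euc k)).contDiff

lemma contDiff_snd_amb {k : ℕ} : ContDiff ℝ 2 (fun p : Amb m k => p.snd) :=
  (WithLp.sndL 2 ℝ (Euc m) (Euc k)).contDiff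

lemma contDiffOn_rimDefining (hj : 1 ≤ j) :
    ContDiffOn ℝ 2 (rimDefining m j) {p | p.fst ≠ 0 ∧ ‖p.snd‖ < 1} := by
  have h1 : ContDiffOn ℝ 2 (fun p : Amb m (j + 1) => ‖p.fst‖) {p | p.fst ≠ 0 ∧ ‖p.snd‖ < 1} :=
    fun p hp => (contDiff_fst_amb.contDiffAt.norm ℝ hp.1).contDiffWithinAt
  have h2 : ContDiff ℝ 2 (fun p : Amb m (j + 1) => ‖p.snd‖ ^ (j + 1)) :=
    (contDiff_norm_pow (by omega)).comp contDiff_snd_amb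
  have h3 : ContDiff ℝ 2 (fun p : Amb m (j + 1) => (‖p.snd‖ ^ 2) ^ j) :=
    (contDiff_snd_amb.norm_sq ℝ).pow j
  refine (h1.sub contDiffOn_const).add (h2.contDiffOn.mul ?_)
  refine (contDiffOn_originFactor j).comp h3.contDiffOn fun p hp => ?_
  rw [← pow_mul]
  exact pow_lt_one₀ (norm_nonneg _) hp.2 (by omega)

lemma contDiffOn_poleDefining :
    ContDiffOn ℝ 2 (poleDefining m j) {p | p.snd ≠ 0} := by
  have h1 : ContDiff ℝ 2 (fun p : Amb m (j + 1) => ‖p.fst‖ ^ 2) := contDiff_fst_amb.norm_sq ℝ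
  have h3 : ContDiff ℝ 2 (fun p : Amb m (j + 1) => 1 - (‖p.snd‖ ^ 2) ^ j) :=
    contDiff_const.sub ((contDiff_snd_amb.norm_sq ℝ).pow j)
  refine h1.contDiffOn.sub (h3.contDiffOn.mul (ContDiffOn.pow ?_ 2))
  refine (contDiffOn_poleFactor j).comp h3.contDiffOn fun p hp => ?_
  have : 0 < ‖p.snd‖ := norm_pos_iff.2 hp
  have : 0 < (‖p.snd‖ ^ 2) ^ j := by positivity
  exact mem_Iio.2 (by linarith)

lemma norm_fst_line {k : ℕ} (p : Amb m k) : ∀ᶠ t : ℝ in 𝓝 0,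
    ‖(p + t • WithLp.toLp 2 (p.fst, (0 : Euc k))).fst‖ = (1 + t) * ‖p.fst‖ := by
  filter_upwards [Ioi_mem_nhds (show (-1 : ℝ) < 0 by norm_num)] with t ht
  have ht : -1 < t := ht
  have : (p + t • WithLp.toLp 2 (p.fst, (0 : Euc k))).fst = (1 + t) • p.fst := by
    change p.fst + t • p.fst = _
    module
  rw [this, norm_smul, Real.norm_of_nonneg (by linarith)]

lemma snd_line {k : ℕ} (p : Amb m k) (t : ℝ) :
    (p + t • WithLp.toLp 2 (p.fst, (0 : Euc k))).snd = p.snd := by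
  change p.snd + t • (0 : Euc k) = p.snd
  simp

lemma isOpen_rim : IsOpen {p : Amb m (j + 1) | p.fst ≠ 0 ∧ ‖p.snd‖ < 1} := by
  have h1 : IsOpen {p : Amb m (j + 1) | p.fst ≠ 0} := isOpen_ne_fun (by fun_prop) (by fun_prop)
  have h2 : IsOpen {p : Amb m (j + 1) | ‖p.snd‖ < 1} := isOpen_lt (by fun_prop) (by fun_prop)
  exact h1.inter h2

lemma isOpen_snd_ne_zero : IsOpen {p : Amb m (j + 1) | p.snd ≠ 0} :=
  isOpen_ne_fun (by fun_prop) (by fun_prop)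

lemma fderiv_rimDefining_ne_zero (hj : 1 ≤ j) {p : Amb m (j + 1)} (h1 : p.fst ≠ 0)
    (h2 : ‖p.snd‖ < 1) : fderiv ℝ (rimDefining m j) p ≠ 0 := by
  have hd : DifferentiableAt ℝ (rimDefining m j) p :=
    ((contDiffOn_rimDefining hj).contDiffAt (isOpen_rim.mem_nhds ⟨h1, h2⟩)).differentiableAt
      (by norm_num)
  refine fderiv_ne_zero_of_hasDerivAt_line (v := WithLp.toLp 2 (p.fst, 0)) hd
    (norm_ne_zero_iff.2 h1) ?_
  have h : HasDerivAt (fun t : ℝ => (1 + t) * ‖p.fst‖ - scalingMax (j + 1) +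
      ‖p.snd‖ ^ (j + 1) * originFactor j ((‖p.snd‖ ^ 2) ^ j)) (1 * ‖p.fst‖) 0 :=
    ((((hasDerivAt_id (0 : ℝ)).const_add 1).mul_const _).sub_const _).add_const _
  rw [one_mul] at h
  refine h.congr_of_eventuallyEq ?_
  filter_upwards [norm_fst_line p] with t ht
  rw [rimDefining, ht, snd_line]

/-- Off the axis the derivative is tested in the direction `(x'', 0)`. On the axis that direction is
zero and the radial direction is used: with `‖x'‖ = 1`, the derivative of `-(1 - (1 + t)^(2j))`
contributes `2j` and the squared factor its value at `0`. -/
lemma fderiv_poleDefining_ne_zero (hj : 1 ≤ j) {p : Amb m (j + 1)} (h2 : p.snd ≠ 0)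
    (hp : p.fst = 0 → ‖p.snd‖ = 1) : fderiv ℝ (poleDefining m j) p ≠ 0 := by
  have hd : DifferentiableAt ℝ (poleDefining m j) p :=
    ((contDiffOn_poleDefining).contDiffAt (isOpen_snd_ne_zero.mem_nhds h2)).differentiableAt
      (by norm_num)
  by_cases h1 : p.fst = 0
  · have hn := hp h1
    have hj0 : (0 : ℝ) < j := by exact_mod_cast hj
    have hq := (((contDiffOn_poleFactor j).contDiffAt (Iio_mem_nhds zero_lt_one)).differentiableAt
      (by norm_num)).hasDerivAt
    set q' := deriv (poleFactor j) 0
    have hq0 := poleFactor_pos hj (zero_lt_one' ℝ)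
    refine fderiv_ne_zero_of_hasDerivAt_line (v := p) (c := (2 * j) * poleFactor j 0 ^ 2) hd
      (by positivity) ?_
    have hw : HasDerivAt (fun t : ℝ => 1 - ((1 + t) ^ 2) ^ j) (-(2 * (j : ℝ))) 0 := by
      have := (((hasDerivAt_id (0 : ℝ)).const_add 1).pow (2 * j)).const_sub 1
      simp only [← pow_mul]
      refine this.congr_deriv ?_
      simp
    have hw0 : (fun t : ℝ => 1 - ((1 + t) ^ 2) ^ j) 0 = 0 := by simp
    have hqw := HasDerivAt.comp_of_eq (0 : ℝ) hq hw hw0.symm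
    have hT := (hw.mul (hqw.pow 2)).const_sub 0
    have hT' : HasDerivAt (fun t : ℝ => 0 - (1 - ((1 + t) ^ 2) ^ j) *
        poleFactor j (1 - ((1 + t) ^ 2) ^ j) ^ 2) ((2 * j) * poleFactor j 0 ^ 2) 0 := by
      refine hT.congr_deriv ?_
      simp
    refine hT'.congr_of_eventuallyEq ?_
    filter_upwards [Ioi_mem_nhds (show (-1 : ℝ) < 0 by norm_num)] with t ht
    have ht : -1 < t := ht
    have e1 : (p + t • p).fst = 0 := by
      change p.fst + t • p.fst = 0
      simp [h1]
    have e2 : ‖(p + t • p).snd‖ = 1 + t := by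
      have : (p + t • p).snd = (1 + t) • p.snd := by
        change p.snd + t • p.snd = _
        module
      rw [this, norm_smul, hn, mul_one, Real.norm_of_nonneg (by linarith)]
    rw [poleDefining, e1, e2]
    simp
  · have hn : ‖p.fst‖ ≠ 0 := norm_ne_zero_iff.2 h1
    refine fderiv_ne_zero_of_hasDerivAt_line (v := WithLp.toLp 2 (p.fst, 0))
      (c := 2 * ‖p.fst‖ ^ 2) hd (by positivity) ?_
    have h := ((((hasDerivAt_id (0 : ℝ)).const_add 1).mul_const ‖p.fst‖).pow 2).sub_const
      ((1 - (‖p.snd‖ ^ 2) ^ j) * poleFactor j (1 - (‖p.snd‖ ^ 2) ^ j) ^ 2)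
    have h' : HasDerivAt (fun t : ℝ => ((1 + t) * ‖p.fst‖) ^ 2 -
        (1 - (‖p.snd‖ ^ 2) ^ j) * poleFactor j (1 - (‖p.snd‖ ^ 2) ^ j) ^ 2)
        (2 * ‖p.fst‖ ^ 2) 0 := by
      refine h.congr_deriv ?_
      simp
      ring
    refine h'.congr_of_eventuallyEq ?_
    filter_upwards [norm_fst_line p] with t ht
    rw [poleDefining, ht, snd_line]

lemma mem_modelArray_iff_rimDefining (hm : 1 ≤ m) (hj : 1 ≤ j) {p : Amb m (j + 1)}
    (h2 : ‖p.snd‖ < 1) : p ∈ modelArray m (j + 1) ↔ rimDefining m j p = 0 := by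
  rw [mem_modelArray_iff hm hj, rimDefining, ← pow_mul,
    ← scalingInv_eq_originFactor hj (norm_nonneg _) h2]
  constructor
  · rintro ⟨_, h⟩
    linarith
  · intro h
    exact ⟨h2.le, by linarith⟩

lemma mem_modelArray_iff_poleDefining (hm : 1 ≤ m) (hj : 1 ≤ j) {p : Amb m (j + 1)}
    (h2 : p.snd ≠ 0) : p ∈ modelArray m (j + 1) ↔ poleDefining m j p = 0 := by
  have hn : 0 < ‖p.snd‖ := norm_pos_iff.2 h2
  rw [mem_modelArray_iff hm hj, poleDefining, ← pow_mul]
  have hpw : 0 < ‖p.snd‖ ^ (2 * j) := by positivity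
  have hq := poleFactor_pos hj (w := 1 - ‖p.snd‖ ^ (2 * j)) (by linarith)
  have key : ∀ h1 : ‖p.snd‖ ≤ 1, (scalingMax (j + 1) - scalingInv (j + 1) ‖p.snd‖) ^ 2 =
      (1 - ‖p.snd‖ ^ (2 * j)) * poleFactor j (1 - ‖p.snd‖ ^ (2 * j)) ^ 2 := by
    intro h1
    rw [scalingMax_sub_scalingInv hj hn h1, mul_pow, Real.sq_sqrt
      (sub_nonneg.2 (pow_le_one₀ hn.le h1))]
  constructor
  · rintro ⟨h1, h⟩
    rw [← key h1, ← h]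
    ring
  · intro h
    have h1 : ‖p.snd‖ ≤ 1 := by
      -- Outside the unit cylinder `1 - ‖x'‖^(2j)` is negative, so the defining function is positive
      -- and the squared equation has no spurious zeros.
      by_contra! hlt
      have : 1 < ‖p.snd‖ ^ (2 * j) := one_lt_pow₀ hlt (by omega)
      nlinarith [mul_pos (sub_pos.2 this) (pow_pos hq 2), sq_nonneg ‖p.fst‖]
    refine ⟨h1, ?_⟩
    rw [← key h1, sub_eq_zero] at h
    have hG := scalingInv_mem hj ⟨hn.le, h1⟩
    rw [sq_eq_sq_iff_of_nonneg (norm_nonneg _) (by linarith [hG.2])] at h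
    linarith

lemma isC2Hypersurface_modelArray (hm : 1 ≤ m) (hj : 1 ≤ j) :
    IsC2Hypersurface m (j + 1) (modelArray m (j + 1)) := by
  intro p hp
  have hp' := (mem_modelArray_iff hm hj).1 hp
  by_cases h2 : p.snd = 0
  · have hn : ‖p.snd‖ < 1 := by simp [h2]
    have h1 : p.fst ≠ 0 := by
      intro h1
      have := hp'.2
      rw [h1, h2, norm_zero, norm_zero, scalingInv_zero] at this
      linarith [scalingMax_pos hj]
    refine ⟨_, rimDefining m j, isOpen_rim, ⟨h1, hn⟩, contDiffOn_rimDefining hj,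
      fderiv_rimDefining_ne_zero hj h1 hn, ?_⟩
    ext q
    constructor
    · rintro ⟨a, b⟩
      exact ⟨b, (mem_modelArray_iff_rimDefining hm hj b.2).1 a⟩
    · rintro ⟨b, a⟩
      exact ⟨(mem_modelArray_iff_rimDefining hm hj b.2).2 a, b⟩
  · refine ⟨_, poleDefining m j, isOpen_snd_ne_zero, h2, contDiffOn_poleDefining,
      fderiv_poleDefining_ne_zero hj h2 fun h1 => ?_, ?_⟩
    · have h3 := hp'.2
      rw [h1, norm_zero, zero_add] at h3
      exact (strictMonoOn_scalingInv hj).injOn ⟨norm_nonneg _, hp'.1⟩ ⟨zero_le_one, le_rfl⟩ h3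
    · ext q
      constructor
      · rintro ⟨a, b⟩
        exact ⟨b, (mem_modelArray_iff_poleDefining hm hj b).1 a⟩
      · rintro ⟨b, a⟩
        exact ⟨(mem_modelArray_iff_poleDefining hm hj b).2 a, b⟩

end Model

/-! ### The Archimedean projection property of the model array -/

section ModelVolume

variable {m j : ℕ}

lemma hasStrictFDerivAt_norm {V : Type*} [NormedAddCommGroup V] [InnerProductSpace ℝ V] {x : V}
    (hx : x ≠ 0) : HasStrictFDerivAt (fun x : V => ‖x‖) (‖x‖⁻¹ • innerSL ℝ x) x := by
  have hn : ‖x‖ ≠ 0 := norm_ne_zero_iff.2 hx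
  have h := (hasStrictFDerivAt_norm_sq x).sqrt (by positivity)
  simp only [Real.sqrt_sq (norm_nonneg _)] at h
  convert h using 1
  ext y
  simp
  field_simp

lemma sphericalArray_inter_preimage {k : ℕ} {Ω U : Set (Euc m)} {f : Euc m → ℝ}
    (hf : ∀ x ∈ Ω, 0 ≤ f x) (hU : U ⊆ Ω) :
    sphericalArray m k Ω f ∩ baseProj m k ⁻¹' U = sphereBundle (Euc k) f U := by
  ext p
  constructor
  · rintro ⟨⟨h1, h2⟩, h3⟩
    exact ⟨h3, (sq_eq_sq_iff_of_nonneg (norm_nonneg _) (hf _ h1)).1 h2⟩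
  · rintro ⟨h1, h2⟩
    exact ⟨⟨hU h1, by rw [h2]⟩, h1⟩

lemma image_baseProj_sphericalArray_subset {k : ℕ} {Ω : Set (Euc m)} {f : Euc m → ℝ} :
    baseProj m k '' sphericalArray m k Ω f ⊆ Ω := by
  rintro _ ⟨p, hp, rfl⟩
  exact hp.1

lemma image_baseProj_sphericalArray {Ω : Set (Euc m)} {f : Euc m → ℝ}
    (hf : ∀ x ∈ Ω, 0 ≤ f x) : baseProj m (j + 1) '' sphericalArray m (j + 1) Ω f = Ω := by
  refine image_baseProj_sphericalArray_subset.antisymm fun x hx => ?_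
  obtain ⟨v, hv⟩ := exists_norm_eq (Euc (j + 1)) (hf x hx)
  exact ⟨WithLp.toLp 2 (x, v), ⟨hx, by simp [hv]⟩, rfl⟩

lemma sphereBundle_union {E V : Type*} [NormedAddCommGroup V] {f : E → ℝ} (A B : Set E) :
    sphereBundle V f (A ∪ B) = sphereBundle V f A ∪ sphereBundle V f B := by
  ext p
  simp only [sphereBundle, mem_ofPred_eq, mem_union]
  tauto

lemma sphereBundle_mono {E V : Type*} [NormedAddCommGroup V] {f : E → ℝ} {A B : Set E}
    (h : A ⊆ B) : sphereBundle V f A ⊆ sphereBundle V f B :=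
  fun _ hp => ⟨h hp.1, hp.2⟩

/-- The warping function of the model array. -/
def modelWarp (m j : ℕ) (x : Euc m) : ℝ := scalingFn (j + 1) (scalingMax (j + 1) - ‖x‖)

lemma hasStrictFDerivAt_modelWarp (hj : 1 ≤ j) {x : Euc m}
    (hx : x ≠ 0) (hxM : ‖x‖ < scalingMax (j + 1)) :
    HasStrictFDerivAt (modelWarp m j)
      ((scalingDensity j (modelWarp m j x))⁻¹ • -(‖x‖⁻¹ • innerSL ℝ x)) x := by
  have hs : scalingMax (j + 1) - ‖x‖ ∈ Ioo 0 (scalingMax (j + 1)) :=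
    ⟨by linarith, by linarith [norm_pos_iff.2 hx]⟩
  exact (hasStrictDerivAt_scalingFn hj hs).comp_hasStrictFDerivAt x
    ((hasStrictFDerivAt_norm hx).const_sub _)

lemma modelWarp_mem_Ioo (hj : 1 ≤ j) {x : Euc m}
    (hx : x ≠ 0) (hxM : ‖x‖ < scalingMax (j + 1)) : modelWarp m j x ∈ Ioo (0 : ℝ) 1 :=
  scalingFn_mem_Ioo hj ⟨by linarith, by linarith [norm_pos_iff.2 hx]⟩

lemma density_modelWarp (hj : 1 ≤ j) {x : Euc m}
    (hx : x ≠ 0) (hxM : ‖x‖ < scalingMax (j + 1)) :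
    √(1 + ‖(scalingDensity j (modelWarp m j x))⁻¹ • -(‖x‖⁻¹ • innerSL ℝ x)‖ ^ 2) *
      modelWarp m j x ^ j = 1 := by
  obtain ⟨h0, h1⟩ := modelWarp_mem_Ioo hj hx hxM
  have hn : ‖-(‖x‖⁻¹ • innerSL ℝ x)‖ = 1 := by
    rw [norm_neg, norm_smul, innerSL_apply_norm, norm_inv, norm_norm,
      inv_mul_cancel₀ (norm_ne_zero_iff.2 hx)]
  rw [norm_smul, hn, mul_one, Real.norm_of_nonneg (inv_nonneg.2 (scalingDensity_pos hj h0 h1).le)]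
  exact sqrt_one_add_inv_scalingDensity_sq_mul hj h0 h1

lemma unitSphereVol_succ (j : ℕ) :
    unitSphereVol (j + 1) = μHE[j] (Metric.sphere (0 : Euc (j + 1)) 1) := rfl

lemma unitSphereVol_ne_zero (j : ℕ) : unitSphereVol (j + 1) ≠ 0 :=
  euclideanHausdorffMeasure_sphere_ne_zero (by simp) one_pos

lemma unitSphereVol_ne_top (j : ℕ) : unitSphereVol (j + 1) ≠ ⊤ :=
  (euclideanHausdorffMeasure_sphere_lt_top (by simp) one_pos).ne

lemma modelWarp_measure_of_measurable (hj : 1 ≤ j) {U : Set (Euc m)} (hU : MeasurableSet U)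
    (hUM : U ⊆ Metric.ball 0 (scalingMax (j + 1)) \ {0}) :
    μHE[m + j] (sphereBundle (Euc (j + 1)) (modelWarp m j) U) = unitSphereVol (j + 1) * volume U := by
  have h : ∀ x ∈ U, x ≠ 0 ∧ ‖x‖ < scalingMax (j + 1) :=
    fun x hx => ⟨(hUM hx).2, mem_ball_zero_iff.1 (hUM hx).1⟩
  exact sphereBundle_measure_eq (by simp) (by simp) hU
    (fun x hx => hasStrictFDerivAt_modelWarp hj (h x hx).1 (h x hx).2)
    (fun x hx => (modelWarp_mem_Ioo hj (h x hx).1 (h x hx).2).1)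
    (fun x hx => density_modelWarp hj (h x hx).1 (h x hx).2)

/-- The density computation applies off the centre and the bounding sphere of the base. Over the
centre lies a sphere of lower dimension, since `m ≥ 1`, and over the bounding sphere the radii
vanish; both parts are negligible. -/
lemma modelWarp_measure (hm : 1 ≤ m) (hj : 1 ≤ j) {U : Set (Euc m)}
    (hU : NullMeasurableSet U volume) (hUM : U ⊆ Metric.closedBall 0 (scalingMax (j + 1))) :
    μHE[m + j] (sphereBundle (Euc (j + 1)) (modelWarp m j) U) = unitSphereVol (j + 1) * volume U := by
  have hM := scalingMax_pos hj
  set W : Set (Euc m) := Metric.ball 0 (scalingMax (j + 1)) \ {0} with hW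
  have hWm : MeasurableSet W := measurableSet_ball.diff (measurableSet_singleton 0)
  have hUW : NullMeasurableSet (U ∩ W) volume := hU.inter hWm.nullMeasurableSet
  have hnt := euc_nontrivial hm
  have hvol : volume (U ∩ W) = volume U := by
    apply measure_congr
    have h1 : volume (Metric.sphere (0 : Euc m) (scalingMax (j + 1)) ∪ {0}) = 0 := by
      rw [measure_union_null_iff]
      exact ⟨Measure.addHaar_sphere _ _ _, measure_singleton 0⟩
    have h2 : ∀ᵐ x : Euc m, x ∉ Metric.sphere (0 : Euc m) (scalingMax (j + 1)) ∪ {0} :=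
      measure_eq_zero_iff_ae_notMem.1 h1
    filter_upwards [h2] with x hx
    refine propext ⟨fun h => h.1, fun h => ⟨h, ?_⟩⟩
    simp only [mem_union, mem_sphere_zero_iff_norm, mem_singleton_iff, not_or] at hx
    have := mem_closedBall_zero_iff.1 (hUM h)
    exact ⟨mem_ball_zero_iff.2 (this.lt_of_ne hx.1), hx.2⟩
  have hmain : μHE[m + j] (sphereBundle (Euc (j + 1)) (modelWarp m j) (U ∩ W)) =
      unitSphereVol (j + 1) * volume (U ∩ W) := by
    -- A null-measurable set is squeezed between measurable sets of the same volume, since null sets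
    -- of the base are not assumed to lift to measurable sets.
    obtain ⟨t₁, h₁, m₁, e₁⟩ := hUW.exists_measurable_subset_ae_eq
    obtain ⟨t₂, h₂, m₂, e₂⟩ := hUW.exists_measurable_superset_ae_eq
    apply le_antisymm
    · have hs : U ∩ W ⊆ t₂ ∩ W := subset_inter h₂ inter_subset_right
      refine (measure_mono (sphereBundle_mono hs)).trans ?_
      rw [modelWarp_measure_of_measurable hj (m₂.inter hWm) inter_subset_right, ← measure_congr e₂]
      gcongr
      exact inter_subset_left
    · rw [← measure_congr e₁, ← modelWarp_measure_of_measurable hj m₁ (h₁.trans inter_subset_right)]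
      exact measure_mono (sphereBundle_mono h₁)
  rw [← hvol, ← hmain]
  apply le_antisymm _ (measure_mono (sphereBundle_mono inter_subset_left))
  have hcover : U ⊆ (U ∩ W) ∪ ({0} ∪ (Metric.sphere 0 (scalingMax (j + 1)))) := by
    intro x hx
    by_cases h0 : x = 0
    · exact Or.inr (Or.inl h0)
    rcases (mem_closedBall_zero_iff.1 (hUM hx)).lt_or_eq with h | h
    · exact Or.inl ⟨hx, mem_ball_zero_iff.2 h, h0⟩
    · exact Or.inr (Or.inr (mem_sphere_zero_iff_norm.2 h))
  refine (measure_mono (sphereBundle_mono hcover)).trans ?_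
  rw [sphereBundle_union, sphereBundle_union]
  have z1 : μHE[m + j] (sphereBundle (Euc (j + 1)) (modelWarp m j) {0}) = 0 := by
    apply sphereBundle_singleton_measure hm (by simp)
    have h1 : modelWarp m j 0 = 1 := by
      rw [modelWarp, norm_zero, sub_zero]
      exact scalingFn_scalingInv hj ⟨zero_le_one, le_rfl⟩
    rw [h1]
    exact one_pos
  have z2 : μHE[m + j] (sphereBundle (Euc (j + 1)) (modelWarp m j)
      (Metric.sphere 0 (scalingMax (j + 1)))) = 0 := by
    apply sphereBundle_measure_of_zero (by simp) hj Metric.isBounded_sphere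
    intro x hx
    rw [modelWarp, mem_sphere_zero_iff_norm.1 hx, sub_self]
    have := scalingFn_scalingInv hj (y := 0) ⟨le_rfl, zero_le_one⟩
    rwa [scalingInv_zero] at this
  refine (measure_union_le _ _).trans ?_
  rw [measure_union_null z1 z2, add_zero]

lemma modelArray_eq (hm : 1 ≤ m) (hj : 1 ≤ j) : modelArray m (j + 1) =
    sphericalArray m (j + 1) (Metric.closedBall 0 (scalingMax (j + 1))) (modelWarp m j) := by
  ext p
  refine and_congr_right fun hp => ?_
  beta_reduce
  rw [boundaryDist_closedBall hm (scalingMax_pos hj) hp, dist_zero_right, modelWarp]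

lemma modelWarp_nonneg (hj : 1 ≤ j) {x : Euc m}
    (hx : x ∈ Metric.closedBall (0 : Euc m) (scalingMax (j + 1))) : 0 ≤ modelWarp m j x := by
  rw [mem_closedBall_zero_iff] at hx
  exact (scalingFn_spec hj ⟨by linarith, by linarith [norm_nonneg x]⟩).1.1

lemma hasAPP_modelArray (hm : 1 ≤ m) (hj : 1 ≤ j) :
    HasAPP m (j + 1) (unitSphereVol (j + 1)) (modelArray m (j + 1)) := by
  refine ⟨unitSphereVol_ne_zero j, unitSphereVol_ne_top j, fun U hU hUm => ?_⟩
  rw [modelArray_eq hm hj] at hU ⊢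
  have hUB := hU.trans image_baseProj_sphericalArray_subset
  rw [sphericalArray_inter_preimage (fun x hx => modelWarp_nonneg hj hx) hUB]
  exact modelWarp_measure hm hj hUm hUB

theorem isArchimedeanWith_modelArray (hm : 1 ≤ m) (hj : 1 ≤ j) :
    IsArchimedeanWith m (j + 1) (unitSphereVol (j + 1)) (modelArray m (j + 1)) where
  array := isSphericalArray_modelArray hm hj
  app := hasAPP_modelArray hm hj
  compact := by
    rw [← frontier_modelBody hm hj]
    exact (isCompact_modelBody hj).of_isClosed_subset isClosed_frontier
      (isClosed_modelBody hj).frontier_subset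
  strictConvex := boundsStrictlyConvex_modelArray hm hj
  smooth := isC2Hypersurface_modelArray hm hj

end ModelVolume

/-! ### Scaled copies -/

section ScaledCopy

open scoped Pointwise

variable {m k j : ℕ} {R : ℝ} {c : Euc m}

lemma scaledCopy_scaledCopy (R R' : ℝ) (c c' : Euc m) (H : Set (Amb m k)) :
    scaledCopy m k R c (scaledCopy m k R' c' H) = scaledCopy m k (R * R') (c + R • c') H := by
  unfold scaledCopy
  rw [image_image]
  congr 1
  ext1 p
  have h : (WithLp.toLp 2 (c + R • c', (0 : Euc k)) : Amb m k) =
      WithLp.toLp 2 (c, (0 : Euc k)) + R • WithLp.toLp 2 (c', (0 : Euc k)) := by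
    apply WithLp.ofLp_injective 2
    exact Prod.ext rfl (by simp)
  rw [h, smul_add, smul_smul, add_assoc]

lemma scaledCopy_one_zero (H : Set (Amb m k)) : scaledCopy m k 1 0 H = H := by
  have h : (WithLp.toLp 2 ((0 : Euc m), (0 : Euc k)) : Amb m k) = 0 := rfl
  simp [scaledCopy, h]

lemma scaledCopy_sphericalArray (hR : 0 < R) (Ω : Set (Euc m)) (f : Euc m → ℝ) :
    scaledCopy m k R c (sphericalArray m k Ω f) =
      sphericalArray m k ((fun x => c + R • x) '' Ω) (fun x => R * f (R⁻¹ • (x - c))) := by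
  have e : ∀ x : Euc m, R⁻¹ • ((c + R • x) - c) = x := fun x => by
    rw [add_sub_cancel_left, inv_smul_smul₀ hR.ne']
  ext q
  constructor
  · rintro ⟨p, ⟨h1, h2⟩, rfl⟩
    refine ⟨⟨p.fst, h1, rfl⟩, ?_⟩
    change ‖(0 : Euc k) + R • p.snd‖ ^ 2 = (R * f (R⁻¹ • ((c + R • p.fst) - c))) ^ 2
    rw [e, zero_add, norm_smul, mul_pow, mul_pow, h2, Real.norm_eq_abs, sq_abs]
  · rintro ⟨⟨x, hx, hx2⟩, h2⟩
    have hx2 : c + R • x = q.fst := hx2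
    beta_reduce at h2
    rw [← hx2, e] at h2
    refine ⟨WithLp.toLp 2 (x, R⁻¹ • q.snd), ⟨hx, ?_⟩, ?_⟩
    · change ‖R⁻¹ • q.snd‖ ^ 2 = f x ^ 2
      rw [norm_smul, mul_pow, h2, Real.norm_eq_abs, sq_abs]
      field_simp
    · apply WithLp.ofLp_injective 2
      refine Prod.ext hx2 ?_
      change (0 : Euc k) + R • R⁻¹ • q.snd = q.snd
      rw [zero_add, smul_inv_smul₀ hR.ne']

/-- The similarity defining `scaledCopy`, as a homeomorphism. -/
def scalingHomeomorph (k : ℕ) (hR : 0 < R) (c : Euc m) : Amb m k ≃ₜ Amb m k :=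
  (Homeomorph.smulOfNeZero R hR.ne').trans (Homeomorph.addLeft (WithLp.toLp 2 (c, (0 : Euc k))))

lemma scalingHomeomorph_apply (hR : 0 < R) (p : Amb m k) :
    scalingHomeomorph k hR c p = WithLp.toLp 2 (c, (0 : Euc k)) + R • p := rfl

lemma scalingHomeomorph_symm_apply (hR : 0 < R) (q : Amb m k) :
    (scalingHomeomorph k hR c).symm q = R⁻¹ • (q - WithLp.toLp 2 (c, (0 : Euc k))) := by
  rw [Homeomorph.symm_apply_eq, scalingHomeomorph_apply, smul_inv_smul₀ hR.ne']
  abel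

lemma scaledCopy_eq_image (hR : 0 < R) (H : Set (Amb m k)) :
    scaledCopy m k R c H = scalingHomeomorph k hR c '' H := rfl

lemma BoundsStrictlyConvex.scale {H : Set (Amb m k)} (hH : BoundsStrictlyConvex m k H)
    (hR : 0 < R) : BoundsStrictlyConvex m k (scaledCopy m k R c H) := by
  obtain ⟨K, h1, h2, h3, rfl⟩ := hH
  refine ⟨scalingHomeomorph k hR c '' K, h1.image (scalingHomeomorph k hR c).continuous, ?_, ?_, ?_⟩
  · rw [← Homeomorph.image_interior]
    exact h2.image _
  · have h := h3.affinity (WithLp.toLp 2 (c, (0 : Euc k)) : Amb m k) R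
    rwa [← image_smul, ← image_vadd, image_image] at h
  · rw [← Homeomorph.image_frontier]
    rfl

lemma hasFDerivAt_smul_sub {F : Type*} [NormedAddCommGroup F] [NormedSpace ℝ F] (r : ℝ) (a x : F) :
    HasFDerivAt (fun q : F => r • (q - a)) (r • ContinuousLinearMap.id ℝ F) x :=
  ((hasFDerivAt_id x).sub_const a).const_smul r

lemma fderiv_comp_smul_sub_ne_zero {F : Type*} [NormedAddCommGroup F] [NormedSpace ℝ F]
    {φ : F → ℝ} {r : ℝ} (hr : r ≠ 0) (a : F) {p x : F} (hx : r • (x - a) = p)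
    (hφ : DifferentiableAt ℝ φ p) (hd : fderiv ℝ φ p ≠ 0) :
    fderiv ℝ (φ ∘ fun q : F => r • (q - a)) x ≠ 0 := by
  subst hx
  rw [(hφ.hasFDerivAt.comp x (hasFDerivAt_smul_sub r a x)).fderiv]
  intro h0
  apply hd
  ext v
  have := congr($h0 (r⁻¹ • v))
  simpa [hr] using this

lemma contDiff_smul_sub {F : Type*} [NormedAddCommGroup F] [NormedSpace ℝ F] (r : ℝ) (a : F) :
    ContDiff ℝ 2 (fun q : F => r • (q - a)) :=
  (contDiff_id.sub contDiff_const).const_smul r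

lemma IsC2Hypersurface.scale {H : Set (Amb m k)} (hH : IsC2Hypersurface m k H)
    (hR : 0 < R) : IsC2Hypersurface m k (scaledCopy m k R c H) := by
  rw [scaledCopy_eq_image hR]
  rintro _ ⟨p, hp, rfl⟩
  obtain ⟨V, φ, hV, hpV, hφ, hd, hHV⟩ := hH p hp
  set S := scalingHomeomorph k hR c
  have hSs : ∀ q, S.symm q = R⁻¹ • (q - WithLp.toLp 2 (c, (0 : Euc k))) :=
    scalingHomeomorph_symm_apply hR
  have hSe : (S.symm : Amb m k → Amb m k) = fun q => R⁻¹ • (q - WithLp.toLp 2 (c, (0 : Euc k))) :=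
    funext hSs
  have hC : ContDiff ℝ 2 S.symm := by
    rw [hSe]
    exact contDiff_smul_sub _ _
  have hsp : S.symm (S p) = p := S.symm_apply_apply p
  refine ⟨S.symm ⁻¹' V, φ ∘ S.symm, hV.preimage S.symm.continuous, ?_,
    hφ.comp hC.contDiffOn (fun q hq => hq), ?_, ?_⟩
  · rw [mem_preimage, hsp]
    exact hpV
  · rw [hSe]
    exact fderiv_comp_smul_sub_ne_zero (inv_ne_zero hR.ne') _ ((hSs (S p)).symm.trans hsp)
      ((hφ.contDiffAt (hV.mem_nhds hpV)).differentiableAt (by norm_num)) hd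
  · ext q
    constructor
    · rintro ⟨⟨x, hx, rfl⟩, hq⟩
      rw [mem_preimage, S.symm_apply_apply] at hq
      have : x ∈ H ∩ V := ⟨hx, hq⟩
      rw [hHV] at this
      refine ⟨by rw [mem_preimage, S.symm_apply_apply]; exact hq, ?_⟩
      rw [Function.comp_apply, S.symm_apply_apply]
      exact this.2
    · rintro ⟨h1, h2⟩
      have : S.symm q ∈ H ∩ V := by
        rw [hHV]
        exact ⟨h1, h2⟩
      exact ⟨⟨_, this.1, S.apply_symm_apply q⟩, h1⟩

lemma euclideanHausdorffMeasure_scaledCopy (hR : 0 < R) (d : ℕ) (H : Set (Amb m k)) :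
    μHE[d] (scaledCopy m k R c H) = ENNReal.ofReal (R ^ d) * μHE[d] H := by
  have h : scaledCopy m k R c H = (fun p => WithLp.toLp 2 (c, (0 : Euc k)) + p) '' (R • H) := by
    rw [← image_smul, image_image]
    rfl
  rw [h, (isometry_add_left _).euclideanHausdorffMeasure_image,
    Measure.euclideanHausdorffMeasure_smul₀ d hR.ne', ENNReal.smul_def, smul_eq_mul]
  congr 1
  rw [ENNReal.ofReal_pow hR.le, ← Real.enorm_eq_ofReal hR.le]
  simp [enorm_eq_nnnorm]

lemma volume_preimage_affine (hR : 0 < R) (c : Euc m) (U : Set (Euc m)) :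
    volume ((fun x => c + R • x) ⁻¹' U) = ENNReal.ofReal (R⁻¹ ^ m) * volume U := by
  have h : (fun x => c + R • x) ⁻¹' U = (R • ·) ⁻¹' ((fun x => c + x) ⁻¹' U) := rfl
  rw [h, Measure.addHaar_preimage_smul _ hR.ne', measure_preimage_add]
  congr 2
  rw [abs_of_nonneg (by positivity)]
  simp

/-- Volumes scale by `R^(m+j)` upstairs and by `R^m` in the base, so the constant scales by the
quotient `R^j`. -/
lemma HasAPP.scale {C : ℝ≥0∞} {H : Set (Amb m (j + 1))} (hH : HasAPP m (j + 1) C H)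
    (hR : 0 < R) :
    HasAPP m (j + 1) (ENNReal.ofReal (R ^ j) * C) (scaledCopy m (j + 1) R c H) := by
  obtain ⟨h0, ht, hU⟩ := hH
  refine ⟨mul_ne_zero (ENNReal.ofReal_pos.2 (by positivity)).ne' h0,
    ENNReal.mul_ne_top ENNReal.ofReal_ne_top ht, fun U hUH hUm => ?_⟩
  set s : Euc m → Euc m := fun x => c + R • x with hs
  have hpre : scaledCopy m (j + 1) R c H ∩ baseProj m (j + 1) ⁻¹' U =
      scaledCopy m (j + 1) R c (H ∩ baseProj m (j + 1) ⁻¹' (s ⁻¹' U)) := by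
    ext q
    constructor
    · rintro ⟨⟨p, hp, rfl⟩, hq⟩
      exact ⟨p, ⟨hp, hq⟩, rfl⟩
    · rintro ⟨p, ⟨hp, hq⟩, rfl⟩
      exact ⟨⟨p, hp, rfl⟩, hq⟩
  have hsub : s ⁻¹' U ⊆ baseProj m (j + 1) '' H := by
    intro x hx
    obtain ⟨_, ⟨p, hp, rfl⟩, hpx⟩ := hUH hx
    have hpx : c + R • p.fst = c + R • x := hpx
    have := smul_right_injective _ hR.ne' (add_left_cancel hpx)
    exact ⟨p, hp, this⟩
  have hq : Measure.QuasiMeasurePreserving s volume volume := by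
    refine ⟨by fun_prop, Measure.AbsolutelyContinuous.mk fun t htm ht0 => ?_⟩
    rw [Measure.map_apply (by fun_prop) htm, volume_preimage_affine hR, ht0, mul_zero]
  have key := hU (s ⁻¹' U) hsub (hUm.preimage hq)
  rw [hpre, euclideanHausdorffMeasure_scaledCopy hR, key, volume_preimage_affine hR]
  have e : ENNReal.ofReal (R ^ (m + (j + 1) - 1)) * ENNReal.ofReal (R⁻¹ ^ m) =
      ENNReal.ofReal (R ^ j) := by
    rw [← ENNReal.ofReal_mul (by positivity)]
    congr 1
    rw [← add_assoc, Nat.add_sub_cancel, pow_add, inv_pow]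
    field_simp
  rw [← e]
  ring

theorem IsArchimedeanWith.scale {C : ℝ≥0∞} {H : Set (Amb m (j + 1))}
    (hH : IsArchimedeanWith m (j + 1) C H) (hR : 0 < R) (c : Euc m) :
    IsArchimedeanWith m (j + 1) (ENNReal.ofReal (R ^ j) * C) (scaledCopy m (j + 1) R c H) where
  array := by
    obtain ⟨Ω, f, hf, rfl⟩ := hH.array
    refine ⟨_, _, ?_, scaledCopy_sphericalArray hR Ω f⟩
    rintro _ ⟨x, hx, rfl⟩
    beta_reduce
    rw [add_sub_cancel_left, inv_smul_smul₀ hR.ne']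
    exact mul_nonneg hR.le (hf x hx)
  app := hH.app.scale hR
  compact := by
    rw [scaledCopy_eq_image hR]
    exact hH.compact.image (scalingHomeomorph (j + 1) hR c).continuous
  strictConvex := hH.strictConvex.scale hR
  smooth := hH.smooth.scale hR

end ScaledCopy

/-! ### Strictly convex bodies bounded by spherical arrays -/

/-- The last point of the ray in the compact set is not interior. -/
lemma exists_ray_mem_frontier {F : Type*} [NormedAddCommGroup F] [NormedSpace ℝ F] {S : Set F}
    (hS : IsCompact S) {p d : F} (hp : p ∈ S) (hd : d ≠ 0) :
    ∃ t : ℝ, 0 ≤ t ∧ p + t • d ∈ frontier S := by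
  have hc : Continuous fun t : ℝ => p + t • d := by fun_prop
  set T : Set ℝ := (fun t : ℝ => p + t • d) ⁻¹' S with hT
  have hTcl : IsClosed T := hS.isClosed.preimage hc
  have h0 : (0 : ℝ) ∈ T := by simpa [hT] using hp
  have hTb : BddAbove T := by
    obtain ⟨B, hB⟩ := isBounded_iff_forall_norm_le.1 hS.isBounded
    have hd' : 0 < ‖d‖ := norm_pos_iff.2 hd
    refine ⟨(B + ‖p‖) / ‖d‖, fun t ht => ?_⟩
    rw [le_div_iff₀ hd']
    calc t * ‖d‖ ≤ |t| * ‖d‖ := by gcongr; exact le_abs_self t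
      _ = ‖(p + t • d) - p‖ := by rw [add_sub_cancel_left, norm_smul, Real.norm_eq_abs]
      _ ≤ ‖p + t • d‖ + ‖p‖ := norm_sub_le _ _
      _ ≤ B + ‖p‖ := by gcongr; exact hB _ ht
  have hmem : sSup T ∈ T := hTcl.csSup_mem ⟨0, h0⟩ hTb
  refine ⟨sSup T, le_csSup hTb h0, ?_⟩
  rw [hS.isClosed.frontier_eq]
  refine ⟨hmem, fun hint => ?_⟩
  have hev : ∀ᶠ t in 𝓝 (sSup T), p + t • d ∈ S :=
    hc.continuousAt.eventually_mem (mem_interior_iff_mem_nhds.1 hint)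
  obtain ⟨t, ht, hlt⟩ := ((hev.filter_mono nhdsWithin_le_nhds).and
      (self_mem_nhdsWithin (a := sSup T) (s := Ioi (sSup T)))).exists
  exact absurd (le_csSup hTb ht) (not_le.2 hlt)

/-- A strictly convex body whose boundary is the spherical array over `Ω` with warping function
`f`. -/
structure IsArrayBody {m k : ℕ} (Ω : Set (Euc m)) (f : Euc m → ℝ) (K : Set (Amb m k)) : Prop where
  nonneg : ∀ x ∈ Ω, 0 ≤ f x
  compact : IsCompact K
  interior_nonempty : (interior K).Nonempty
  strictConvex : StrictConvex ℝ K
  frontier_eq : frontier K = sphericalArray m k Ω f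

namespace IsArrayBody

variable {m j : ℕ} {Ω : Set (Euc m)} {f : Euc m → ℝ} {K : Set (Amb m (j + 1))}

lemma mem_frontier_iff (h : IsArrayBody Ω f K) {p : Amb m (j + 1)} :
    p ∈ frontier K ↔ p.fst ∈ Ω ∧ ‖p.snd‖ = f p.fst := by
  rw [h.frontier_eq]
  exact and_congr_right fun hp => sq_eq_sq_iff_of_nonneg (norm_nonneg _) (h.nonneg _ hp)

/-- Following a fibre direction leaves the base point unchanged and ends on the boundary, which is
known to be the array. This transfers information about the array to the whole body. -/
lemma exists_vertical_mem_frontier (h : IsArrayBody Ω f K) {p : Amb m (j + 1)} (hp : p ∈ K)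
    {d : Euc (j + 1)} (hd : d ≠ 0) : ∃ t : ℝ, 0 ≤ t ∧ p.fst ∈ Ω ∧ ‖p.snd + t • d‖ = f p.fst := by
  obtain ⟨t, ht, hf⟩ := exists_ray_mem_frontier h.compact hp
    (d := WithLp.toLp 2 ((0 : Euc m), d)) (fun h0 => hd congr($(h0).snd))
  rw [h.mem_frontier_iff] at hf
  have e1 : (p + t • WithLp.toLp 2 ((0 : Euc m), d)).fst = p.fst := by
    change p.fst + t • (0 : Euc m) = p.fst
    simp
  have e2 : (p + t • WithLp.toLp 2 ((0 : Euc m), d)).snd = p.snd + t • d := rfl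
  rw [e1, e2] at hf
  exact ⟨t, ht, hf.1, hf.2⟩

lemma fst_mem (h : IsArrayBody Ω f K) {p : Amb m (j + 1)} (hp : p ∈ K) : p.fst ∈ Ω := by
  obtain ⟨d, hd⟩ := exists_ne (0 : Euc (j + 1))
  obtain ⟨_, _, h1, _⟩ := h.exists_vertical_mem_frontier hp hd
  exact h1

lemma norm_snd_le (h : IsArrayBody Ω f K) {p : Amb m (j + 1)} (hp : p ∈ K) :
    ‖p.snd‖ ≤ f p.fst := by
  by_cases h0 : p.snd = 0
  · rw [h0, norm_zero]
    exact h.nonneg _ (h.fst_mem hp)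
  obtain ⟨t, ht, _, h2⟩ := h.exists_vertical_mem_frontier hp h0
  rw [← h2]
  have : p.snd + t • p.snd = (1 + t) • p.snd := by module
  rw [this, norm_smul, Real.norm_of_nonneg (by linarith)]
  nlinarith [norm_nonneg p.snd]

lemma mem_of_norm_eq (h : IsArrayBody Ω f K) {x : Euc m} {v : Euc (j + 1)} (hx : x ∈ Ω)
    (hv : ‖v‖ = f x) : WithLp.toLp 2 (x, v) ∈ K :=
  h.compact.isClosed.frontier_subset (h.mem_frontier_iff.2 ⟨hx, hv⟩)

lemma convex_base (h : IsArrayBody Ω f K) : Convex ℝ Ω := by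
  obtain ⟨e, he⟩ := exists_norm_eq (Euc (j + 1)) zero_le_one
  intro x hx y hy s t hs ht hst
  have hfx : ‖f x • e‖ = f x := by rw [norm_smul, he, mul_one, Real.norm_of_nonneg (h.nonneg x hx)]
  have hfy : ‖f y • e‖ = f y := by rw [norm_smul, he, mul_one, Real.norm_of_nonneg (h.nonneg y hy)]
  exact h.fst_mem (h.strictConvex.convex (h.mem_of_norm_eq hx hfx) (h.mem_of_norm_eq hy hfy)
    hs ht hst)

/-- Boundary points over `x` and `y` in one common fibre direction have their convex combinations in
`K`, where the fibre norm is at most `f`. -/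
lemma concaveOn (h : IsArrayBody Ω f K) : ConcaveOn ℝ Ω f := by
  obtain ⟨e, he⟩ := exists_norm_eq (Euc (j + 1)) zero_le_one
  refine ⟨h.convex_base, ?_⟩
  intro x hx y hy s t hs ht hst
  have hfx : ‖f x • e‖ = f x := by rw [norm_smul, he, mul_one, Real.norm_of_nonneg (h.nonneg x hx)]
  have hfy : ‖f y • e‖ = f y := by rw [norm_smul, he, mul_one, Real.norm_of_nonneg (h.nonneg y hy)]
  have := h.norm_snd_le (h.strictConvex.convex (h.mem_of_norm_eq hx hfx) (h.mem_of_norm_eq hy hfy)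
    hs ht hst)
  have e2 : ‖s • f x • e + t • f y • e‖ = s • f x + t • f y := by
    have : s • f x • e + t • f y • e = (s * f x + t * f y) • e := by module
    rw [this, norm_smul, he, mul_one, Real.norm_of_nonneg]
    · rfl
    · exact add_nonneg (mul_nonneg hs (h.nonneg x hx)) (mul_nonneg ht (h.nonneg y hy))
  rw [← e2]
  exact this

lemma norm_snd_lt_of_mem_interior (h : IsArrayBody Ω f K) {p : Amb m (j + 1)}
    (hp : p ∈ interior K) : ‖p.snd‖ < f p.fst := by
  have hpK := interior_subset hp
  refine (h.norm_snd_le hpK).lt_of_ne fun he => ?_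
  exact disjoint_interior_frontier.notMem_of_mem_left hp
    (h.mem_frontier_iff.2 ⟨h.fst_mem hpK, he⟩)

lemma fst_mem_interior (h : IsArrayBody Ω f K) {p : Amb m (j + 1)}
    (hp : p ∈ interior K) : p.fst ∈ interior Ω := by
  have hc : Continuous fun x : Euc m => (WithLp.toLp 2 (x, p.snd) : Amb m (j + 1)) := by fun_prop
  refine mem_interior_iff_mem_nhds.2 ?_
  have : ∀ᶠ x in 𝓝 p.fst, (WithLp.toLp 2 (x, p.snd) : Amb m (j + 1)) ∈ K :=
    hc.continuousAt.eventually_mem (mem_interior_iff_mem_nhds.1 hp)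
  exact this.mono fun x hx => h.fst_mem hx

/-- The midpoint of two antipodal boundary points over `x`. -/
lemma axis_mem_interior (h : IsArrayBody Ω f K) {x : Euc m} (hx : x ∈ Ω) (hf : 0 < f x) :
    WithLp.toLp 2 (x, (0 : Euc (j + 1))) ∈ interior K := by
  obtain ⟨v, hv⟩ := exists_norm_eq (Euc (j + 1)) hf.le
  have hne : (WithLp.toLp 2 (x, v) : Amb m (j + 1)) ≠ WithLp.toLp 2 (x, -v) := by
    intro he
    have he' : v = -v := congr(($he).snd)
    have h2 : (2 : ℝ) • v = 0 := by
      rw [two_smul]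
      nth_rewrite 2 [he']
      exact add_neg_cancel v
    have hv0 : v = 0 := by simpa using h2
    rw [hv0, norm_zero] at hv
    exact hf.ne hv
  have := h.strictConvex (h.mem_of_norm_eq hx hv) (h.mem_of_norm_eq hx (by rwa [norm_neg])) hne
    (a := 1 / 2) (b := 1 / 2) (by norm_num) (by norm_num) (by norm_num)
  convert this using 1
  apply WithLp.ofLp_injective 2
  refine Prod.ext ?_ ?_
  · change x = (1 / 2 : ℝ) • x + (1 / 2 : ℝ) • x
    module
  · change (0 : Euc (j + 1)) = (1 / 2 : ℝ) • v + (1 / 2 : ℝ) • -v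
    module

lemma mem_interior_of_pos (h : IsArrayBody Ω f K) {x : Euc m} (hx : x ∈ Ω) (hf : 0 < f x) :
    x ∈ interior Ω :=
  h.fst_mem_interior (h.axis_mem_interior hx hf)

/-- Pushing `x` slightly away from the base point of an interior point `q` of `K` stays in `Ω`.
Hence `x` lies strictly between, an interior point of `K` lies over `x`, and its fibre norm is
strictly below `f x`. -/
lemma pos_of_mem_interior (h : IsArrayBody Ω f K) {x : Euc m} (hx : x ∈ interior Ω) : 0 < f x := by
  obtain ⟨q, hq⟩ := h.interior_nonempty
  have hc : ContinuousAt (fun t : ℝ => x + t • (x - q.fst)) 0 := by fun_prop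
  have hev : ∀ᶠ t in 𝓝 (0 : ℝ), x + t • (x - q.fst) ∈ Ω := by
    apply hc.eventually_mem
    rw [zero_smul, add_zero]
    exact mem_interior_iff_mem_nhds.1 hx
  obtain ⟨t, ht, ht0⟩ := ((hev.filter_mono nhdsWithin_le_nhds).and
      (self_mem_nhdsWithin (a := (0 : ℝ)) (s := Ioi 0))).exists
  have ht0 : 0 < t := ht0
  obtain ⟨v, hv⟩ := exists_norm_eq (Euc (j + 1)) (h.nonneg _ ht)
  have h1 : 0 < 1 + t := by linarith
  have := h.strictConvex.convex.combo_interior_self_mem_interior hq (h.mem_of_norm_eq ht hv)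
    (a := t / (1 + t)) (b := 1 / (1 + t)) (by positivity) (by positivity) (by field_simp; ring)
  have hlt := h.norm_snd_lt_of_mem_interior this
  have e : (t / (1 + t)) • q.fst + (1 / (1 + t)) • (x + t • (x - q.fst)) = x := by
    have : (t / (1 + t)) = (1 / (1 + t)) * t := by ring
    have h2 : (1 / (1 + t)) * (1 + t) = 1 := by field_simp
    calc _ = ((1 / (1 + t)) * (1 + t)) • x := by rw [this]; module
      _ = x := by rw [h2, one_smul]
  have e' : ((t / (1 + t)) • q + (1 / (1 + t)) •
      (WithLp.toLp 2 (x + t • (x - q.fst), v) : Amb m (j + 1))).fst = x := e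
  rw [e'] at hlt
  exact (norm_nonneg _).trans_lt hlt

lemma interior_base_nonempty (h : IsArrayBody Ω f K) : (interior Ω).Nonempty := by
  obtain ⟨q, hq⟩ := h.interior_nonempty
  exact ⟨_, h.fst_mem_interior hq⟩

lemma base_eq_image (h : IsArrayBody Ω f K) : Ω = (fun p : Amb m (j + 1) => p.fst) '' K := by
  ext x
  constructor
  · intro hx
    obtain ⟨v, hv⟩ := exists_norm_eq (Euc (j + 1)) (h.nonneg _ hx)
    exact ⟨_, h.mem_of_norm_eq hx hv, rfl⟩
  · rintro ⟨p, hp, rfl⟩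
    exact h.fst_mem hp

lemma isCompact_base (h : IsArrayBody Ω f K) : IsCompact Ω := by
  rw [h.base_eq_image]
  exact h.compact.image (by fun_prop)

/-- Preimages of closed sets under `f` are projections of compact parts of the boundary. This gives
continuity up to the boundary of `Ω`, which concavity alone would not. -/
lemma continuousOn (h : IsArrayBody Ω f K) : ContinuousOn f Ω := by
  rw [continuousOn_iff_isClosed]
  intro C hC
  have hcl : IsClosed ((fun p : Amb m (j + 1) => ‖p.snd‖) ⁻¹' C) := hC.preimage (by fun_prop)
  refine ⟨(fun p : Amb m (j + 1) => p.fst) '' (frontier K ∩ (fun p => ‖p.snd‖) ⁻¹' C), ?_, ?_⟩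
  · refine IsCompact.isClosed (IsCompact.image ?_ (by fun_prop))
    exact (h.compact.of_isClosed_subset isClosed_frontier h.compact.isClosed.frontier_subset).inter_right hcl
  · ext x
    constructor
    · rintro ⟨hx, hxΩ⟩
      obtain ⟨v, hv⟩ := exists_norm_eq (Euc (j + 1)) (h.nonneg _ hxΩ)
      refine ⟨⟨WithLp.toLp 2 (x, v), ⟨h.mem_frontier_iff.2 ⟨hxΩ, hv⟩, ?_⟩, rfl⟩, hxΩ⟩
      change ‖v‖ ∈ C
      rw [hv]
      exact hx
    · rintro ⟨⟨p, ⟨hp, hpC⟩, rfl⟩, hxΩ⟩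
      refine ⟨?_, hxΩ⟩
      have : ‖p.snd‖ ∈ C := hpC
      rw [(h.mem_frontier_iff.1 hp).2] at this
      exact this

/-- Two maximum points would give two boundary points with the same fibre component, whose midpoint
is interior to `K` although its fibre norm is already maximal. -/
lemma eq_of_eq_of_forall_le (h : IsArrayBody Ω f K) {x y : Euc m} (hx : x ∈ Ω) (hy : y ∈ Ω)
    (hxy : f x = f y) (hmax : ∀ z ∈ Ω, f z ≤ f y) : x = y := by
  by_contra hne
  obtain ⟨v, hv⟩ := exists_norm_eq (Euc (j + 1)) (h.nonneg _ hy)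
  have := h.strictConvex (h.mem_of_norm_eq hx (hv.trans hxy.symm)) (h.mem_of_norm_eq hy hv)
    (fun he => hne congr(($he).fst)) (a := 1 / 2) (b := 1 / 2) (by norm_num) (by norm_num)
    (by norm_num)
  have hlt := h.norm_snd_lt_of_mem_interior this
  have hle := hmax _ (h.fst_mem (interior_subset this))
  have e : ((1 / 2 : ℝ) • (WithLp.toLp 2 (x, v) : Amb m (j + 1)) +
      (1 / 2 : ℝ) • WithLp.toLp 2 (y, v)).snd = v := by
    change (1 / 2 : ℝ) • v + (1 / 2 : ℝ) • v = v
    module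
  rw [e, hv] at hlt
  linarith

end IsArrayBody

/-! ### Differentiability of the warping function -/

namespace IsArrayBody

open scoped RealInnerProductSpace
open Asymptotics

variable {m j : ℕ} {Ω : Set (Euc m)} {f : Euc m → ℝ} {K : Set (Amb m (j + 1))}

/-- The graph of the warping function in the direction `e`. -/
def lift (f : Euc m → ℝ) (e : Euc (j + 1)) (x : Euc m) : Amb m (j + 1) := WithLp.toLp 2 (x, f x • e)

lemma exists_lipschitz_near (h : IsArrayBody Ω f K) {x₀ : Euc m} (hx₀ : x₀ ∈ interior Ω) :
    ∃ C : ℝ≥0, ∃ N ∈ 𝓝 x₀, LipschitzOnWith C f N := by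
  obtain ⟨C, N, hN, hL⟩ := h.concaveOn.locallyLipschitzOn_interior hx₀
  rw [isOpen_interior.nhdsWithin_eq hx₀] at hN
  exact ⟨C, N, hN, hL⟩

lemma continuousAt_of_mem_interior (h : IsArrayBody Ω f K) {x₀ : Euc m} (hx₀ : x₀ ∈ interior Ω) :
    ContinuousAt f x₀ :=
  (h.continuousOn x₀ (interior_subset hx₀)).continuousAt (mem_interior_iff_mem_nhds.1 hx₀)

lemma continuousAt_lift (h : IsArrayBody Ω f K) {x₀ : Euc m} (hx₀ : x₀ ∈ interior Ω)
    (e : Euc (j + 1)) : ContinuousAt (lift f e) x₀ := by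
  have h1 : ContinuousAt (fun x => ((x, f x • e) : Euc m × Euc (j + 1))) x₀ :=
    continuousAt_id.prodMk ((h.continuousAt_of_mem_interior hx₀).smul continuousAt_const)
  exact (WithLp.prod_continuous_toLp 2 (Euc m) (Euc (j + 1))).continuousAt.comp h1

lemma lift_sub_isBigO (h : IsArrayBody Ω f K) {x₀ : Euc m} (hx₀ : x₀ ∈ interior Ω)
    {e : Euc (j + 1)} (he : ‖e‖ = 1) :
    (fun q : Euc m × Euc m => lift f e q.1 - lift f e q.2) =O[𝓝 (x₀, x₀)]
      fun q => q.1 - q.2 := by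
  obtain ⟨C, N, hN, hL⟩ := h.exists_lipschitz_near hx₀
  refine IsBigO.of_bound (1 + C) ?_
  filter_upwards [prod_mem_nhds hN hN] with q hq
  have h1 := hL.dist_le_mul _ hq.1 _ hq.2
  rw [dist_eq_norm, dist_eq_norm] at h1
  have hC : (0 : ℝ) ≤ C := C.2
  refine (pow_le_pow_iff_left₀ (norm_nonneg _) (by positivity) two_ne_zero).1 ?_
  rw [WithLp.prod_norm_sq_eq_of_L2]
  change ‖q.1 - q.2‖ ^ 2 + ‖f q.1 • e - f q.2 • e‖ ^ 2 ≤ _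
  rw [← sub_smul, norm_smul, he, mul_one]
  have h2 : ‖f q.1 - f q.2‖ ^ 2 ≤ (C * ‖q.1 - q.2‖) ^ 2 := by gcongr
  nlinarith [mul_nonneg hC (sq_nonneg ‖q.1 - q.2‖)]

/-- The defining function of the boundary, linearized along the graph of the warping function. -/
lemma linearized_isLittleO (h : IsArrayBody Ω f K) {x₀ : Euc m} (hx₀ : x₀ ∈ interior Ω)
    {e : Euc (j + 1)} (he : ‖e‖ = 1) {V : Set (Amb m (j + 1))} {φ : Amb m (j + 1) → ℝ}
    (hV : IsOpen V) (hpV : lift f e x₀ ∈ V) {L : Amb m (j + 1) →L[ℝ] ℝ}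
    (hφ : HasStrictFDerivAt φ L (lift f e x₀))
    (hHV : sphericalArray m (j + 1) Ω f ∩ V = {x | x ∈ V ∧ φ x = 0}) :
    (fun q : Euc m × Euc m => L (WithLp.toLp 2 (q.1 - q.2, (0 : Euc (j + 1)))) +
      (f q.1 - f q.2) * L (WithLp.toLp 2 ((0 : Euc m), e))) =o[𝓝 (x₀, x₀)] fun q => q.1 - q.2 := by
  have hc := h.continuousAt_lift hx₀ e
  have ht : Tendsto (fun q : Euc m × Euc m => (lift f e q.1, lift f e q.2)) (𝓝 (x₀, x₀))
      (𝓝 (lift f e x₀, lift f e x₀)) := by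
    rw [nhds_prod_eq, nhds_prod_eq]
    exact hc.tendsto.prodMap hc.tendsto
  have h1 := (hφ.isLittleO.comp_tendsto ht).trans_isBigO (h.lift_sub_isBigO hx₀ he)
  have hzero : ∀ᶠ x in 𝓝 x₀, φ (lift f e x) = 0 := by
    filter_upwards [hc.eventually_mem (hV.mem_nhds hpV), mem_interior_iff_mem_nhds.1 hx₀] with x hx hxΩ
    have : lift f e x ∈ sphericalArray m (j + 1) Ω f ∩ V := by
      refine ⟨⟨hxΩ, ?_⟩, hx⟩
      change ‖f x • e‖ ^ 2 = f x ^ 2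
      rw [norm_smul, he, mul_one, Real.norm_eq_abs, sq_abs]
    rw [hHV] at this
    exact this.2
  have h2 : ∀ᶠ q : Euc m × Euc m in 𝓝 (x₀, x₀), φ (lift f e q.1) = 0 ∧ φ (lift f e q.2) = 0 := by
    rw [nhds_prod_eq]
    exact hzero.prod_mk hzero
  refine (h1.neg_left).congr' ?_ EventuallyEq.rfl
  filter_upwards [h2] with q hq
  simp only [Function.comp_apply, hq.1, hq.2]
  have : lift f e q.1 - lift f e q.2 = WithLp.toLp 2 (q.1 - q.2, (0 : Euc (j + 1))) +
      (f q.1 - f q.2) • WithLp.toLp 2 ((0 : Euc m), e) := by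
    apply WithLp.ofLp_injective 2
    refine Prod.ext ?_ ?_
    · change q.1 - q.2 = (q.1 - q.2) + (f q.1 - f q.2) • (0 : Euc m)
      simp
    · change f q.1 • e - f q.2 • e = (0 : Euc (j + 1)) + (f q.1 - f q.2) • e
      rw [sub_smul, zero_add]
  rw [this, map_add, map_smul, smul_eq_mul]
  ring

lemma linearMap_eq_zero_of_isLittleO {E : Type*} [NormedAddCommGroup E] [NormedSpace ℝ E]
    (A : E →L[ℝ] ℝ) (x₀ : E) (h : (fun q : E × E => A (q.1 - q.2)) =o[𝓝 (x₀, x₀)]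
      fun q => q.1 - q.2) : A = 0 := by
  have h1 : HasStrictFDerivAt (fun x => A x) (0 : E →L[ℝ] ℝ) x₀ := by
    refine .of_isLittleO (h.congr_left fun q => ?_)
    simp
  exact A.hasFDerivAt.unique h1.hasFDerivAt

lemma hasDerivAt_circle {F : Type*} [NormedAddCommGroup F] [NormedSpace ℝ F] (a b c : F) (r : ℝ) :
    HasDerivAt (fun t => a + (r * Real.cos t) • b + (r * Real.sin t) • c) (r • c) 0 := by
  have d1 := ((Real.hasDerivAt_cos 0).const_mul r).smul_const b
  have d2 := ((Real.hasDerivAt_sin 0).const_mul r).smul_const c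
  refine ((d1.const_add a).add d2).congr_deriv ?_
  simp

/-- A curve in the zero set of `φ` has its velocity in the kernel of the differential; at time `0`
the velocity of this circle is `r • c`. -/
lemma apply_eq_zero_of_circle {F : Type*} [NormedAddCommGroup F] [NormedSpace ℝ F] {φ : F → ℝ}
    {L : F →L[ℝ] ℝ} {V : Set F} {a b c p : F} {r : ℝ} (hr : r ≠ 0) (hp : a + r • b = p)
    (hV : IsOpen V) (hpV : p ∈ V) (hφ : HasFDerivAt φ L p)
    (h : ∀ t : ℝ, a + (r * Real.cos t) • b + (r * Real.sin t) • c ∈ V →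
      φ (a + (r * Real.cos t) • b + (r * Real.sin t) • c) = 0) : L c = 0 := by
  have hd := hasDerivAt_circle a b c r
  set γ : ℝ → F := fun t => a + (r * Real.cos t) • b + (r * Real.sin t) • c
  have h0 : γ 0 = p := by simp [γ, hp]
  have hev : ∀ᶠ t in 𝓝 (0 : ℝ), φ (γ t) = 0 := by
    filter_upwards [hd.continuousAt.eventually_mem (hV.mem_nhds (h0 ▸ hpV))] with t ht using h t ht
  subst h0
  have h1 := (hφ.comp_hasDerivAt (0 : ℝ) hd).unique
    ((hasDerivAt_const (0 : ℝ) (0 : ℝ)).congr_of_eventuallyEq hev)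
  rw [map_smul, smul_eq_mul] at h1
  exact (mul_eq_zero.1 h1).resolve_left hr

lemma exists_circle_tangent {L : Amb m (j + 1) →L[ℝ] ℝ} {φ : Amb m (j + 1) → ℝ}
    {V : Set (Amb m (j + 1))} {x₀ : Euc m} (hx₀ : x₀ ∈ Ω) {e v : Euc (j + 1)} (he : ‖e‖ = 1)
    (hv : ‖v‖ = 1) (hev : ⟪e, v⟫ = 0) (hf : f x₀ ≠ 0) (hV : IsOpen V) (hpV : lift f e x₀ ∈ V)
    (hφ : HasFDerivAt φ L (lift f e x₀))
    (hHV : sphericalArray m (j + 1) Ω f ∩ V = {x | x ∈ V ∧ φ x = 0}) :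
    L (WithLp.toLp 2 ((0 : Euc m), v)) = 0 := by
  let γ : ℝ → Amb m (j + 1) := fun t => WithLp.toLp 2 (x₀, (0 : Euc (j + 1))) +
    (f x₀ * Real.cos t) • WithLp.toLp 2 ((0 : Euc m), e) +
    (f x₀ * Real.sin t) • WithLp.toLp 2 ((0 : Euc m), v)
  have hγ1 : ∀ t, (γ t).fst = x₀ := by
    intro t
    change x₀ + (f x₀ * Real.cos t) • (0 : Euc m) + (f x₀ * Real.sin t) • (0 : Euc m) = x₀
    simp
  have hγ2 : ∀ t, (γ t).snd = f x₀ • (Real.cos t • e + Real.sin t • v) := by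
    intro t
    change (0 : Euc (j + 1)) + (f x₀ * Real.cos t) • e + (f x₀ * Real.sin t) • v = _
    module
  have hn : ∀ t, ‖Real.cos t • e + Real.sin t • v‖ ^ 2 = 1 := by
    intro t
    rw [norm_add_sq_real, inner_smul_left, inner_smul_right, hev, norm_smul, norm_smul, he, hv]
    simp
  refine apply_eq_zero_of_circle (a := WithLp.toLp 2 (x₀, (0 : Euc (j + 1))))
    (b := WithLp.toLp 2 ((0 : Euc m), e)) hf ?_ hV hpV hφ fun t ht => ?_
  · apply WithLp.ofLp_injective 2
    refine Prod.ext ?_ ?_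
    · change x₀ + f x₀ • (0 : Euc m) = x₀
      simp
    · change (0 : Euc (j + 1)) + f x₀ • e = f x₀ • e
      simp
  · have : γ t ∈ sphericalArray m (j + 1) Ω f ∩ V := by
      refine ⟨⟨?_, ?_⟩, ht⟩
      · rw [hγ1]; exact hx₀
      · rw [hγ1, hγ2, norm_smul, mul_pow, hn, mul_one, Real.norm_eq_abs, sq_abs]
    rw [hHV] at this
    exact this.2

/-- The differential `L` of a defining function has nonzero component `c` in the radial fibre
direction `e`. Otherwise the linearized equation makes `L` vanish on the base, circles in the fibre
sphere make it vanish on the fibre directions orthogonal to `e`, and `L = 0`. Dividing the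
linearized equation by `c` then yields the derivative of `f`; the Lipschitz bound from concavity is
what makes its error small relative to `q.1 - q.2`. -/
theorem exists_hasStrictFDerivAt (h : IsArrayBody Ω f K)
    (hC2 : IsC2Hypersurface m (j + 1) (sphericalArray m (j + 1) Ω f)) {x₀ : Euc m}
    (hx₀ : x₀ ∈ interior Ω) : ∃ f' : Euc m →L[ℝ] ℝ, HasStrictFDerivAt f f' x₀ := by
  obtain ⟨e, he⟩ := exists_norm_eq (Euc (j + 1)) zero_le_one
  have hpos := h.pos_of_mem_interior hx₀
  have hx₀Ω := interior_subset hx₀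
  obtain ⟨V, φ, hV, hpV, hφ, hd, hHV⟩ := hC2 (lift f e x₀) ⟨hx₀Ω, by
    change ‖f x₀ • e‖ ^ 2 = f x₀ ^ 2
    rw [norm_smul, he, mul_one, Real.norm_eq_abs, sq_abs]⟩
  set L := fderiv ℝ φ (lift f e x₀)
  have hstrict : HasStrictFDerivAt φ L (lift f e x₀) :=
    (hφ.contDiffAt (hV.mem_nhds hpV)).hasStrictFDerivAt (by norm_num)
  have hlin := h.linearized_isLittleO hx₀ he hV hpV hstrict hHV
  set c := L (WithLp.toLp 2 ((0 : Euc m), e)) with hcdef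
  let ι : Euc m →L[ℝ] Amb m (j + 1) :=
    (WithLp.prodContinuousLinearEquiv 2 ℝ (Euc m) (Euc (j + 1))).symm.toContinuousLinearMap.comp
      (ContinuousLinearMap.inl ℝ (Euc m) (Euc (j + 1)))
  have hι : ∀ w, ι w = WithLp.toLp 2 (w, (0 : Euc (j + 1))) := fun w => rfl
  have hc : c ≠ 0 := by
    intro hc0
    apply hd
    have hA : L.comp ι = 0 := by
      apply linearMap_eq_zero_of_isLittleO _ x₀
      refine hlin.congr_left fun q => ?_
      rw [hc0, mul_zero, add_zero]
      rfl
    have hB : ∀ v : Euc (j + 1), L (WithLp.toLp 2 ((0 : Euc m), v)) = 0 := by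
      intro v
      set w := v - ⟪e, v⟫ • e with hw
      have hew : ⟪e, w⟫ = 0 := by
        rw [hw, inner_sub_right, inner_smul_right, real_inner_self_eq_norm_sq, he]
        ring
      have hLw : L (WithLp.toLp 2 ((0 : Euc m), w)) = 0 := by
        by_cases hw0 : w = 0
        · rw [hw0]
          exact map_zero L
        · have hwn : ‖w‖ ≠ 0 := norm_ne_zero_iff.2 hw0
          have := exists_circle_tangent (v := ‖w‖⁻¹ • w) hx₀Ω he
            (by rw [norm_smul, norm_inv, norm_norm, inv_mul_cancel₀ hwn])
            (by rw [inner_smul_right, hew, mul_zero]) hpos.ne' hV hpV hstrict.hasFDerivAt hHV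
          have e1 : (WithLp.toLp 2 ((0 : Euc m), ‖w‖⁻¹ • w) : Amb m (j + 1)) =
              ‖w‖⁻¹ • WithLp.toLp 2 ((0 : Euc m), w) := by
            apply WithLp.ofLp_injective 2
            exact Prod.ext (smul_zero _).symm rfl
          rw [e1, map_smul, smul_eq_mul] at this
          exact (mul_eq_zero.1 this).resolve_left (inv_ne_zero hwn)
      have e2 : (WithLp.toLp 2 ((0 : Euc m), v) : Amb m (j + 1)) =
          WithLp.toLp 2 ((0 : Euc m), w) + ⟪e, v⟫ • WithLp.toLp 2 ((0 : Euc m), e) := by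
        apply WithLp.ofLp_injective 2
        refine Prod.ext ?_ ?_
        · change (0 : Euc m) = 0 + ⟪e, v⟫ • (0 : Euc m)
          simp
        · change v = w + ⟪e, v⟫ • e
          rw [hw]
          abel
      rw [e2, map_add, hLw, map_smul, ← hcdef, hc0, smul_zero, add_zero]
    ext p
    have e3 : p = ι p.fst + WithLp.toLp 2 ((0 : Euc m), p.snd) := by
      rw [hι]
      apply WithLp.ofLp_injective 2
      refine Prod.ext ?_ ?_
      · change p.fst = p.fst + 0
        simp
      · change p.snd = 0 + p.snd
        simp
    rw [e3, map_add, hB, add_zero]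
    exact congr($hA p.fst)
  refine ⟨-(c⁻¹ • L.comp ι), .of_isLittleO ?_⟩
  refine (hlin.const_mul_left c⁻¹).congr_left fun q => ?_
  simp only [neg_apply, smul_apply, ContinuousLinearMap.comp_apply, hι, smul_eq_mul]
  field_simp
  ring

end IsArrayBody

/-! ### Functions with gradient of unit length -/

section Eikonal

variable {E : Type*} [NormedAddCommGroup E] [NormedSpace ℝ E]

/-- A one-sided bound suffices, because it applies to both `w` and `-w`. -/
lemma HasFDerivAt.norm_le_of_sub_le {g : E → ℝ} {g' : E →L[ℝ] ℝ} {x : E} {c : ℝ} (hc : 0 ≤ c)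
    (hg : HasFDerivAt g g' x) (h : ∀ᶠ z in 𝓝 x, g z - g x ≤ c * ‖z - x‖) : ‖g'‖ ≤ c := by
  have key : ∀ w, g' w ≤ c * ‖w‖ := by
    intro w
    have h1 : HasDerivAt (fun t : ℝ => g (x + t • w)) (g' w) 0 := by
      have h2 : HasDerivAt (fun t : ℝ => x + t • w) ((1 : ℝ) • w) 0 :=
        ((hasDerivAt_id (0 : ℝ)).smul_const w).const_add x
      rw [one_smul] at h2
      have e : x = x + (0 : ℝ) • w := by simp
      rw [e] at hg
      exact hg.comp_hasDerivAt (0 : ℝ) h2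
    have h3 := h1.tendsto_slope_zero_right
    refine le_of_tendsto h3 ?_
    have hcont : ContinuousAt (fun t : ℝ => x + t • w) 0 := by fun_prop
    have h' : ∀ᶠ z in 𝓝 (x + (0 : ℝ) • w), g z - g x ≤ c * ‖z - x‖ := by simpa using h
    have hev : ∀ᶠ t in 𝓝 (0 : ℝ), g (x + t • w) - g x ≤ c * ‖(x + t • w) - x‖ :=
      hcont.eventually h'
    filter_upwards [hev.filter_mono nhdsWithin_le_nhds, self_mem_nhdsWithin] with t ht ht0
    have ht0 : 0 < t := ht0
    rw [add_sub_cancel_left, norm_smul, Real.norm_of_nonneg ht0.le] at ht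
    simp only [zero_add, zero_smul, add_zero, smul_eq_mul]
    rw [inv_mul_le_iff₀ ht0]
    linarith
  refine g'.opNorm_le_bound hc fun w => ?_
  rw [Real.norm_eq_abs, abs_le]
  have := key (-w)
  rw [map_neg, norm_neg] at this
  exact ⟨by linarith, key w⟩

/-- A nonnegative function with gradient of unit length wherever it is positive, apart from a peak
`p`, decays at least at unit rate from the peak. -/
lemma le_sub_norm_of_unit_gradient {Ω : Set E} (hΩ : IsCompact Ω) {g : E → ℝ}
    (hg : ContinuousOn g Ω) {p : E}
    (hgrad : ∀ y ∈ Ω, 0 < g y → y ≠ p → Ω ∈ 𝓝 y ∧ ∃ g' : E →L[ℝ] ℝ, HasFDerivAt g g' y ∧ ‖g'‖ = 1)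
    {x : E} (hx : x ∈ Ω) (hpos : 0 < g x) : g x ≤ g p - ‖x - p‖ := by
  have main : ∀ ε ∈ Ioo (0 : ℝ) 1, g x ≤ g p - (1 - ε) * ‖x - p‖ := by
    intro ε hε
    -- Maximize `g` minus a cone of slope `1 - ε` with vertex `x`. The maximum has `g > 0`, and away
    -- from `p` it would force the gradient of `g` to have norm at most `1 - ε`; so it is attained
    -- at `p`.
    have hcont : ContinuousOn (fun y => g y - (1 - ε) * ‖x - y‖) Ω :=
      hg.sub (by fun_prop)
    obtain ⟨y, hyΩ, hmax⟩ := hΩ.exists_isMaxOn ⟨x, hx⟩ hcont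
    have hxy : g x ≤ g y - (1 - ε) * ‖x - y‖ := by simpa using hmax hx
    have h1 : 0 ≤ (1 - ε) * ‖x - y‖ := mul_nonneg (by linarith [hε.2]) (norm_nonneg _)
    by_cases hyp : y = p
    · rwa [hyp] at hxy
    obtain ⟨hnhds, g', hg', hn⟩ := hgrad y hyΩ (by linarith) hyp
    have : ‖g'‖ ≤ 1 - ε := by
      apply hg'.norm_le_of_sub_le (by linarith [hε.2])
      filter_upwards [hnhds] with z hz
      have h2 : g z - (1 - ε) * ‖x - z‖ ≤ g y - (1 - ε) * ‖x - y‖ := hmax hz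
      have h3 : ‖x - z‖ ≤ ‖x - y‖ + ‖z - y‖ := by
        have := norm_sub_le (x - y) (z - y)
        rwa [sub_sub_sub_cancel_right] at this
      nlinarith [mul_le_mul_of_nonneg_left h3 (by linarith [hε.2] : 0 ≤ 1 - ε)]
    linarith [hε.1]
  have hlim : Tendsto (fun ε : ℝ => g p - (1 - ε) * ‖x - p‖) (𝓝[>] 0) (𝓝 (g p - (1 - 0) * ‖x - p‖)) := by
    have : Continuous fun ε : ℝ => g p - (1 - ε) * ‖x - p‖ := by fun_prop
    exact this.continuousAt.tendsto.mono_left nhdsWithin_le_nhds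
  rw [sub_zero, one_mul] at hlim
  refine ge_of_tendsto hlim ?_
  filter_upwards [Ioo_mem_nhdsGT (zero_lt_one' ℝ)] with ε hε using main ε hε

/-- Mean value theorem on the segment from `p` to `x`. Its open part lies in the interior by
convexity and avoids `p`; continuity covers an endpoint on the boundary. -/
lemma sub_norm_le_of_unit_gradient {Ω : Set E} (hΩ : Convex ℝ Ω) {g : E → ℝ}
    (hg : ContinuousOn g Ω) {p : E} (hp : p ∈ interior Ω)
    (hgrad : ∀ y ∈ interior Ω, y ≠ p → ∃ g' : E →L[ℝ] ℝ, HasFDerivAt g g' y ∧ ‖g'‖ = 1)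
    {x : E} (hx : x ∈ Ω) : g p - ‖x - p‖ ≤ g x := by
  rcases eq_or_ne x p with rfl | hxp
  · simp
  have hseg : ∀ t ∈ Icc (0 : ℝ) 1, p + t • (x - p) ∈ Ω := fun t ht =>
    hΩ.add_smul_sub_mem (interior_subset hp) hx ht
  have hint : ∀ t ∈ Ioo (0 : ℝ) 1, p + t • (x - p) ∈ interior Ω := by
    intro t ht
    have := hΩ.combo_interior_self_mem_interior hp hx (a := 1 - t) (b := t)
      (by linarith [ht.2]) ht.1.le (by ring)
    convert this using 1
    module
  have hcont : ContinuousOn (fun t : ℝ => g (p + t • (x - p))) (Icc 0 1) :=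
    hg.comp (by fun_prop) hseg
  have hd : ∀ t ∈ Ioo (0 : ℝ) 1, ∃ d, HasDerivAt (fun t : ℝ => g (p + t • (x - p))) d t ∧
      |d| ≤ ‖x - p‖ := by
    intro t ht
    have hne : p + t • (x - p) ≠ p := by
      intro h
      have : t • (x - p) = 0 := by simpa using h
      rcases smul_eq_zero.1 this with h | h
      · exact ht.1.ne' h
      · exact hxp (sub_eq_zero.1 h)
    obtain ⟨g', hg', hn⟩ := hgrad _ (hint t ht) hne
    have h2 : HasDerivAt (fun t : ℝ => p + t • (x - p)) ((1 : ℝ) • (x - p)) t :=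
      ((hasDerivAt_id t).smul_const (x - p)).const_add p
    refine ⟨g' ((1 : ℝ) • (x - p)), hg'.comp_hasDerivAt t h2, ?_⟩
    rw [one_smul]
    simpa [hn] using g'.le_opNorm (x - p)
  choose! d hd hdb using hd
  obtain ⟨t, ht, he⟩ := exists_hasDerivAt_eq_slope (fun t : ℝ => g (p + t • (x - p))) d zero_lt_one
    hcont hd
  have hb := abs_le.1 (hdb t ht)
  rw [he] at hb
  simp only [one_smul, zero_smul, add_zero, add_sub_cancel, sub_zero, div_one] at hb
  linarith [hb.1]

end Eikonal

/-! ### Uniqueness -/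

namespace IsArrayBody

variable {m j : ℕ} {Ω : Set (Euc m)} {f : Euc m → ℝ} {K : Set (Amb m (j + 1))}

lemma exists_density_eq_one (h : IsArrayBody Ω f K)
    (hA : IsArchimedeanWith m (j + 1) (unitSphereVol (j + 1)) (sphericalArray m (j + 1) Ω f))
    {x : Euc m} (hx : x ∈ interior Ω) : ∃ f' : Euc m →L[ℝ] ℝ, HasStrictFDerivAt f f' x ∧
      √(1 + ‖f'‖ ^ 2) * f x ^ j = 1 := by
  obtain ⟨f', hf'⟩ := h.exists_hasStrictFDerivAt hA.smooth hx
  refine ⟨f', hf', ?_⟩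
  have hpos := h.pos_of_mem_interior hx
  have key := density_eq_of_sphereBundle_measure_eq (V := Euc (j + 1)) (d := m) (j := j)
    (by simp) (by simp) (isOpen_interior.mem_nhds hx) (C := unitSphereVol (j + 1))
    (fun U hU hUm => by
      have hUΩ := hU.trans interior_subset
      rw [← sphericalArray_inter_preimage h.nonneg hUΩ]
      exact hA.app.2.2 U (by rwa [image_baseProj_sphericalArray h.nonneg]) hUm.nullMeasurableSet)
    hf' hpos
  rw [← unitSphereVol_succ] at key
  have h1 : ENNReal.ofReal (√(1 + ‖f'‖ ^ 2) * f x ^ j) = 1 := by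
    have h2 : ENNReal.ofReal (√(1 + ‖f'‖ ^ 2) * f x ^ j) * unitSphereVol (j + 1) =
        1 * unitSphereVol (j + 1) := by rw [key, one_mul]
    exact (ENNReal.mul_left_inj (unitSphereVol_ne_zero j) (unitSphereVol_ne_top j)).1 h2
  rwa [ENNReal.ofReal_eq_one] at h1

/-- The density equation solved for the gradient norm `n`. By the chain rule the left side is the
norm of the gradient of `scalingInv ∘ f`. -/
lemma scalingDensity_mul_eq_one (hj : 1 ≤ j) {y n : ℝ} (h0 : 0 < y) (h1 : y < 1) (hn : 0 ≤ n)
    (h : √(1 + n ^ 2) * y ^ j = 1) : scalingDensity j y * n = 1 := by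
  have hy : 0 < y ^ j := pow_pos h0 j
  have hpos := one_sub_pow_pos hj h0.le h1
  have h2 : (1 + n ^ 2) * (y ^ j) ^ 2 = 1 := by
    rw [← Real.sq_sqrt (by positivity : (0 : ℝ) ≤ 1 + n ^ 2), ← mul_pow, h, one_pow]
  have h3 : (y ^ j * n) ^ 2 = 1 - y ^ (2 * j) := by
    rw [mul_comm 2 j, pow_mul]
    linarith [h2, mul_pow (y ^ j) n 2]
  have h4 : √(1 - y ^ (2 * j)) = y ^ j * n := by
    rw [← h3, Real.sqrt_sq (by positivity)]
  have h5 : 0 < y ^ j * n := by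
    rw [← h4]
    exact Real.sqrt_pos.2 hpos
  rw [scalingDensity, h4, div_mul_eq_mul_div, div_self h5.ne']

/-- The base is a ball and the warping function is determined. -/
theorem eq_model (hm : 1 ≤ m) (hj : 1 ≤ j) (h : IsArrayBody Ω f K)
    (hA : IsArchimedeanWith m (j + 1) (unitSphereVol (j + 1)) (sphericalArray m (j + 1) Ω f)) :
    ∃ c : Euc m, Ω = Metric.closedBall c (scalingMax (j + 1)) ∧
      ∀ x ∈ Ω, f x = scalingFn (j + 1) (boundaryDist Ω x) := by
  have hM := scalingMax_pos hj
  have hΩ := h.isCompact_base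
  have hcont := h.continuousOn
  have hint : ∀ x ∈ Ω, 0 < f x → x ∈ interior Ω := fun x hx => h.mem_interior_of_pos hx
  -- The square root in the density is at least `1`, so `f^j` is at most `1`.
  have hle1 : ∀ x ∈ Ω, f x ≤ 1 := by
    intro x hx
    by_contra! hlt
    obtain ⟨f', -, hd⟩ := h.exists_density_eq_one hA (hint x hx (by linarith))
    have h1 : 1 ≤ √(1 + ‖f'‖ ^ 2) := Real.one_le_sqrt.2 (by nlinarith [norm_nonneg f'])
    have h2 : 1 < f x ^ j := one_lt_pow₀ hlt (by omega)
    nlinarith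
  obtain ⟨x₁, hx₁⟩ := h.interior_base_nonempty
  obtain ⟨p, hp, hmax⟩ := hΩ.exists_isMaxOn ⟨x₁, interior_subset hx₁⟩ hcont
  have hppos : 0 < f p := (h.pos_of_mem_interior hx₁).trans_le (hmax (interior_subset hx₁))
  have hpint := hint p hp hppos
  -- The gradient vanishes at the maximum, which reduces the density equation to `f p ^ j = 1`.
  have hfp : f p = 1 := by
    obtain ⟨f', hf', hd⟩ := h.exists_density_eq_one hA hpint
    have hloc : IsLocalMax f p := by
      filter_upwards [mem_interior_iff_mem_nhds.1 hpint] with x hx using hmax hx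
    have h0 : f' = 0 := hloc.hasFDerivAt_eq_zero hf'.hasFDerivAt
    rw [h0, norm_zero, zero_pow two_ne_zero, add_zero, Real.sqrt_one, one_mul] at hd
    exact (pow_eq_one_iff_of_nonneg hppos.le (by omega)).1 hd
  have hlt1 : ∀ x ∈ Ω, x ≠ p → f x < 1 := by
    intro x hx hne
    refine (hle1 x hx).lt_of_ne fun he => hne ?_
    exact h.eq_of_eq_of_forall_le hx hp (by rw [he, hfp]) fun z hz => hmax hz
  have hI : ∀ x ∈ Ω, f x ∈ Icc (0 : ℝ) 1 := fun x hx => ⟨h.nonneg x hx, hle1 x hx⟩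
  set g : Euc m → ℝ := fun x => scalingInv (j + 1) (f x) with hg
  have hgcont : ContinuousOn g Ω := (continuousOn_scalingInv hj).comp hcont hI
  have hgp : g p = scalingMax (j + 1) := by simp only [hg, hfp]; rfl
  have hg0 : ∀ x ∈ Ω, 0 ≤ g x := fun x hx => (scalingInv_mem hj (hI x hx)).1
  have hgpos : ∀ x ∈ Ω, 0 < f x → 0 < g x := by
    intro x hx hfx
    have := strictMonoOn_scalingInv hj ⟨le_rfl, zero_le_one⟩ (hI x hx) hfx
    rwa [scalingInv_zero] at this
  have hfpos : ∀ x ∈ Ω, 0 < g x → 0 < f x := by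
    intro x hx hgx
    refine (h.nonneg x hx).lt_of_ne fun he => ?_
    simp only [hg, ← he, scalingInv_zero] at hgx
    exact lt_irrefl _ hgx
  have hgrad : ∀ y ∈ interior Ω, y ≠ p → ∃ g' : Euc m →L[ℝ] ℝ, HasFDerivAt g g' y ∧ ‖g'‖ = 1 := by
    intro y hy hyp
    obtain ⟨f', hf', hd⟩ := h.exists_density_eq_one hA hy
    have y0 := h.pos_of_mem_interior hy
    have y1 := hlt1 y (interior_subset hy) hyp
    refine ⟨_, (hasDerivAt_scalingInv hj y0 y1).comp_hasFDerivAt y hf'.hasFDerivAt, ?_⟩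
    rw [norm_smul, Real.norm_of_nonneg (scalingDensity_pos hj y0 y1).le]
    exact scalingDensity_mul_eq_one hj y0 y1 (norm_nonneg _) hd
  have hupper : ∀ x ∈ interior Ω, g x ≤ scalingMax (j + 1) - ‖x - p‖ := by
    intro x hx
    rw [← hgp]
    refine le_sub_norm_of_unit_gradient hΩ hgcont (fun y hy hgy hyp => ?_) (interior_subset hx)
      (hgpos x (interior_subset hx) (h.pos_of_mem_interior hx))
    have hyint := hint y hy (hfpos y hy hgy)
    exact ⟨mem_interior_iff_mem_nhds.1 hyint, hgrad y hyint hyp⟩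
  have hlower : ∀ x ∈ Ω, scalingMax (j + 1) - ‖x - p‖ ≤ g x := by
    intro x hx
    rw [← hgp]
    exact sub_norm_le_of_unit_gradient h.convex_base hgcont hpint hgrad hx
  -- The upper bound is available where `g` is positive, that is on the interior. It confines the
  -- interior to a closed ball, and hence `Ω`, which lies in the closure of its interior.
  have hball : ∀ x ∈ Ω, ‖x - p‖ ≤ scalingMax (j + 1) := by
    intro x hx
    have hsub : Ω ⊆ closure (interior Ω) := by
      rw [h.convex_base.closure_interior_eq_closure_of_nonempty_interior ⟨p, hpint⟩]
      exact subset_closure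
    have hcl : closure (interior Ω) ⊆ Metric.closedBall p (scalingMax (j + 1)) := by
      refine closure_minimal (fun y hy => ?_) Metric.isClosed_closedBall
      have := hupper y hy
      have := hg0 y (interior_subset hy)
      rw [mem_closedBall_iff_norm]
      linarith
    exact mem_closedBall_iff_norm.1 (hcl (hsub hx))
  have heq : ∀ x ∈ Ω, g x = scalingMax (j + 1) - ‖x - p‖ := by
    intro x hx
    by_cases hfx : 0 < f x
    · exact le_antisymm (hupper x (hint x hx hfx)) (hlower x hx)
    · have h0 : g x = 0 := by
        have : f x = 0 := le_antisymm (not_lt.1 hfx) (h.nonneg x hx)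
        simp only [hg, this, scalingInv_zero]
      have := hlower x hx
      have := hball x hx
      linarith
  have hΩeq : Ω = Metric.closedBall p (scalingMax (j + 1)) := by
    ext y
    rw [mem_closedBall_iff_norm]
    refine ⟨hball y, fun hy => ?_⟩
    rcases eq_or_ne y p with rfl | hyp
    · exact hp
    -- The ray from `p` through `y` leaves `Ω` at a point where `f` and `g` vanish, hence at
    -- distance exactly `M_k` from `p`. So `y` lies between `p` and this point, and convexity puts
    -- it in `Ω`.
    obtain ⟨t, ht, hfr⟩ := exists_ray_mem_frontier hΩ hp (sub_ne_zero.2 hyp)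
    rw [hΩ.isClosed.frontier_eq] at hfr
    have hz : g (p + t • (y - p)) = 0 := by
      have h0 : ¬ 0 < f (p + t • (y - p)) := fun h0 => hfr.2 (hint _ hfr.1 h0)
      have : f (p + t • (y - p)) = 0 := le_antisymm (not_lt.1 h0) (h.nonneg _ hfr.1)
      simp only [hg, this, scalingInv_zero]
    have hn := heq _ hfr.1
    rw [hz, add_sub_cancel_left, norm_smul, Real.norm_of_nonneg ht] at hn
    have hyn : 0 < ‖y - p‖ := norm_pos_iff.2 (sub_ne_zero.2 hyp)
    have ht1 : 1 ≤ t := by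
      by_contra! hlt
      nlinarith
    have := h.convex_base.add_smul_sub_mem hp hfr.1 (t := t⁻¹)
      ⟨by positivity, inv_le_one_of_one_le₀ ht1⟩
    rwa [add_sub_cancel_left, inv_smul_smul₀ (by linarith), add_sub_cancel] at this
  refine ⟨p, hΩeq, fun x hx => ?_⟩
  have hxb : x ∈ Metric.closedBall p (scalingMax (j + 1)) := hΩeq ▸ hx
  rw [hΩeq, boundaryDist_closedBall hm hM hxb, dist_eq_norm, ← heq x hx,
    scalingFn_scalingInv hj (hI x hx)]

end IsArrayBody

/-! ### Normalization of the constant and classification up to similarity -/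

section Uniqueness

variable {m j : ℕ}

lemma sphericalArray_congr {k : ℕ} {Ω : Set (Euc m)} {f g : Euc m → ℝ} (h : ∀ x ∈ Ω, f x = g x) :
    sphericalArray m k Ω f = sphericalArray m k Ω g := by
  ext p
  refine and_congr_right fun hp => ?_
  rw [h _ hp]

/-- A spherical array over a ball of radius `M_k`, warped by `f_k` of the distance to the boundary,
is a translate of the model array. -/
lemma sphericalArray_eq_translate_modelArray (hm : 1 ≤ m) (hj : 1 ≤ j) {Ω : Set (Euc m)}
    {f : Euc m → ℝ} {c : Euc m} (hΩ : Ω = Metric.closedBall c (scalingMax (j + 1)))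
    (hf : ∀ x ∈ Ω, f x = scalingFn (j + 1) (boundaryDist Ω x)) :
    sphericalArray m (j + 1) Ω f = scaledCopy m (j + 1) 1 c (modelArray m (j + 1)) := by
  rw [modelArray_eq hm hj, scaledCopy_sphericalArray one_pos]
  have hball : (fun x => c + (1 : ℝ) • x) '' Metric.closedBall (0 : Euc m) (scalingMax (j + 1)) =
      Ω := by
    rw [hΩ]
    simp only [one_smul, image_add_left, Metric.preimage_add_left_closedBall, neg_neg,
      add_zero]
  rw [hball]
  refine sphericalArray_congr fun x hx => ?_
  rw [hf x hx, hΩ, boundaryDist_closedBall hm (scalingMax_pos hj) (hΩ ▸ hx)]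
  simp [modelWarp, dist_eq_norm]

lemma isArchimedeanWith_scaledCopy_modelArray (hm : 1 ≤ m) (hj : 1 ≤ j) {R : ℝ} (hR : 0 < R)
    (c : Euc m) :
    IsArchimedeanWith m (j + 1) (ENNReal.ofReal (R ^ j) * unitSphereVol (j + 1))
      (scaledCopy m (j + 1) R c (modelArray m (j + 1))) :=
  (isArchimedeanWith_modelArray hm hj).scale hR c

lemma isArchimedeanWith_unitSphereVol_iff (hm : 1 ≤ m) (hj : 1 ≤ j) {Ω : Set (Euc m)}
    {f : Euc m → ℝ} (hf : ∀ x ∈ Ω, 0 ≤ f x) :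
    IsArchimedeanWith m (j + 1) (unitSphereVol (j + 1)) (sphericalArray m (j + 1) Ω f) ↔
      ∃ c : Euc m, Ω = Metric.closedBall c (scalingMax (j + 1)) ∧
        ∀ x ∈ Ω, f x = scalingFn (j + 1) (boundaryDist Ω x) := by
  constructor
  · intro hA
    obtain ⟨K, hK, hint, hconv, hfr⟩ := hA.strictConvex
    exact IsArrayBody.eq_model hm hj ⟨hf, hK, hint, hconv, hfr⟩ hA
  · rintro ⟨c, hΩ, hc⟩
    rw [sphericalArray_eq_translate_modelArray hm hj hΩ hc]
    simpa using isArchimedeanWith_scaledCopy_modelArray hm hj one_pos c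

/-- The scaling ratio that turns the proportionality constant `C` into `σ`. -/
lemma exists_ofReal_pow_mul_eq {C σ : ℝ≥0∞} (hC0 : C ≠ 0) (hC : C ≠ ⊤) (hσ0 : σ ≠ 0) (hσ : σ ≠ ⊤)
    (hj : 1 ≤ j) : ∃ r : ℝ, 0 < r ∧ ENNReal.ofReal (r ^ j) * C = σ := by
  have hpos : 0 < (σ / C).toReal :=
    ENNReal.toReal_pos (ENNReal.div_ne_zero.2 ⟨hσ0, hC⟩) (ENNReal.div_ne_top hσ hC0)
  refine ⟨(σ / C).toReal ^ (1 / (j : ℝ)), Real.rpow_pos_of_pos hpos _, ?_⟩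
  have hj0 : (j : ℝ) ≠ 0 := by positivity
  rw [← Real.rpow_natCast, ← Real.rpow_mul hpos.le, one_div_mul_cancel hj0, Real.rpow_one,
    ENNReal.ofReal_toReal (ENNReal.div_ne_top hσ hC0), ENNReal.div_mul_cancel hC0 hC]

/-- Rescale so that the constant becomes the volume of the unit sphere, apply the normalized
classification, and undo the scaling by `r⁻¹`. -/
lemma IsArchimedean.exists_eq_scaledCopy (hm : 1 ≤ m) (hj : 1 ≤ j) {H : Set (Amb m (j + 1))}
    (hH : IsArchimedean m (j + 1) H) :
    ∃ (R : ℝ) (c : Euc m), 0 < R ∧ H = scaledCopy m (j + 1) R c (modelArray m (j + 1)) := by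
  obtain ⟨C, hC⟩ := hH
  obtain ⟨r, hr, hrC⟩ := exists_ofReal_pow_mul_eq hC.app.1 hC.app.2.1 (unitSphereVol_ne_zero j)
    (unitSphereVol_ne_top j) hj
  have hS := hC.scale hr 0
  rw [hrC] at hS
  obtain ⟨Ω, f, hf, heq⟩ := hS.array
  rw [heq] at hS
  obtain ⟨c, hΩ, hc⟩ := (isArchimedeanWith_unitSphereVol_iff hm hj hf).1 hS
  refine ⟨r⁻¹, r⁻¹ • c, inv_pos.2 hr, ?_⟩
  rw [sphericalArray_eq_translate_modelArray hm hj hΩ hc] at heq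
  have h := congrArg (scaledCopy m (j + 1) r⁻¹ 0) heq
  rwa [scaledCopy_scaledCopy, scaledCopy_scaledCopy, inv_mul_cancel₀ hr.ne', smul_zero, add_zero,
    scaledCopy_one_zero, mul_one, zero_add] at h

end Uniqueness

end

theorem theorem2 (n k : ℕ) (hn : 3 ≤ n) (hk : 2 ≤ k) (hkn : k ≤ n - 1) :
    -- existence
    IsArchimedeanWith (n - k) k (unitSphereVol k) (modelArray (n - k) k) ∧
    -- uniqueness up to scaling (and position of the centre in the base space)
    (∀ H : Set (Amb (n - k) k), IsArchimedean (n - k) k H ↔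
      ∃ (R : ℝ) (c : Euc (n - k)), 0 < R ∧ H = scaledCopy (n - k) k R c (modelArray (n - k) k)) ∧
    -- all arrays with the constant `Vol(S^(k-1)(1))`
    (∀ (Ω : Set (Euc (n - k))) (f : Euc (n - k) → ℝ), (∀ x ∈ Ω, 0 ≤ f x) →
      (IsArchimedeanWith (n - k) k (unitSphereVol k) (sphericalArray (n - k) k Ω f) ↔
        ∃ c : Euc (n - k), Ω = Metric.closedBall c (scalingMax k) ∧
          ∀ x ∈ Ω, f x = scalingFn k (boundaryDist Ω x))) := by
  -- Replaces the truncated subtractions in `k - 1` and `2 * k - 2` by `j` and `2 * j`.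
  obtain ⟨j, rfl⟩ : ∃ j, k = j + 1 := ⟨k - 1, by omega⟩
  have hj : 1 ≤ j := by omega
  have hm : 1 ≤ n - (j + 1) := by omega
  refine ⟨isArchimedeanWith_modelArray hm hj, fun H => ⟨fun hH => hH.exists_eq_scaledCopy hm hj, ?_⟩,
    fun Ω f hf => isArchimedeanWith_unitSphereVol_iff hm hj hf⟩
  rintro ⟨R, c, hR, rfl⟩
  exact ⟨_, isArchimedeanWith_scaledCopy_modelArray hm hj hR c⟩
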